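/- Let $W_{\mathbb R}=\mathbb R^{2N}$ be a real symplectic space, $\mathrm U\cong \mathrm U(N)$ the standard maximal compact subgroup of $\mathrm{Sp}(W_{\mathbb R})$, and let $(G,G')$ be a real reductive dual pair in $\mathrm{Sp}(W_{\mathbb R})$, i.e. two subgroups which act reductively on $W_{\mathbb R}$ and are each other's centralizers. Assume that $G$ and $G'$ are stable under the Cartan involution of $\mathrm{Sp}(W_{\mathbb R})$ attached to $\mathrm U$, so that $K=G\cap \mathrm U$ and $K'=G'\cap \mathrm U$ are maximal compact subgroups; let $\mathfrak g=\mathfrak k\oplus\mathfrak p$ and $\mathfrak g'=\mathfrak k'\oplus\mathfrak p'$ be the complexified Cartan decompositions. Let $\widetilde{\mathrm U}=\{(k,\zeta)\in \mathrm U(N)\times\mathbb C^\times:\zeta^2=\det k\}$ be the inverse image of $\mathrm U$ in the metaplectic double cover of $\mathrm{Sp}(W_{\mathbb R})$, let $\widetilde K,\widetilde K'\subset\widetilde{\mathrm U}$ be the inverse images of $K,K'$, and let $\mathscr Y=\mathbb C[W]$, $W\cong\mathbb C^N$, be the Fock model of the oscillator representation, a module for $\mathfrak{sp}(W_{\mathbb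 R})\otimes\mathbb C$ and $\widetilde{\mathrm U}$. Let $\rho'$ be an irreducible $(\mathfrak g',\widetilde K')$-module on a space $V_{\rho'}$, and let $V_{\rho'^*}=\mathrm{Hom}_{\mathbb C}(V_{\rho'},\mathbb C)_{\widetilde K'\text{-finite}}$ be its contragredient. A full theta lift of $\rho'$ is a $(\mathfrak g,\widetilde K)$-module $\Theta(\rho')$ with $$\mathscr Y\Big/\bigcap_{T\in\mathrm{Hom}_{\mathfrak g',\widetilde K'}(\mathscr Y,\rho')}\ker T\;\cong\;\rho'\otimes\Theta(\rho')$$ as modules for $(\mathfrak g',\widetilde K')$ and $(\mathfrak g,\widetilde K)$. For a module $V$ for $\mathfrak g'$ and $\widetilde K'$ put $V_{\mathfrak p'}=V/\mathrm{span}\{Xv: X\in\mathfrak p', v\in V\}$ and $V_{\mathfrak g',K'}=V/\mathrm{span}\{Xv,\ kv-v: X\in\mathfrak g',k\in\widetilde K', v\in V\}$. (If $\rho'$ is genuine, i.e. the nontrivial element of the kernel of $\widetilde K'\to K'$ acts by $-1$, then $\widetilde K'$ acts on $V_{\rho'^*}\otimes\mathscr Y$ through $K'$.) Then a full theta lift of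 $\rho'$ exists, it is unique up to isomorphism, and there are isomorphisms of $(\mathfrak g,\widetilde K)$-modules $$\Theta(\rho')\;\cong\;(V_{\rho'^*}\otimes\mathscr Y)_{\mathfrak g',K'}\;\cong\;\big((V_{\rho'^*}\otimes\mathscr Y)_{\mathfrak p'}\big)^{K'},$$ where $(\ )^{K'}$ denotes the vectors fixed by $\widetilde K'$, and $\mathfrak g$ and $\widetilde K$ act on the last two spaces through $\mathscr Y$. -/

import Mathlib

attribute [local instance 100] LieRing.ofAssociativeRing

open scoped Matrix TensorProduct ComplexConjugate

noncomputable section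

namespace ThetaLift

/-! ### The Weyl algebra acting on polynomials -/

/-- The space `ℂ[w₁, …, w_N]` of complex polynomials on `W ≅ ℂ^N`. -/
abbrev Fock (N : ℕ) : Type := MvPolynomial (Fin N) ℂ

/-- Multiplication by the coordinate `w_i`. -/
def mulW {N : ℕ} (i : Fin N) : Module.End ℂ (Fock N) :=
  LinearMap.mulLeft ℂ (MvPolynomial.X i)

/-- The partial derivative `∂/∂w_i`. -/
def diffW {N : ℕ} (i : Fin N) : Module.End ℂ (Fock N) :=
  (MvPolynomial.pderiv i).toLinearMap

/-- `∑ α_{ij} w_j ∂_i`. -/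
def opE {A : Type*} [Ring A] [Algebra ℂ A] {N : ℕ} (w d : Fin N → A)
    (α : Matrix (Fin N) (Fin N) ℂ) : A :=
  ∑ i, ∑ j, α i j • (w j * d i)

/-- `∑ c_{ij} x_i x_j`. -/
def opQ {A : Type*} [Ring A] [Algebra ℂ A] {N : ℕ} (x : Fin N → A)
    (c : Matrix (Fin N) (Fin N) ℂ) : A :=
  ∑ i, ∑ j, c i j • (x i * x j)

/-- `- ½ tr α - ∑ α_{ij} w_j ∂_i + ½ ∑ β_{ij} ∂_i ∂_j - ½ ∑ m_{ij} w_i w_j`. -/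
def weylOp {A : Type*} [Ring A] [Algebra ℂ A] {N : ℕ} (w d : Fin N → A)
    (α β m : Matrix (Fin N) (Fin N) ℂ) : A :=
  -((1 / 2 : ℂ) * α.trace) • (1 : A) - opE w d α
    + (1 / 2 : ℂ) • opQ d β - (1 / 2 : ℂ) • opQ w m

section Weyl

theorem lie_mulW_mulW {N : ℕ} (i j : Fin N) : ⁅mulW i, mulW j⁆ = 0 := by
  rw [LieRing.of_associative_ring_bracket, sub_eq_zero]
  exact LinearMap.ext fun f => mul_left_comm _ _ _

theorem lie_diffW_mulW {N : ℕ} (i j : Fin N) :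
    ⁅diffW i, mulW j⁆ = (if i = j then (1 : ℂ) else 0) • (1 : Module.End ℂ (Fock N)) := by
  rw [LieRing.of_associative_ring_bracket]
  refine LinearMap.ext fun f => ?_
  by_cases h : i = j
  · subst h; simp [mulW, diffW]
  · have hX : MvPolynomial.pderiv i (MvPolynomial.X j : Fock N) = 0 :=
      MvPolynomial.pderiv_X_of_ne (Ne.symm h)
    simp [mulW, diffW, h, hX]

theorem lie_diffW_diffW {N : ℕ} (i j : Fin N) :
    ⁅(diffW i : Module.End ℂ (Fock N)), diffW j⁆ = 0 := by
  have h : ⁅(MvPolynomial.pderiv i : Derivation ℂ (Fock N) (Fock N)),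
      (MvPolynomial.pderiv j : Derivation ℂ (Fock N) (Fock N))⁆ = 0 := by
    refine MvPolynomial.derivation_ext fun k => ?_
    classical
    rw [Derivation.commutator_apply]
    simp [MvPolynomial.pderiv_X, Pi.single_apply, apply_ite]
  rw [LieRing.of_associative_ring_bracket]
  refine LinearMap.ext fun f => ?_
  have := congrArg (fun D => D f) h
  simpa [Derivation.commutator_apply, diffW] using this

variable {A : Type*} [Ring A] [Algebra ℂ A] {N : ℕ} {w d : Fin N → A}

theorem lie_sum_smul_mul (a : A)
    (c : Matrix (Fin N) (Fin N) ℂ) (x y : Fin N → Fin N → A) :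
    ⁅a, ∑ i, ∑ j, c i j • (x i j * y i j)⁆
      = ∑ i, ∑ j, c i j • (⁅a, x i j⁆ * y i j) + ∑ i, ∑ j, c i j • (x i j * ⁅a, y i j⁆) := by
  simp only [LieRing.of_associative_ring_bracket, Finset.sum_mul, Finset.mul_sum,
    ← Finset.sum_sub_distrib, smul_mul_assoc, mul_smul_comm, ← smul_sub, ← Finset.sum_add_distrib,
    ← smul_add]
  refine Finset.sum_congr rfl fun i _ => Finset.sum_congr rfl fun j _ => ?_
  congr 1
  noncomm_ring

theorem sum_smul_mul_lie (a : A)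
    (c : Matrix (Fin N) (Fin N) ℂ) (x y : Fin N → Fin N → A) :
    ⁅∑ i, ∑ j, c i j • (x i j * y i j), a⁆
      = ∑ i, ∑ j, c i j • (⁅x i j, a⁆ * y i j) + ∑ i, ∑ j, c i j • (x i j * ⁅y i j, a⁆) := by
  rw [← lie_skew, lie_sum_smul_mul]
  simp only [← lie_skew a, neg_mul, mul_neg, smul_neg, Finset.sum_neg_distrib]
  abel

/-- The canonical commutation relations. -/
structure CCR (w d : Fin N → A) : Prop where
  ww : ∀ i j, ⁅w i, w j⁆ = 0
  dd : ∀ i j, ⁅d i, d j⁆ = 0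
  dw : ∀ i j, ⁅d i, w j⁆ = (if i = j then (1 : ℂ) else 0) • (1 : A)

theorem CCR.wd (h : CCR w d) (i j : Fin N) :
    ⁅w i, d j⁆ = -((if i = j then (1 : ℂ) else 0) • (1 : A)) := by
  rw [← lie_skew, h.dw]; simp [eq_comm]

theorem lie_opE_mulW (h : CCR w d) (α : Matrix (Fin N) (Fin N) ℂ) (k : Fin N) :
    ⁅opE w d α, w k⁆ = ∑ j, α k j • w j := by
  rw [opE, sum_smul_mul_lie]
  simp only [h.ww, h.dw, zero_mul, smul_zero, Finset.sum_const_zero, zero_add, mul_smul_comm,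
    mul_one]
  rw [Finset.sum_comm]
  simp

theorem lie_opE_diffW (h : CCR w d) (α : Matrix (Fin N) (Fin N) ℂ) (k : Fin N) :
    ⁅opE w d α, d k⁆ = -∑ i, α i k • d i := by
  rw [opE, sum_smul_mul_lie]
  simp only [h.dd, h.wd, mul_zero, smul_zero, Finset.sum_const_zero, add_zero, smul_mul_assoc,
    one_mul, neg_mul, smul_neg, Finset.sum_neg_distrib]
  simp

theorem lie_opD_mulW (h : CCR w d) {β : Matrix (Fin N) (Fin N) ℂ} (hβ : βᵀ = β) (k : Fin N) :
    ⁅opQ d β, w k⁆ = (2 : ℂ) • ∑ j, β k j • d j := by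
  have hs : ∀ i j, β i j = β j i := fun i j => by
    conv_lhs => rw [← hβ]
    rfl
  rw [opQ, sum_smul_mul_lie]
  simp only [h.dw, smul_mul_assoc, mul_smul_comm, one_mul, mul_one]
  simp only [ite_smul, one_smul, zero_smul, smul_ite, smul_zero,
    Finset.sum_ite_eq', Finset.mem_univ, if_true, two_smul]
  congr 1
  · rw [Finset.sum_comm]
    simp
  · exact Finset.sum_congr rfl fun i _ => by rw [hs]

theorem lie_opQ_self {x : Fin N → A} (h : ∀ i j, ⁅x i, x j⁆ = 0)
    (c : Matrix (Fin N) (Fin N) ℂ) (k : Fin N) : ⁅opQ x c, x k⁆ = 0 := by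
  rw [opQ, sum_smul_mul_lie]
  simp [h]

theorem lie_opE_opE (h : CCR w d) (α α' : Matrix (Fin N) (Fin N) ℂ) :
    ⁅opE w d α, opE w d α'⁆ = opE w d (α' * α) - opE w d (α * α') := by
  conv_lhs => rw [opE.eq_def w d α', lie_sum_smul_mul]
  simp only [lie_opE_mulW h, lie_opE_diffW h, mul_neg, smul_neg, Finset.sum_neg_distrib,
    ← sub_eq_add_neg]
  congr 1
  · simp only [opE, Matrix.mul_apply, Finset.sum_mul, Finset.smul_sum, Finset.sum_smul,
      smul_mul_assoc, smul_smul]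
    exact Finset.sum_congr rfl fun i _ => Finset.sum_comm
  · simp only [opE, Matrix.mul_apply, Finset.mul_sum, Finset.smul_sum, Finset.sum_smul,
      mul_smul_comm, smul_smul]
    rw [Finset.sum_congr rfl fun i _ => Finset.sum_comm, Finset.sum_comm]
    refine Finset.sum_congr rfl fun i _ => ?_
    rw [Finset.sum_comm]
    exact Finset.sum_congr rfl fun j _ => Finset.sum_congr rfl fun k _ => by rw [mul_comm]

theorem lie_opE_opD (h : CCR w d) (α β : Matrix (Fin N) (Fin N) ℂ) :
    ⁅opE w d α, opQ d β⁆ = -opQ d (α * β + β * αᵀ) := by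
  conv_lhs => rw [opQ.eq_def d β, lie_sum_smul_mul]
  simp only [lie_opE_diffW h, mul_neg, neg_mul, smul_neg, Finset.sum_neg_distrib, opQ,
    Matrix.add_apply, add_smul, Finset.sum_add_distrib, neg_add]
  congr 2
  · simp only [Matrix.mul_apply, Finset.sum_mul, Finset.smul_sum, Finset.sum_smul,
      smul_mul_assoc, smul_smul]
    rw [Finset.sum_congr rfl fun i _ => Finset.sum_comm, Finset.sum_comm]
    refine Finset.sum_congr rfl fun i _ => ?_
    rw [Finset.sum_comm]
    exact Finset.sum_congr rfl fun j _ => Finset.sum_congr rfl fun k _ => by rw [mul_comm]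
  · simp only [Matrix.mul_apply, Matrix.transpose_apply, Finset.mul_sum, Finset.smul_sum,
      Finset.sum_smul, mul_smul_comm, smul_smul]
    exact Finset.sum_congr rfl fun i _ => Finset.sum_comm

theorem lie_opE_opM (h : CCR w d) (α m : Matrix (Fin N) (Fin N) ℂ) :
    ⁅opE w d α, opQ w m⁆ = opQ w (αᵀ * m + m * α) := by
  conv_lhs => rw [opQ.eq_def w m, lie_sum_smul_mul]
  simp only [lie_opE_mulW h, opQ, Matrix.add_apply, add_smul, Finset.sum_add_distrib]
  congr 1
  · simp only [Matrix.mul_apply, Matrix.transpose_apply, Finset.sum_mul, Finset.smul_sum,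
      Finset.sum_smul, smul_mul_assoc, smul_smul]
    rw [Finset.sum_congr rfl fun i _ => Finset.sum_comm, Finset.sum_comm]
    refine Finset.sum_congr rfl fun i _ => ?_
    rw [Finset.sum_comm]
    exact Finset.sum_congr rfl fun j _ => Finset.sum_congr rfl fun k _ => by rw [mul_comm]
  · simp only [Matrix.mul_apply, Finset.mul_sum, Finset.smul_sum,
      Finset.sum_smul, mul_smul_comm, smul_smul]
    exact Finset.sum_congr rfl fun i _ => Finset.sum_comm

theorem lie_opQ_opQ {x : Fin N → A} (h : ∀ i j, ⁅x i, x j⁆ = 0)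
    (c c' : Matrix (Fin N) (Fin N) ℂ) : ⁅opQ x c, opQ x c'⁆ = 0 := by
  conv_lhs => rw [opQ.eq_def x c', lie_sum_smul_mul]
  simp [lie_opQ_self h]

theorem lie_opD_opM (h : CCR w d) {β m : Matrix (Fin N) (Fin N) ℂ} (hβ : βᵀ = β) (hm : mᵀ = m) :
    ⁅opQ d β, opQ w m⁆ = (4 : ℂ) • opE w d (β * m) + (2 * (β * m).trace) • 1 := by
  have hs : ∀ i j, β i j = β j i := fun i j => by
    conv_lhs => rw [← hβ]
    rfl
  have hms : ∀ i j, m i j = m j i := fun i j => by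
    conv_lhs => rw [← hm]
    rfl
  have h1 : ∑ i, ∑ j, m i j • ((∑ k, β i k • d k) * w j)
      = opE w d (β * m) + ((β * m).trace) • (1 : A) := by
    have hdw : ∀ k j : Fin N, d k * w j
        = w j * d k + (if k = j then (1 : ℂ) else 0) • (1 : A) := by
      intro k j
      rw [← h.dw, LieRing.of_associative_ring_bracket]; abel
    simp only [Finset.sum_mul, smul_mul_assoc, hdw, smul_add, Finset.smul_sum,
      Finset.sum_add_distrib]
    congr 1
    · simp only [opE, Matrix.mul_apply, Finset.sum_smul, smul_smul]
      rw [Finset.sum_congr rfl fun i _ => Finset.sum_comm, Finset.sum_comm]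
      refine Finset.sum_congr rfl fun i _ => ?_
      rw [Finset.sum_comm]
      exact Finset.sum_congr rfl fun j _ => Finset.sum_congr rfl fun k _ => by
        rw [mul_comm, hs]
    · simp only [ite_smul, one_smul, zero_smul, smul_ite, smul_zero, Finset.sum_ite_eq',
        Finset.mem_univ, if_true, smul_smul, Matrix.trace, Matrix.diag, Matrix.mul_apply,
        Finset.sum_smul]
      exact Finset.sum_congr rfl fun i _ => Finset.sum_congr rfl fun j _ => by
        rw [mul_comm, hms]
  have h2 : ∑ i, ∑ j, m i j • (w i * (∑ k, β j k • d k)) = opE w d (β * m) := by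
    simp only [Finset.mul_sum, mul_smul_comm, Finset.smul_sum, opE, Matrix.mul_apply,
      Finset.sum_smul, smul_smul]
    rw [Finset.sum_congr rfl fun i _ => Finset.sum_comm, Finset.sum_comm]
    refine Finset.sum_congr rfl fun i _ => ?_
    exact Finset.sum_congr rfl fun j _ => Finset.sum_congr rfl fun k _ => by
      rw [mul_comm, hs, hms]
  conv_lhs => rw [opQ.eq_def w m, lie_sum_smul_mul]
  simp only [lie_opD_mulW h hβ, smul_mul_assoc, mul_smul_comm]
  simp only [smul_comm _ (2 : ℂ), ← Finset.smul_sum]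
  rw [h1, h2]
  module

theorem opE_linear (a b : ℂ) (x y : Matrix (Fin N) (Fin N) ℂ) :
    opE w d (a • x + b • y) = a • opE w d x + b • opE w d y := by
  simp [opE, Finset.smul_sum, ← Finset.sum_add_distrib, add_smul, mul_smul]

theorem opQ_linear (x : Fin N → A) (a b : ℂ) (c c' : Matrix (Fin N) (Fin N) ℂ) :
    opQ x (a • c + b • c') = a • opQ x c + b • opQ x c' := by
  simp [opQ, Finset.smul_sum, ← Finset.sum_add_distrib, add_smul, mul_smul]

theorem weylOp_linear (a b : ℂ) (α β m α' β' m' : Matrix (Fin N) (Fin N) ℂ) :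
    weylOp w d (a • α + b • α') (a • β + b • β') (a • m + b • m')
      = a • weylOp w d α β m + b • weylOp w d α' β' m' := by
  simp only [weylOp, opE_linear, opQ_linear, Matrix.trace_add, Matrix.trace_smul,
    smul_eq_mul]
  module

theorem lie_weylOp (h : CCR w d) {α β m α' β' m' : Matrix (Fin N) (Fin N) ℂ}
    (hβ : βᵀ = β) (hm : mᵀ = m) (hβ' : β'ᵀ = β') (hm' : m'ᵀ = m') :
    ⁅weylOp w d α β m, weylOp w d α' β' m'⁆
      = weylOp w d (α * α' - α' * α + β * m' - β' * m)
          (α * β' + β' * αᵀ - (α' * β + β * α'ᵀ))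
          (α'ᵀ * m + m * α' - (αᵀ * m' + m' * α)) := by
  have e1 : ∀ x y : Matrix (Fin N) (Fin N) ℂ, opE w d (x + y) = opE w d x + opE w d y := by
    intro x y
    simpa using opE_linear (w := w) (d := d) 1 1 x y
  have e2 : ∀ x y : Matrix (Fin N) (Fin N) ℂ, opE w d (x - y) = opE w d x - opE w d y := by
    intro x y
    have := opE_linear (w := w) (d := d) 1 (-1) x y
    rwa [one_smul, one_smul, neg_one_smul, neg_one_smul, ← sub_eq_add_neg, ← sub_eq_add_neg] at this
  have d2 : ∀ x y : Matrix (Fin N) (Fin N) ℂ, opQ d (x - y) = opQ d x - opQ d y := by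
    intro x y
    have := opQ_linear d 1 (-1) x y
    rwa [one_smul, one_smul, neg_one_smul, neg_one_smul, ← sub_eq_add_neg, ← sub_eq_add_neg] at this
  have m2 : ∀ x y : Matrix (Fin N) (Fin N) ℂ, opQ w (x - y) = opQ w x - opQ w y := by
    intro x y
    have := opQ_linear w 1 (-1) x y
    rwa [one_smul, one_smul, neg_one_smul, neg_one_smul, ← sub_eq_add_neg, ← sub_eq_add_neg] at this
  have h1 : ⁅weylOp w d α β m, weylOp w d α' β' m'⁆
      = ⁅opE w d α, opE w d α'⁆ - (1 / 2 : ℂ) • ⁅opE w d α, opQ d β'⁆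
        + (1 / 2 : ℂ) • ⁅opE w d α, opQ w m'⁆
        + (1 / 2 : ℂ) • ⁅opE w d α', opQ d β⁆ - (1 / 2 : ℂ) • ⁅opE w d α', opQ w m⁆
        + (1 / 4 : ℂ) • ⁅opQ d β, opQ d β'⁆ - (1 / 4 : ℂ) • ⁅opQ d β, opQ w m'⁆
        + (1 / 4 : ℂ) • ⁅opQ d β', opQ w m⁆ + (1 / 4 : ℂ) • ⁅opQ w m, opQ w m'⁆ := by
    simp only [weylOp, LieRing.of_associative_ring_bracket, mul_add, add_mul, mul_sub, sub_mul,
      smul_mul_assoc, mul_smul_comm, mul_one, one_mul]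
    module
  rw [h1, lie_opE_opE h, lie_opE_opD h, lie_opE_opM h, lie_opE_opD h, lie_opE_opM h,
    lie_opQ_opQ h.dd, lie_opQ_opQ h.ww, lie_opD_opM h hβ hm', lie_opD_opM h hβ' hm]
  simp only [weylOp, e2, e1, d2, m2, Matrix.trace_add, Matrix.trace_sub, Matrix.trace_mul_comm α' α]
  module

end Weyl
/-! ### The symplectic group, its maximal compact subgroup and the double cover of the latter -/

/-- Real `2N × 2N` matrices, acting on `W_ℝ = ℝ^N ⊕ ℝ^N`. -/
abbrev Mat (N : ℕ) : Type := Matrix (Fin N ⊕ Fin N) (Fin N ⊕ Fin N) ℝ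

/-- The real symplectic group `Sp(W_ℝ)`, `W_ℝ = ℝ^{2N}`. -/
abbrev Sp (N : ℕ) : Type := Matrix.symplecticGroup (Fin N) ℝ

/-- Identify `ℝ^N ⊕ ℝ^N` with `W = ℂ^N` by `(x, y) ↦ z = x + i y`. Every real linear map has a
unique form `z ↦ α z + β z̄`; this is its complex linear part `α`. -/
def holPart {N : ℕ} (X : Mat N) : Matrix (Fin N) (Fin N) ℂ :=
  Matrix.of fun i j =>
    ⟨(X (.inl i) (.inl j) + X (.inr i) (.inr j)) / 2,
      (X (.inr i) (.inl j) - X (.inl i) (.inr j)) / 2⟩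

/-- The coefficient `β` of the conjugate linear part of the real linear map
`z ↦ α z + β z̄`. -/
def antiPart {N : ℕ} (X : Mat N) : Matrix (Fin N) (Fin N) ℂ :=
  Matrix.of fun i j =>
    ⟨(X (.inl i) (.inl j) - X (.inr i) (.inr j)) / 2,
      (X (.inr i) (.inl j) + X (.inl i) (.inr j)) / 2⟩

/-- Entrywise complex conjugation. -/
def conjM {N : ℕ} (M : Matrix (Fin N) (Fin N) ℂ) : Matrix (Fin N) (Fin N) ℂ :=
  M.map (starRingEnd ℂ)

section Parts

variable {N : ℕ}

theorem conjM_mul (x y : Matrix (Fin N) (Fin N) ℂ) : conjM (x * y) = conjM x * conjM y :=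
  Matrix.map_mul

theorem conjM_conjM (x : Matrix (Fin N) (Fin N) ℂ) : conjM (conjM x) = x := by
  ext i j; simp [conjM]

theorem conjM_transpose (x : Matrix (Fin N) (Fin N) ℂ) : conjM xᵀ = (conjM x)ᵀ := rfl

theorem holPart_linear (a b : ℝ) (X Y : Mat N) :
    holPart (a • X + b • Y) = (a : ℂ) • holPart X + (b : ℂ) • holPart Y := by
  ext i j
  apply Complex.ext <;> simp [holPart] <;> ring

theorem antiPart_linear (a b : ℝ) (X Y : Mat N) :
    antiPart (a • X + b • Y) = (a : ℂ) • antiPart X + (b : ℂ) • antiPart Y := by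
  ext i j
  apply Complex.ext <;> simp [antiPart] <;> ring

theorem holPart_sub (X Y : Mat N) : holPart (X - Y) = holPart X - holPart Y := by
  ext i j
  apply Complex.ext <;> simp [holPart] <;> ring

theorem antiPart_sub (X Y : Mat N) : antiPart (X - Y) = antiPart X - antiPart Y := by
  ext i j
  apply Complex.ext <;> simp [antiPart] <;> ring

theorem holPart_one : holPart (1 : Mat N) = 1 := by
  ext i j
  apply Complex.ext <;> by_cases h : i = j <;> simp [holPart, Matrix.one_apply, h]

theorem holPart_mul (X Y : Mat N) :
    holPart (X * Y) = holPart X * holPart Y + antiPart X * conjM (antiPart Y) := by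
  ext i j
  simp only [Matrix.add_apply, Matrix.mul_apply, ← Finset.sum_add_distrib]
  apply Complex.ext
  · simp only [holPart, antiPart, conjM, Matrix.of_apply, Matrix.mul_apply, Fintype.sum_sum_type,
      Complex.re_sum, ← Finset.sum_add_distrib, Finset.sum_div, Matrix.map_apply]
    refine Finset.sum_congr rfl fun k _ => ?_
    simp
    ring
  · simp only [holPart, antiPart, conjM, Matrix.of_apply, Matrix.mul_apply, Fintype.sum_sum_type,
      Complex.im_sum, ← Finset.sum_add_distrib, ← Finset.sum_sub_distrib, Finset.sum_div,
      Matrix.map_apply]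
    refine Finset.sum_congr rfl fun k _ => ?_
    simp
    ring

theorem antiPart_mul (X Y : Mat N) :
    antiPart (X * Y) = holPart X * antiPart Y + antiPart X * conjM (holPart Y) := by
  ext i j
  simp only [Matrix.add_apply, Matrix.mul_apply, ← Finset.sum_add_distrib]
  apply Complex.ext
  · simp only [holPart, antiPart, conjM, Matrix.of_apply, Matrix.mul_apply, Fintype.sum_sum_type,
      Complex.re_sum, ← Finset.sum_add_distrib, ← Finset.sum_sub_distrib, Finset.sum_div,
      Matrix.map_apply]
    refine Finset.sum_congr rfl fun k _ => ?_
    simp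
    ring
  · simp only [holPart, antiPart, conjM, Matrix.of_apply, Matrix.mul_apply, Fintype.sum_sum_type,
      Complex.im_sum, ← Finset.sum_add_distrib, Finset.sum_div,
      Matrix.map_apply]
    refine Finset.sum_congr rfl fun k _ => ?_
    simp
    ring

theorem holPart_transpose (X : Mat N) : holPart Xᵀ = conjM (holPart X)ᵀ := by
  ext i j
  apply Complex.ext <;> simp [holPart, conjM]
  ring

end Parts

/-- The maximal compact subgroup `U = Sp(W_ℝ) ∩ O(2N) ≅ U(N)` of `Sp(W_ℝ)`. -/
def maxU (N : ℕ) : Subgroup (Sp N) where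
  carrier := {g | (g : Mat N)ᵀ * (g : Mat N) = 1}
  one_mem' := by simp
  mul_mem' {a b} ha hb := by
    have ha' : (a : Mat N)ᵀ * (a : Mat N) = 1 := ha
    have hb' : (b : Mat N)ᵀ * (b : Mat N) = 1 := hb
    change ((a : Mat N) * (b : Mat N))ᵀ * ((a : Mat N) * (b : Mat N)) = 1
    rw [Matrix.transpose_mul, Matrix.mul_assoc, ← Matrix.mul_assoc _ (a : Mat N), ha',
      Matrix.one_mul, hb']
  inv_mem' {a} ha := by
    have ha' : (a : Mat N)ᵀ * (a : Mat N) = 1 := ha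
    change ((a⁻¹ : Sp N) : Mat N)ᵀ * ((a⁻¹ : Sp N) : Mat N) = 1
    rw [SymplecticGroup.coe_inv', Matrix.inv_eq_left_inv ha', Matrix.transpose_transpose]
    exact mul_eq_one_comm.mp ha'

section

variable {N : ℕ}

theorem antiPart_of_mem_maxU {g : Sp N} (hg : g ∈ maxU N) : antiPart (g : Mat N) = 0 := by
  have h1 : (g : Mat N)ᵀ * (g : Mat N) = 1 := hg
  have h2 : (g : Mat N)ᵀ * Matrix.J (Fin N) ℝ * (g : Mat N) = Matrix.J (Fin N) ℝ :=
    SymplecticGroup.mem_iff'.mp g.2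
  have h3 : Matrix.J (Fin N) ℝ * (g : Mat N) = (g : Mat N) * Matrix.J (Fin N) ℝ := by
    have h4 : (g : Mat N) * (g : Mat N)ᵀ = 1 := mul_eq_one_comm.mp h1
    calc Matrix.J (Fin N) ℝ * (g : Mat N)
        = ((g : Mat N) * (g : Mat N)ᵀ) * (Matrix.J (Fin N) ℝ * (g : Mat N)) := by
          rw [h4, Matrix.one_mul]
      _ = (g : Mat N) * ((g : Mat N)ᵀ * Matrix.J (Fin N) ℝ * (g : Mat N)) := by
          simp only [Matrix.mul_assoc]
      _ = _ := by rw [h2]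
  ext i j
  have e1 := congrFun (congrFun h3 (.inl i)) (.inl j)
  have e2 := congrFun (congrFun h3 (.inl i)) (.inr j)
  simp [Matrix.mul_apply, Matrix.J, Fintype.sum_sum_type, Matrix.one_apply] at e1 e2
  apply Complex.ext <;> simp [antiPart] <;> linarith

theorem holPart_mul_of_mem_maxU {g : Sp N} (hg : g ∈ maxU N) (X : Mat N) :
    holPart ((g : Mat N) * X) = holPart (g : Mat N) * holPart X := by
  rw [holPart_mul, antiPart_of_mem_maxU hg, Matrix.zero_mul, add_zero]

theorem holPart_mul_inv {g : Sp N} (hg : g ∈ maxU N) :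
    holPart (g : Mat N) * holPart ((g⁻¹ : Sp N) : Mat N) = 1 := by
  rw [← holPart_mul_of_mem_maxU hg, ← Submonoid.coe_mul, mul_inv_cancel, Submonoid.coe_one,
    holPart_one]

theorem conjM_holPart_inv {g : Sp N} (hg : g ∈ maxU N) :
    conjM (holPart ((g⁻¹ : Sp N) : Mat N)) = (holPart (g : Mat N))ᵀ := by
  have hg' : (g : Mat N)ᵀ * (g : Mat N) = 1 := hg
  rw [SymplecticGroup.coe_inv', Matrix.inv_eq_left_inv hg', holPart_transpose, conjM_conjM]

end

/-- The inverse image `Ũ` of `U` in the metaplectic double cover of `Sp(W_ℝ)`: the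
`det^{1/2}`-cover, consisting of the pairs `(k, ζ)` with `k ∈ U ≅ U(N)` and `ζ² = det k`,
where `det` is the determinant of `k` acting on the complex vector space `W = ℂ^N`. -/
def utilde (N : ℕ) : Subgroup (Sp N × ℂˣ) where
  carrier := {p | p.1 ∈ maxU N ∧ (p.2 : ℂ) ^ 2 = (holPart (p.1 : Mat N)).det}
  one_mem' := ⟨one_mem _, by simp [holPart_one]⟩
  mul_mem' {a b} ha hb := ⟨mul_mem ha.1 hb.1, by
    change ((a.2 * b.2 : ℂˣ) : ℂ) ^ 2 = (holPart ((a.1 : Mat N) * (b.1 : Mat N))).det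
    rw [holPart_mul_of_mem_maxU ha.1, Matrix.det_mul, ← ha.2, ← hb.2, Units.val_mul, mul_pow]⟩
  inv_mem' {a} ha := ⟨inv_mem ha.1, by
    have h := congrArg Matrix.det (holPart_mul_inv ha.1)
    rw [Matrix.det_mul, ← ha.2, Matrix.det_one] at h
    change ((a.2⁻¹ : ℂˣ) : ℂ) ^ 2 = (holPart ((a.1⁻¹ : Sp N) : Mat N)).det
    rw [Units.val_inv_eq_inv_val, inv_pow]
    exact inv_eq_of_mul_eq_one_right h⟩

/-! ### The Fock model -/

theorem ccr_fock (N : ℕ) : CCR (mulW (N := N)) diffW :=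
  ⟨lie_mulW_mulW, lie_diffW_diffW, lie_diffW_mulW⟩

/-- The substitution `f ↦ (w ↦ f (a w))` on polynomials. -/
def substW {N : ℕ} (a : Matrix (Fin N) (Fin N) ℂ) : Fock N →ₐ[ℂ] Fock N :=
  MvPolynomial.aeval fun i => ∑ j, a i j • (MvPolynomial.X j : Fock N)

theorem substW_mul {N : ℕ} (a b : Matrix (Fin N) (Fin N) ℂ) :
    substW (a * b) = (substW b).comp (substW a) := by
  refine MvPolynomial.algHom_ext fun i => ?_
  simp only [substW, MvPolynomial.aeval_X, AlgHom.comp_apply, map_sum, map_smul, Finset.smul_sum,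
    Matrix.mul_apply, Finset.sum_smul, mul_smul]
  exact Finset.sum_comm

theorem substW_one {N : ℕ} : substW (1 : Matrix (Fin N) (Fin N) ℂ) = AlgHom.id ℂ _ := by
  refine MvPolynomial.algHom_ext fun i => ?_
  simp [substW, Matrix.one_apply]

/-- The action of `Ũ` on the Fock model: `((k, ζ) f)(w) = ζ⁻¹ f (k⁻¹ w)`. -/
def fockU (N : ℕ) : utilde N →* Module.End ℂ (Fock N) where
  toFun p := ((p.1.2⁻¹ : ℂˣ) : ℂ) • (substW (holPart ((p.1.1⁻¹ : Sp N) : Mat N))).toLinearMap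
  map_one' := by
    have h : holPart (((1 : Sp N)⁻¹ : Sp N) : Mat N) = 1 := by
      rw [inv_one, Submonoid.coe_one, holPart_one]
    refine LinearMap.ext fun f => ?_
    change ((1⁻¹ : ℂˣ) : ℂ) • substW (holPart (((1 : Sp N)⁻¹ : Sp N) : Mat N)) f = f
    rw [h, substW_one]
    simp
  map_mul' p q := by
    have h : holPart (((p.1.1 * q.1.1 : Sp N)⁻¹ : Sp N) : Mat N)
        = holPart ((q.1.1⁻¹ : Sp N) : Mat N) * holPart ((p.1.1⁻¹ : Sp N) : Mat N) := by
      rw [mul_inv_rev, Submonoid.coe_mul, holPart_mul_of_mem_maxU (inv_mem q.2.1)]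
    refine LinearMap.ext fun f => ?_
    change (((p.1.2 * q.1.2)⁻¹ : ℂˣ) : ℂ) • substW (holPart (((p.1.1 * q.1.1 : Sp N)⁻¹ : Sp N) :
        Mat N)) f = ((p.1.2⁻¹ : ℂˣ) : ℂ) • substW (holPart ((p.1.1⁻¹ : Sp N) : Mat N))
          (((q.1.2⁻¹ : ℂˣ) : ℂ) • substW (holPart ((q.1.1⁻¹ : Sp N) : Mat N)) f)
    rw [h, substW_mul, map_smul, smul_smul, mul_inv_rev, mul_comm, Units.val_mul, mul_comm]
    rfl

theorem mem_sp_iff {N : ℕ} {X : Mat N} : X ∈ LieAlgebra.Symplectic.sp (Fin N) ℝ ↔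
    Xᵀ * Matrix.J (Fin N) ℝ = Matrix.J (Fin N) ℝ * (-X) := by
  rw [LieAlgebra.Symplectic.sp, mem_skewAdjointMatricesLieSubalgebra,
    mem_skewAdjointMatricesSubmodule]
  rfl

theorem sp_blocks {N : ℕ} {X : Mat N} (hX : X ∈ LieAlgebra.Symplectic.sp (Fin N) ℝ)
    (i j : Fin N) :
    X (.inl i) (.inl j) = -X (.inr j) (.inr i) ∧ X (.inl i) (.inr j) = X (.inl j) (.inr i) ∧
      X (.inr i) (.inl j) = X (.inr j) (.inl i) := by
  rw [mem_sp_iff] at hX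
  have e1 := congrFun (congrFun hX (.inl i)) (.inl j)
  have e2 := congrFun (congrFun hX (.inr i)) (.inr j)
  have e3 := congrFun (congrFun hX (.inl j)) (.inr i)
  simp [Matrix.mul_apply, Matrix.J, Fintype.sum_sum_type, Matrix.one_apply] at e1 e2 e3
  exact ⟨by linarith, by linarith, by linarith⟩

theorem antiPart_symm {N : ℕ} {X : Mat N} (hX : X ∈ LieAlgebra.Symplectic.sp (Fin N) ℝ) :
    (antiPart X)ᵀ = antiPart X := by
  ext i j
  have h := sp_blocks hX i j
  have h' := sp_blocks hX j i
  apply Complex.ext <;> simp [antiPart] <;> linarith [h.1, h.2.1, h.2.2, h'.1]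

theorem conjM_holPart_sp {N : ℕ} {X : Mat N} (hX : X ∈ LieAlgebra.Symplectic.sp (Fin N) ℝ) :
    conjM (holPart X) = -(holPart X)ᵀ := by
  ext i j
  have h := sp_blocks hX i j
  have h' := sp_blocks hX j i
  apply Complex.ext <;> simp [holPart, conjM] <;> linarith [h.1, h.2.1, h.2.2, h'.1]

/-- The operator by which a matrix `X`, acting on `W = ℂ^N` by `z ↦ α z + β z̄`, acts in the
Fock model: `- ½ tr α - ∑ α_{ij} w_j ∂_i + ½ ∑ β_{ij} ∂_i ∂_j - ½ ∑ β̄_{ij} w_i w_j`. -/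
def fockOp {N : ℕ} (X : Mat N) : Module.End ℂ (Fock N) :=
  weylOp mulW diffW (holPart X) (antiPart X) (conjM (antiPart X))

theorem lie_fockOp {N : ℕ} {X Y : Mat N} (hX : X ∈ LieAlgebra.Symplectic.sp (Fin N) ℝ)
    (hY : Y ∈ LieAlgebra.Symplectic.sp (Fin N) ℝ) :
    ⁅fockOp X, fockOp Y⁆ = fockOp ⁅X, Y⁆ := by
  have c1 : ∀ {M : Matrix (Fin N) (Fin N) ℂ}, Mᵀ = M → (conjM M)ᵀ = conjM M := by
    intro M h
    rw [← conjM_transpose, h]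
  rw [fockOp, fockOp, lie_weylOp (ccr_fock N) (antiPart_symm hX) (c1 (antiPart_symm hX))
    (antiPart_symm hY) (c1 (antiPart_symm hY)), fockOp]
  have hα : holPart ⁅X, Y⁆ = holPart X * holPart Y - holPart Y * holPart X
      + antiPart X * conjM (antiPart Y) - antiPart Y * conjM (antiPart X) := by
    rw [LieRing.of_associative_ring_bracket, holPart_sub, holPart_mul, holPart_mul]
    abel
  have hβ : antiPart ⁅X, Y⁆ = holPart X * antiPart Y + antiPart Y * (holPart X)ᵀ
      - (holPart Y * antiPart X + antiPart X * (holPart Y)ᵀ) := by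
    rw [LieRing.of_associative_ring_bracket, antiPart_sub, antiPart_mul, antiPart_mul,
      conjM_holPart_sp hX, conjM_holPart_sp hY, Matrix.mul_neg, Matrix.mul_neg]
    abel
  have hm : conjM (antiPart ⁅X, Y⁆) = (holPart Y)ᵀ * conjM (antiPart X)
      + conjM (antiPart X) * holPart Y
      - ((holPart X)ᵀ * conjM (antiPart Y) + conjM (antiPart Y) * holPart X) := by
    have cs : ∀ x y : Matrix (Fin N) (Fin N) ℂ, conjM (x - y) = conjM x - conjM y := by
      intro x y; ext i j; simp [conjM]
    have ca : ∀ x y : Matrix (Fin N) (Fin N) ℂ, conjM (x + y) = conjM x + conjM y := by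
      intro x y; ext i j; simp [conjM]
    rw [LieRing.of_associative_ring_bracket, antiPart_sub, antiPart_mul, antiPart_mul, cs, ca, ca,
      conjM_mul, conjM_mul, conjM_mul, conjM_mul, conjM_conjM, conjM_conjM, conjM_holPart_sp hX,
      conjM_holPart_sp hY, Matrix.neg_mul, Matrix.neg_mul]
    abel
  rw [hm, hα, hβ]

/-- The action of the Lie algebra `sp(W_ℝ)` on the Fock model. -/
def fockSp (N : ℕ) : LieAlgebra.Symplectic.sp (Fin N) ℝ →ₗ⁅ℝ⁆ Module.End ℂ (Fock N) where
  toFun X := fockOp (X : Mat N)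
  map_add' X Y := by
    have h1 := holPart_linear 1 1 (X : Mat N) Y
    have h2 := antiPart_linear 1 1 (X : Mat N) Y
    simp only [one_smul, Complex.ofReal_one] at h1 h2
    have h3 : conjM (antiPart (X : Mat N) + antiPart (Y : Mat N))
        = conjM (antiPart (X : Mat N)) + conjM (antiPart (Y : Mat N)) := by
      ext i j; simp [conjM]
    have := weylOp_linear (w := mulW) (d := diffW) 1 1 (holPart (X : Mat N)) (antiPart (X : Mat N))
      (conjM (antiPart (X : Mat N))) (holPart (Y : Mat N)) (antiPart (Y : Mat N))
      (conjM (antiPart (Y : Mat N)))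
    simp only [one_smul] at this
    change fockOp ((X : Mat N) + (Y : Mat N)) = _
    rw [fockOp, h1, h2, h3, this]
    rfl
  map_smul' c X := by
    have h1 := holPart_linear c 0 (X : Mat N) X
    have h2 := antiPart_linear c 0 (X : Mat N) X
    simp only [zero_smul, add_zero, Complex.ofReal_zero] at h1 h2
    have h3 : conjM ((c : ℂ) • antiPart (X : Mat N)) = (c : ℂ) • conjM (antiPart (X : Mat N)) := by
      ext i j; simp [conjM]
    have := weylOp_linear (w := mulW) (d := diffW) (c : ℂ) 0 (holPart (X : Mat N))
      (antiPart (X : Mat N)) (conjM (antiPart (X : Mat N))) (holPart (X : Mat N))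
      (antiPart (X : Mat N)) (conjM (antiPart (X : Mat N)))
    simp only [zero_smul, add_zero] at this
    change fockOp (c • (X : Mat N)) = _
    rw [fockOp, h1, h2, h3, this]
    rfl
  map_lie' {X Y} := (lie_fockOp X.2 Y.2).symm

section Equivariance

variable {N : ℕ}

theorem weylOp_intertwine {A : Type*} [Ring A] [Algebra ℂ A] {w d : Fin N → A} {S : A}
    {k k' : Matrix (Fin N) (Fin N) ℂ} (hk : k' * k = 1)
    (hw : ∀ i, S * w i = (∑ j, k' i j • w j) * S) (hd : ∀ i, S * d i = (∑ j, k j i • d j) * S)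
    (α β m : Matrix (Fin N) (Fin N) ℂ) :
    S * weylOp w d α β m = weylOp w d (k * α * k') (k * β * kᵀ) (k'ᵀ * m * k') * S := by
  have gen : ∀ (x y : Fin N → A) (a b c : Matrix (Fin N) (Fin N) ℂ),
      (∀ i, S * x i = (∑ j, a i j • x j) * S) → (∀ i, S * y i = (∑ j, b i j • y j) * S) →
      S * (∑ i, ∑ j, c i j • (x i * y j))
        = (∑ i, ∑ j, (aᵀ * c * b) i j • (x i * y j)) * S := by
    intro x y a b c hx hy
    have e : ∀ i j, S * (x i * y j)
        = (∑ p, ∑ q, (a i p * b j q) • (x p * y q)) * S := by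
      intro i j
      rw [← mul_assoc, hx, mul_assoc, hy, ← mul_assoc]
      congr 1
      rw [Finset.sum_mul_sum]
      refine Finset.sum_congr rfl fun p _ => Finset.sum_congr rfl fun q _ => ?_
      rw [smul_mul_assoc, mul_smul_comm, smul_smul]
    have e' : S * (∑ i, ∑ j, c i j • (x i * y j))
        = (∑ i, ∑ j, c i j • ∑ p, ∑ q, (a i p * b j q) • (x p * y q)) * S := by
      rw [Finset.mul_sum, Finset.sum_mul]
      refine Finset.sum_congr rfl fun i _ => ?_
      rw [Finset.mul_sum, Finset.sum_mul]
      refine Finset.sum_congr rfl fun j _ => ?_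
      rw [mul_smul_comm, e, smul_mul_assoc]
    rw [e']
    congr 1
    simp only [Finset.smul_sum, smul_smul, Matrix.mul_apply, Matrix.transpose_apply,
      Finset.sum_mul, Finset.sum_smul]
    calc ∑ i, ∑ j, ∑ p, ∑ q, (c i j * (a i p * b j q)) • (x p * y q)
        = ∑ i, ∑ p, ∑ j, ∑ q, (c i j * (a i p * b j q)) • (x p * y q) :=
          Finset.sum_congr rfl fun i _ => Finset.sum_comm
      _ = ∑ p, ∑ i, ∑ j, ∑ q, (c i j * (a i p * b j q)) • (x p * y q) := Finset.sum_comm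
      _ = ∑ p, ∑ i, ∑ q, ∑ j, (c i j * (a i p * b j q)) • (x p * y q) :=
          Finset.sum_congr rfl fun p _ => Finset.sum_congr rfl fun i _ => Finset.sum_comm
      _ = ∑ p, ∑ q, ∑ i, ∑ j, (c i j * (a i p * b j q)) • (x p * y q) :=
          Finset.sum_congr rfl fun p _ => Finset.sum_comm
      _ = ∑ p, ∑ q, ∑ j, ∑ i, (a i p * c i j * b j q) • (x p * y q) := by
          refine Finset.sum_congr rfl fun p _ => Finset.sum_congr rfl fun q _ => ?_
          rw [Finset.sum_comm]
          refine Finset.sum_congr rfl fun j _ => Finset.sum_congr rfl fun i _ => ?_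
          congr 1
          ring
  have hE : S * opE w d α = opE w d (k * α * k') * S := by
    have h := gen w d k' kᵀ αᵀ hw hd
    have e : ∀ a : Matrix (Fin N) (Fin N) ℂ,
        opE w d a = ∑ i, ∑ j, aᵀ i j • (w i * d j) := fun a => Finset.sum_comm
    rw [e, e, h]
    simp only [Matrix.transpose_mul, Matrix.mul_assoc]
  have hD : S * opQ d β = opQ d (k * β * kᵀ) * S := by
    have h := gen d d kᵀ kᵀ β hd hd
    rwa [Matrix.transpose_transpose] at h
  have hM : S * opQ w m = opQ w (k'ᵀ * m * k') * S := gen w w k' k' m hw hw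
  have ht : (k * α * k').trace = α.trace := by
    rw [Matrix.trace_mul_comm, ← Matrix.mul_assoc, hk, Matrix.one_mul]
  simp only [weylOp, mul_add, mul_sub, add_mul, sub_mul, mul_smul_comm, smul_mul_assoc, hE, hD, hM,
    ht, mul_one, one_mul]

theorem substW_X_mul (a : Matrix (Fin N) (Fin N) ℂ) (i : Fin N) (f : Fock N) :
    substW a (mulW i f) = ∑ j, a i j • mulW j (substW a f) := by
  have h : substW a (MvPolynomial.X i) = ∑ j, a i j • (MvPolynomial.X j : Fock N) := by
    rw [substW, MvPolynomial.aeval_X]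
  rw [mulW, LinearMap.mulLeft_apply, map_mul, h, Finset.sum_mul]
  refine Finset.sum_congr rfl fun j _ => ?_
  rw [smul_mul_assoc, mulW, LinearMap.mulLeft_apply]

theorem substW_mulW (a : Matrix (Fin N) (Fin N) ℂ) (i : Fin N) :
    ((substW a).toLinearMap : Module.End ℂ (Fock N)) * mulW i
      = (∑ j, a i j • mulW j) * ((substW a).toLinearMap : Module.End ℂ (Fock N)) := by
  refine LinearMap.ext fun f => ?_
  rw [Module.End.mul_apply, Module.End.mul_apply, LinearMap.sum_apply]
  exact substW_X_mul a i f

theorem diffW_substW (a : Matrix (Fin N) (Fin N) ℂ) (i : Fin N) (f : Fock N) :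
    diffW i (substW a f) = ∑ j, a j i • substW a (diffW j f) := by
  induction f using MvPolynomial.induction_on with
  | C c => simp [diffW, substW]
  | add p q hp hq => simp only [map_add, hp, hq, smul_add, Finset.sum_add_distrib]
  | mul_X p k hp =>
    have hX : diffW i (substW a (MvPolynomial.X k)) = MvPolynomial.C (a k i) := by
      classical
      simp [diffW, substW, MvPolynomial.pderiv_X, Pi.single_apply, MvPolynomial.smul_eq_C_mul]
    have hl : ∀ (l : Fin N) (f g : Fock N), diffW l (f * g) = diffW l f * g + f * diffW l g := by
      intro l f g
      have := (MvPolynomial.pderiv l : Derivation ℂ (Fock N) (Fock N)).leibniz f g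
      rw [smul_eq_mul, smul_eq_mul] at this
      rw [add_comm, mul_comm (diffW l f)]
      exact this
    have hX' : ∀ l, (diffW l (MvPolynomial.X k) : Fock N) = if k = l then 1 else 0 := by
      intro l
      classical
      simp [diffW, MvPolynomial.pderiv_X, Pi.single_apply]
    rw [map_mul, hl, hp, hX]
    simp only [hl, hX', map_add, map_mul, smul_add, Finset.sum_add_distrib, Finset.sum_mul,
      smul_mul_assoc]
    congr 1
    rw [Finset.sum_eq_single k]
    · simp [MvPolynomial.smul_eq_C_mul, mul_comm]
    · intro l _ hl
      simp [Ne.symm hl]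
    · simp

theorem substW_diffW {k k' : Matrix (Fin N) (Fin N) ℂ} (h : k' * k = 1) (i : Fin N) :
    ((substW k').toLinearMap : Module.End ℂ (Fock N)) * diffW i
      = (∑ j, k j i • diffW j) * ((substW k').toLinearMap : Module.End ℂ (Fock N)) := by
  refine LinearMap.ext fun f => ?_
  change substW k' (diffW i f) = (∑ j, k j i • diffW j : Module.End ℂ (Fock N)) (substW k' f)
  rw [LinearMap.sum_apply]
  simp only [LinearMap.smul_apply, diffW_substW, Finset.smul_sum, smul_smul]
  rw [Finset.sum_comm]
  simp only [← Finset.sum_smul]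
  have e : ∀ l, ∑ j, k j i * k' l j = if l = i then 1 else 0 := by
    intro l
    have := congrFun (congrFun h l) i
    rw [Matrix.mul_apply, Matrix.one_apply] at this
    rw [← this]
    exact Finset.sum_congr rfl fun j _ => mul_comm _ _
  simp [e]

/-- `Ũ` acts on the Fock model compatibly with the adjoint action on `sp(W_ℝ)`. -/
theorem fockU_fockOp (p : utilde N) (X : Mat N) :
    fockU N p * fockOp X
      = fockOp ((p.1.1 : Mat N) * X * ((p.1.1⁻¹ : Sp N) : Mat N)) * fockU N p := by
  have hp := p.2.1
  have hpi : p.1.1⁻¹ ∈ maxU N := inv_mem hp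
  have hk : holPart ((p.1.1⁻¹ : Sp N) : Mat N) * holPart (p.1.1 : Mat N) = 1 := by
    have := holPart_mul_inv hpi
    rwa [inv_inv] at this
  have h := weylOp_intertwine hk (substW_mulW _) (substW_diffW hk) (holPart X) (antiPart X)
    (conjM (antiPart X))
  have z : conjM (0 : Matrix (Fin N) (Fin N) ℂ) = 0 := by ext i j; simp [conjM]
  have e1 : holPart ((p.1.1 : Mat N) * X * ((p.1.1⁻¹ : Sp N) : Mat N))
      = holPart (p.1.1 : Mat N) * holPart X * holPart ((p.1.1⁻¹ : Sp N) : Mat N) := by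
    rw [Matrix.mul_assoc, holPart_mul_of_mem_maxU hp, holPart_mul, antiPart_of_mem_maxU hpi, z,
      Matrix.mul_zero, add_zero, Matrix.mul_assoc]
  have e2 : antiPart ((p.1.1 : Mat N) * X * ((p.1.1⁻¹ : Sp N) : Mat N))
      = holPart (p.1.1 : Mat N) * antiPart X * (holPart (p.1.1 : Mat N))ᵀ := by
    rw [Matrix.mul_assoc, antiPart_mul, antiPart_of_mem_maxU hp, Matrix.zero_mul, add_zero,
      antiPart_mul, antiPart_of_mem_maxU hpi, Matrix.mul_zero, zero_add, conjM_holPart_inv hp,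
      Matrix.mul_assoc]
  have e3 : conjM (holPart (p.1.1 : Mat N)) = (holPart ((p.1.1⁻¹ : Sp N) : Mat N))ᵀ := by
    have := conjM_holPart_inv hpi
    rwa [inv_inv] at this
  have e4 : conjM (holPart (p.1.1 : Mat N))ᵀ = holPart ((p.1.1⁻¹ : Sp N) : Mat N) := by
    rw [conjM_transpose, e3, Matrix.transpose_transpose]
  have e5 : fockOp ((p.1.1 : Mat N) * X * ((p.1.1⁻¹ : Sp N) : Mat N))
      = weylOp mulW diffW (holPart (p.1.1 : Mat N) * holPart X * holPart ((p.1.1⁻¹ : Sp N) : Mat N))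
          (holPart (p.1.1 : Mat N) * antiPart X * (holPart (p.1.1 : Mat N))ᵀ)
          ((holPart ((p.1.1⁻¹ : Sp N) : Mat N))ᵀ * conjM (antiPart X)
            * holPart ((p.1.1⁻¹ : Sp N) : Mat N)) := by
    rw [fockOp, e1, e2, conjM_mul, conjM_mul, e3, e4]
  rw [e5]
  change ((p.1.2⁻¹ : ℂˣ) : ℂ) • (substW (holPart ((p.1.1⁻¹ : Sp N) : Mat N))).toLinearMap * fockOp X
    = _ * ((p.1.2⁻¹ : ℂˣ) : ℂ) • (substW (holPart ((p.1.1⁻¹ : Sp N) : Mat N))).toLinearMap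
  rw [smul_mul_assoc, mul_smul_comm]
  exact congrArg _ h

end Equivariance
/-! ### Reductive dual pairs -/

/-- A subgroup of `Sp(W_ℝ)` acts reductively on `W_ℝ` if every invariant subspace has an
invariant complement. -/
def ActsReductively {N : ℕ} (H : Subgroup (Sp N)) : Prop :=
  ∀ E : Submodule ℝ (Fin N ⊕ Fin N → ℝ),
    (∀ h ∈ H, ∀ v ∈ E, (h : Mat N) *ᵥ v ∈ E) →
      ∃ F : Submodule ℝ (Fin N ⊕ Fin N → ℝ),
        (∀ h ∈ H, ∀ v ∈ F, (h : Mat N) *ᵥ v ∈ F) ∧ IsCompl E F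

/-- The Cartan involution `g ↦ (gᵀ)⁻¹` of `Sp(W_ℝ)`, whose fixed points form `U`. -/
def cartanInv {N : ℕ} (g : Sp N) : Sp N :=
  (⟨(g : Mat N)ᵀ, SymplecticGroup.transpose_mem g.2⟩ : Sp N)⁻¹

/-- A real reductive dual pair `(G, G')` in `Sp(W_ℝ)`: two subgroups acting reductively on `W_ℝ`,
each of which is the centralizer of the other. -/
structure DualPair (N : ℕ) where
  /-- the first member -/
  G : Subgroup (Sp N)
  /-- the second member -/
  G' : Subgroup (Sp N)
  centralizer_G : Subgroup.centralizer (G : Set (Sp N)) = G'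
  centralizer_G' : Subgroup.centralizer (G' : Set (Sp N)) = G
  reductive_G : ActsReductively G
  reductive_G' : ActsReductively G'

namespace DualPair

variable {N : ℕ}

/-- The dual pair `(G', G)`. All notions below are defined for the first member `G` of a dual
pair; those for `G'` are obtained from `D.swap`. -/
def swap (D : DualPair N) : DualPair N :=
  ⟨D.G', D.G, D.centralizer_G', D.centralizer_G, D.reductive_G', D.reductive_G⟩

/-- The maximal compact subgroup `U` is adapted to the dual pair: the Cartan involution of
`Sp(W_ℝ)` attached to `U` preserves `G` and `G'`. Then `K = G ∩ U` and `K' = G' ∩ U` are maximal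
compact subgroups, and the involution induces Cartan decompositions of the Lie algebras. -/
def Adapted (D : DualPair N) : Prop :=
  (∀ g ∈ D.G, cartanInv g ∈ D.G) ∧ (∀ g ∈ D.G', cartanInv g ∈ D.G')

theorem commute_of_exp {A : Type*} [NormedRing A] [NormedAlgebra ℝ A] [CompleteSpace A] {a x : A}
    (h : ∀ t : ℝ, a * NormedSpace.exp (t • x) = NormedSpace.exp (t • x) * a) :
    a * x = x * a := by
  have h0 : HasDerivAt (fun t : ℝ => NormedSpace.exp (t • x)) x 0 := by
    simpa using hasDerivAt_exp_smul_const (𝕂 := ℝ) x 0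
  have h1 := h0.const_mul a
  rw [funext h] at h1
  exact h1.unique (h0.mul_const a)

theorem skew_of_exp {A : Type*} [NormedRing A] [NormedAlgebra ℝ A] [CompleteSpace A] {x y j : A}
    (h : ∀ t : ℝ, NormedSpace.exp (t • y) * j * NormedSpace.exp (t • x) = j) :
    y * j = j * (-x) := by
  have h0 : ∀ z : A, HasDerivAt (fun t : ℝ => NormedSpace.exp (t • z)) z 0 := fun z => by
    simpa using hasDerivAt_exp_smul_const (𝕂 := ℝ) z 0
  have h1 := ((h0 y).mul_const j).mul (h0 x)
  have h2 : ((fun t : ℝ => NormedSpace.exp (t • y) * j) * fun t : ℝ => NormedSpace.exp (t • x))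
      = fun _ => j := funext h
  rw [h2] at h1
  have h3 := h1.unique (hasDerivAt_const (0 : ℝ) j)
  simp only [zero_smul, NormedSpace.exp_zero, one_mul, mul_one] at h3
  rw [mul_neg]
  exact eq_neg_of_add_eq_zero_left h3

theorem commute_of_exp_mat {a x : Mat N}
    (h : ∀ t : ℝ, a * NormedSpace.exp (t • x) = NormedSpace.exp (t • x) * a) :
    a * x = x * a := by
  let _ : NormedRing (Mat N) := Matrix.linftyOpNormedRing
  let _ : NormedAlgebra ℝ (Mat N) := Matrix.linftyOpNormedAlgebra
  exact commute_of_exp h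

theorem skew_of_exp_mat {x y j : Mat N}
    (h : ∀ t : ℝ, NormedSpace.exp (t • y) * j * NormedSpace.exp (t • x) = j) :
    y * j = j * (-x) := by
  let _ : NormedRing (Mat N) := Matrix.linftyOpNormedRing
  let _ : NormedAlgebra ℝ (Mat N) := Matrix.linftyOpNormedAlgebra
  exact skew_of_exp h

theorem commute_exp_mat {a x : Mat N} (h : a * x = x * a) (t : ℝ) :
    a * NormedSpace.exp (t • x) = NormedSpace.exp (t • x) * a := by
  let _ : NormedRing (Mat N) := Matrix.linftyOpNormedRing
  let _ : NormedAlgebra ℝ (Mat N) := Matrix.linftyOpNormedAlgebra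
  let _ : NormedAlgebra ℚ (Mat N) := NormedAlgebra.restrictScalars ℚ ℝ (Mat N)
  have hc : Commute a x := h
  exact (hc.smul_right t).exp_right

theorem exp_curve_iff (D : DualPair N) (X : Mat N) :
    (∀ t : ℝ, ∃ g ∈ D.G, (g : Mat N) = NormedSpace.exp (t • X)) ↔
      X ∈ LieAlgebra.Symplectic.sp (Fin N) ℝ ∧
        ∀ h ∈ D.G', (h : Mat N) * X = X * (h : Mat N) := by
  constructor
  · intro hX
    refine ⟨?_, fun h hh => ?_⟩
    · rw [mem_sp_iff]
      refine skew_of_exp_mat fun t => ?_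
      obtain ⟨g, -, hg⟩ := hX t
      rw [← Matrix.transpose_smul, Matrix.exp_transpose, ← hg]
      exact SymplecticGroup.mem_iff'.mp g.2
    · refine commute_of_exp_mat fun t => ?_
      obtain ⟨g, hgG, hg⟩ := hX t
      rw [← hg]
      rw [← D.centralizer_G', Subgroup.mem_centralizer_iff] at hgG
      exact congrArg Subtype.val (hgG h hh)
  · rintro ⟨hsp, hc⟩ t
    rw [mem_sp_iff] at hsp
    have hJ : IsUnit (Matrix.J (Fin N) ℝ) :=
      (Matrix.isUnit_iff_isUnit_det _).2 (Matrix.isUnit_det_J (Fin N) ℝ)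
    have hJd := Matrix.isUnit_det_J (Fin N) ℝ
    have hmem : NormedSpace.exp (t • X) ∈ Matrix.symplecticGroup (Fin N) ℝ := by
      rw [SymplecticGroup.mem_iff', ← Matrix.exp_transpose]
      have e : (t • X)ᵀ = Matrix.J (Fin N) ℝ * (-(t • X)) * (Matrix.J (Fin N) ℝ)⁻¹ := by
        rw [Matrix.transpose_smul, ← smul_neg, Matrix.mul_smul, ← hsp, Matrix.smul_mul,
          Matrix.mul_nonsing_inv_cancel_right _ _ hJd]
      rw [e, Matrix.exp_conj _ _ hJ, Matrix.nonsing_inv_mul_cancel_right _ _ hJd, Matrix.mul_assoc,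
        ← Matrix.exp_add_of_commute _ _ (Commute.refl (t • X)).neg_left, neg_add_cancel,
        NormedSpace.exp_zero, Matrix.mul_one]
    refine ⟨⟨_, hmem⟩, ?_, rfl⟩
    rw [← D.centralizer_G', Subgroup.mem_centralizer_iff]
    intro h hh
    apply Subtype.ext
    exact commute_exp_mat (hc h hh) t

/-- The real Lie algebra of `G`: all `X` whose one-parameter group `exp (t X)` lies in `G`.
Representations of its complexification `𝔤` on a complex vector space are the same as
representations of this real Lie algebra by complex linear operators. -/
def lieG (D : DualPair N) : LieSubalgebra ℝ (Mat N) where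
  carrier := {X | ∀ t : ℝ, ∃ g ∈ D.G, (g : Mat N) = NormedSpace.exp (t • X)}
  zero_mem' := (D.exp_curve_iff 0).2 ⟨zero_mem _, by simp⟩
  add_mem' {X Y} hX hY := by
    obtain ⟨h1, h2⟩ := (D.exp_curve_iff X).1 hX
    obtain ⟨h3, h4⟩ := (D.exp_curve_iff Y).1 hY
    exact (D.exp_curve_iff (X + Y)).2 ⟨add_mem h1 h3, fun h hh => by
      rw [Matrix.mul_add, Matrix.add_mul, h2 h hh, h4 h hh]⟩
  smul_mem' c {X} hX := by
    obtain ⟨h1, h2⟩ := (D.exp_curve_iff X).1 hX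
    exact (D.exp_curve_iff (c • X)).2
      ⟨(LieAlgebra.Symplectic.sp (Fin N) ℝ).smul_mem c h1, fun h hh => by
        rw [Matrix.mul_smul, Matrix.smul_mul, h2 h hh]⟩
  lie_mem' {X Y} hX hY := by
    obtain ⟨h1, h2⟩ := (D.exp_curve_iff X).1 hX
    obtain ⟨h3, h4⟩ := (D.exp_curve_iff Y).1 hY
    refine (D.exp_curve_iff ⁅X, Y⁆).2 ⟨LieSubalgebra.lie_mem _ h1 h3, fun h hh => ?_⟩
    have e2 : Commute (h : Mat N) X := h2 h hh
    have e4 : Commute (h : Mat N) Y := h4 h hh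
    rw [LieRing.of_associative_ring_bracket]
    exact ((e2.mul_right e4).sub_right (e4.mul_right e2))

theorem mem_lieG_iff (D : DualPair N) {X : Mat N} : X ∈ D.lieG ↔
    X ∈ LieAlgebra.Symplectic.sp (Fin N) ℝ ∧ ∀ h ∈ D.G', (h : Mat N) * X = X * (h : Mat N) :=
  D.exp_curve_iff X

theorem lieG_le (D : DualPair N) : D.lieG ≤ LieAlgebra.Symplectic.sp (Fin N) ℝ :=
  fun _ hX => (D.mem_lieG_iff.1 hX).1

/-- The double cover `K̃` of `K = G ∩ U`: the inverse image of `K` in `Ũ`. -/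
def ktilde (D : DualPair N) : Subgroup (Sp N × ℂˣ) :=
  utilde N ⊓ D.G.comap (MonoidHom.fst (Sp N) ℂˣ)

theorem conj_mem_lieG (D : DualPair N) (k : D.ktilde) (X : D.lieG) :
    (k.1.1 : Mat N) * (X : Mat N) * ((k.1.1⁻¹ : Sp N) : Mat N) ∈ D.lieG := by
  intro t
  obtain ⟨g, hg, hgX⟩ := X.2 t
  refine ⟨k.1.1 * g * k.1.1⁻¹, mul_mem (mul_mem k.2.2 hg) (inv_mem k.2.2), ?_⟩
  have hu : IsUnit (k.1.1 : Mat N) :=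
    (Matrix.isUnit_iff_isUnit_det _).2 (SymplecticGroup.symplectic_det k.1.1.2)
  rw [Submonoid.coe_mul, Submonoid.coe_mul, hgX, SymplecticGroup.coe_inv',
    ← Matrix.exp_conj _ _ hu, Matrix.mul_smul, Matrix.smul_mul]

/-- The adjoint action of `K̃` on the Lie algebra of `G`. -/
def Ad (D : DualPair N) (k : D.ktilde) (X : D.lieG) : D.lieG :=
  ⟨(k.1.1 : Mat N) * (X : Mat N) * ((k.1.1⁻¹ : Sp N) : Mat N), D.conj_mem_lieG k X⟩

theorem Ad_inv_Ad (D : DualPair N) (k : D.ktilde) (X : D.lieG) : D.Ad k (D.Ad k⁻¹ X) = X := by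
  apply Subtype.ext
  have h1 : (k.1.1 : Mat N) * ((k.1.1⁻¹ : Sp N) : Mat N) = 1 := by
    rw [← Submonoid.coe_mul, mul_inv_cancel, Submonoid.coe_one]
  change (k.1.1 : Mat N) * (((k.1.1⁻¹ : Sp N) : Mat N) * (X : Mat N)
    * (((k.1.1⁻¹ : Sp N)⁻¹ : Sp N) : Mat N)) * ((k.1.1⁻¹ : Sp N) : Mat N) = (X : Mat N)
  rw [inv_inv, Matrix.mul_assoc, Matrix.mul_assoc, Matrix.mul_assoc, h1, Matrix.mul_one,
    ← Matrix.mul_assoc, h1, Matrix.one_mul]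

/-- The elements of `𝔭`, the `(-1)`-eigenspace `{X | Xᵀ = X}` of the Cartan involution
`X ↦ -Xᵀ` on the Lie algebra of `G`. -/
def IsP (D : DualPair N) (X : D.lieG) : Prop :=
  (X : Mat N)ᵀ = (X : Mat N)

theorem IsP.Ad {D : DualPair N} {X : D.lieG} (hX : D.IsP X) (k : D.ktilde) :
    D.IsP (D.Ad k X) := by
  have hk : (k.1.1 : Mat N)ᵀ * (k.1.1 : Mat N) = 1 := k.2.1.1
  have hX' : (X : Mat N)ᵀ = (X : Mat N) := hX
  have hi : ((k.1.1⁻¹ : Sp N) : Mat N) = (k.1.1 : Mat N)ᵀ := by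
    rw [SymplecticGroup.coe_inv', Matrix.inv_eq_left_inv hk]
  change ((k.1.1 : Mat N) * (X : Mat N) * ((k.1.1⁻¹ : Sp N) : Mat N))ᵀ
    = (k.1.1 : Mat N) * (X : Mat N) * ((k.1.1⁻¹ : Sp N) : Mat N)
  rw [hi, Matrix.transpose_mul, Matrix.transpose_mul, Matrix.transpose_transpose, hX',
    Matrix.mul_assoc]

theorem lieG_lie_lieG' (D : DualPair N) (X : D.lieG) (X' : D.swap.lieG) :
    (X : Mat N) * (X' : Mat N) = (X' : Mat N) * (X : Mat N) := by
  refine commute_of_exp_mat fun t => ?_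
  obtain ⟨g, hg, hgX⟩ := X'.2 t
  rw [← hgX]
  exact ((D.mem_lieG_iff.1 X.2).2 g hg).symm

end DualPair

/-! ### `(𝔤, K̃)`-modules -/

section GK

variable {N : ℕ} {D : DualPair N}

/-- An action of the Lie algebra of `G` and an action of `K̃` on a complex vector space. -/
structure GKAct (D : DualPair N) (V : Type*) [AddCommGroup V] [Module ℂ V] where
  /-- the action of the Lie algebra -/
  lie : D.lieG →ₗ⁅ℝ⁆ Module.End ℂ V
  /-- the action of the group -/
  grp : D.ktilde →* Module.End ℂ V

variable {V W : Type*} [AddCommGroup V] [Module ℂ V] [AddCommGroup W] [Module ℂ W]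

/-- The axioms of a `(𝔤, K̃)`-module: `K̃` acts locally finitely and continuously, the differential
of the action of `K̃` is the restriction of the action of `𝔤` to `𝔨`, and the two actions are
compatible with the adjoint action. Continuity and differentiability (which concern the
finite-dimensional spaces spanned by `K̃`-orbits) are expressed by matrix coefficients. -/
structure GKAct.IsGKModule (a : GKAct D V) : Prop where
  locallyFinite : ∀ v : V,
    FiniteDimensional ℂ (Submodule.span ℂ (Set.range fun k : D.ktilde => a.grp k v))
  continuous : ∀ (v : V) (l : Module.Dual ℂ V), Continuous fun k : D.ktilde => l (a.grp k v)
  differential : ∀ γ : Multiplicative ℝ →* D.ktilde, Continuous γ →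
    ∀ X : D.lieG, (∀ t : ℝ, ((γ (Multiplicative.ofAdd t)).1.1 : Mat N)
      = NormedSpace.exp (t • (X : Mat N))) →
    ∀ (v : V) (l : Module.Dual ℂ V),
      HasDerivAt (fun t : ℝ => l (a.grp (γ (Multiplicative.ofAdd t)) v)) (l (a.lie X v)) 0
  equivariant : ∀ (k : D.ktilde) (X : D.lieG) (v : V),
    a.grp k (a.lie X v) = a.lie (D.Ad k X) (a.grp k v)

/-- Irreducibility: `V ≠ 0`, and no invariant subspaces except `0` and `V`. -/
def GKAct.IsIrreducible (a : GKAct D V) : Prop :=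
  Nontrivial V ∧ ∀ S : Submodule ℂ V, (∀ X, ∀ v ∈ S, a.lie X v ∈ S) →
    (∀ k, ∀ v ∈ S, a.grp k v ∈ S) → S = ⊥ ∨ S = ⊤

/-- A linear map which commutes with the actions of `𝔤` and `K̃`. -/
def IsIntertwining (a : GKAct D V) (b : GKAct D W) (T : V →ₗ[ℂ] W) : Prop :=
  (∀ X v, T (a.lie X v) = b.lie X (T v)) ∧ ∀ k v, T (a.grp k v) = b.grp k (T v)

/-- Isomorphism of `(𝔤, K̃)`-modules. -/
def GKIso (a : GKAct D V) (b : GKAct D W) : Prop :=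
  ∃ e : V ≃ₗ[ℂ] W, IsIntertwining a b e.toLinearMap

/-- Bundle a function into a homomorphism of real Lie algebras into complex linear operators. -/
def mkLie (f : D.lieG → Module.End ℂ V) (hadd : ∀ X Y, f (X + Y) = f X + f Y)
    (hsmul : ∀ (c : ℝ) X v, f (c • X) v = (c : ℂ) • f X v)
    (hlie : ∀ X Y v, f ⁅X, Y⁆ v = f X (f Y v) - f Y (f X v)) :
    D.lieG →ₗ⁅ℝ⁆ Module.End ℂ V where
  toFun := f
  map_add' := hadd
  map_smul' c X := LinearMap.ext fun v => hsmul c X v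
  map_lie' {X Y} := LinearMap.ext fun v => hlie X Y v

theorem GKAct.lie_smul_apply (a : GKAct D V) (c : ℝ) (X : D.lieG) (v : V) :
    a.lie (c • X) v = (c : ℂ) • a.lie X v := by
  rw [map_smul]; rfl

theorem GKAct.lie_lie_apply (a : GKAct D V) (X Y : D.lieG) (v : V) :
    a.lie ⁅X, Y⁆ v = a.lie X (a.lie Y v) - a.lie Y (a.lie X v) := by
  rw [LieHom.map_lie]; rfl

/-- The action on an invariant subspace. -/
def GKAct.sub (a : GKAct D V) (S : Submodule ℂ V) (hl : ∀ X, ∀ v ∈ S, a.lie X v ∈ S)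
    (hk : ∀ k, ∀ v ∈ S, a.grp k v ∈ S) : GKAct D S where
  lie := mkLie (fun X => (a.lie X).restrict (hl X))
    (fun X Y => LinearMap.ext fun v => Subtype.ext (by simp [LinearMap.restrict_apply]))
    (fun c X v => Subtype.ext (a.lie_smul_apply c X v))
    (fun X Y v => Subtype.ext (a.lie_lie_apply X Y v))
  grp :=
    { toFun := fun k => (a.grp k).restrict (hk k)
      map_one' := LinearMap.ext fun v => Subtype.ext (by simp [LinearMap.restrict_apply])
      map_mul' := fun k k' => LinearMap.ext fun v =>
        Subtype.ext (by simp [LinearMap.restrict_apply]) }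

/-- The action on the quotient by an invariant subspace. -/
def GKAct.quot (a : GKAct D V) (S : Submodule ℂ V) (hl : ∀ X, ∀ v ∈ S, a.lie X v ∈ S)
    (hk : ∀ k, ∀ v ∈ S, a.grp k v ∈ S) : GKAct D (V ⧸ S) where
  lie := mkLie (fun X => S.mapQ S (a.lie X) (hl X))
    (fun X Y => by
      refine Submodule.linearMap_qext _ (LinearMap.ext fun v => ?_)
      simp)
    (fun c X v => by
      induction v using Submodule.Quotient.induction_on with
      | H v => exact congrArg S.mkQ (a.lie_smul_apply c X v))
    (fun X Y v => by
      induction v using Submodule.Quotient.induction_on with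
      | H v => exact congrArg S.mkQ (a.lie_lie_apply X Y v))
  grp :=
    { toFun := fun k => S.mapQ S (a.grp k) (hk k)
      map_one' := by
        refine Submodule.linearMap_qext _ (LinearMap.ext fun v => ?_)
        simp
      map_mul' := fun k k' => by
        refine Submodule.linearMap_qext _ (LinearMap.ext fun v => ?_)
        simp }

/-- The tensor product of two modules. -/
def GKAct.tensor (a : GKAct D V) (b : GKAct D W) : GKAct D (V ⊗[ℂ] W) where
  lie := mkLie (fun X => (a.lie X).rTensor W + (b.lie X).lTensor V)
    (fun X Y => by
      refine TensorProduct.ext' fun v w => ?_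
      simp only [map_add, LinearMap.add_apply, LinearMap.rTensor_tmul, LinearMap.lTensor_tmul,
        TensorProduct.add_tmul, TensorProduct.tmul_add]
      abel)
    (fun c X e => by
      induction e with
      | zero => simp
      | add x y hx hy => simp only [map_add, smul_add, hx, hy]
      | tmul v w =>
        simp only [LinearMap.add_apply, LinearMap.rTensor_tmul, LinearMap.lTensor_tmul,
          a.lie_smul_apply, b.lie_smul_apply, TensorProduct.tmul_smul, TensorProduct.smul_tmul',
          smul_add])
    (fun X Y e => by
      induction e with
      | zero => simp
      | add x y hx hy => simp only [map_add, hx, hy]; abel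
      | tmul v w =>
        simp only [LinearMap.add_apply, LinearMap.rTensor_tmul, LinearMap.lTensor_tmul,
          a.lie_lie_apply, b.lie_lie_apply, map_add, TensorProduct.sub_tmul,
          TensorProduct.tmul_sub]
        abel)
  grp :=
    { toFun := fun k => TensorProduct.map (a.grp k) (b.grp k)
      map_one' := by rw [map_one, map_one]; exact TensorProduct.map_id
      map_mul' := fun k k' => by
        rw [map_mul, map_mul]
        exact TensorProduct.map_comp _ _ _ _ }

/-- The action on `V ⊗ W` through the second factor. -/
def GKAct.onRight (V : Type*) [AddCommGroup V] [Module ℂ V] (b : GKAct D W) :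
    GKAct D (V ⊗[ℂ] W) where
  lie := mkLie (fun X => (b.lie X).lTensor V)
    (fun X Y => by rw [map_add, LinearMap.lTensor_add])
    (fun c X e => by
      induction e with
      | zero => simp
      | add x y hx hy => simp only [map_add, smul_add, hx, hy]
      | tmul v w => simp only [LinearMap.lTensor_tmul, b.lie_smul_apply, TensorProduct.tmul_smul])
    (fun X Y e => by
      induction e with
      | zero => simp
      | add x y hx hy => simp only [map_add, hx, hy]; abel
      | tmul v w => simp only [LinearMap.lTensor_tmul, b.lie_lie_apply, TensorProduct.tmul_sub])
  grp :=
    { toFun := fun k => (b.grp k).lTensor V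
      map_one' := by rw [map_one]; exact LinearMap.lTensor_id _ _
      map_mul' := fun k k' => by rw [map_mul]; exact LinearMap.lTensor_comp _ _ _ }

/-! ### The contragredient -/

/-- The functional `k · l = l ∘ k⁻¹`. -/
def GKAct.dualGrp (a : GKAct D V) (k : D.ktilde) : Module.End ℂ (Module.Dual ℂ V) :=
  (a.grp k⁻¹).dualMap

/-- The functional `X · l = -l ∘ X`. -/
def GKAct.dualLie (a : GKAct D V) (X : D.lieG) : Module.End ℂ (Module.Dual ℂ V) :=
  -(a.lie X).dualMap

/-- The space `V^* = Hom_ℂ(V, ℂ)_{K̃-finite}`. -/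
def GKAct.finDual (a : GKAct D V) : Submodule ℂ (Module.Dual ℂ V) where
  carrier := {l | FiniteDimensional ℂ
    (Submodule.span ℂ (Set.range fun k : D.ktilde => a.dualGrp k l))}
  zero_mem' := by
    have : Submodule.span ℂ (Set.range fun k : D.ktilde => a.dualGrp k 0) = ⊥ := by
      rw [Submodule.span_eq_bot]
      rintro _ ⟨k, rfl⟩
      exact map_zero _
    change FiniteDimensional ℂ _
    rw [this]
    infer_instance
  add_mem' {l m} hl hm := by
    have hl' : FiniteDimensional ℂ
      (Submodule.span ℂ (Set.range fun k : D.ktilde => a.dualGrp k l)) := hl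
    have hm' : FiniteDimensional ℂ
      (Submodule.span ℂ (Set.range fun k : D.ktilde => a.dualGrp k m)) := hm
    refine Submodule.finiteDimensional_of_le
      (S₂ := Submodule.span ℂ (Set.range fun k : D.ktilde => a.dualGrp k l) ⊔
        Submodule.span ℂ (Set.range fun k : D.ktilde => a.dualGrp k m)) ?_
    rw [Submodule.span_le]
    rintro _ ⟨k, rfl⟩
    change a.dualGrp k (l + m) ∈ _
    rw [map_add]
    exact Submodule.add_mem_sup (Submodule.subset_span ⟨k, rfl⟩) (Submodule.subset_span ⟨k, rfl⟩)
  smul_mem' c {l} hl := by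
    have hl' : FiniteDimensional ℂ
      (Submodule.span ℂ (Set.range fun k : D.ktilde => a.dualGrp k l)) := hl
    refine Submodule.finiteDimensional_of_le
      (S₂ := Submodule.span ℂ (Set.range fun k : D.ktilde => a.dualGrp k l)) ?_
    rw [Submodule.span_le]
    rintro _ ⟨k, rfl⟩
    change a.dualGrp k (c • l) ∈ _
    rw [map_smul]
    exact Submodule.smul_mem _ _ (Submodule.subset_span ⟨k, rfl⟩)

theorem GKAct.dualGrp_mul (a : GKAct D V) (k k' : D.ktilde) (l : Module.Dual ℂ V) :
    a.dualGrp (k * k') l = a.dualGrp k (a.dualGrp k' l) := by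
  refine LinearMap.ext fun v => ?_
  simp [GKAct.dualGrp, mul_inv_rev]

theorem GKAct.dualGrp_mem (a : GKAct D V) (k : D.ktilde) (l : Module.Dual ℂ V)
    (hl : l ∈ a.finDual) : a.dualGrp k l ∈ a.finDual := by
  have hl' : FiniteDimensional ℂ
    (Submodule.span ℂ (Set.range fun k : D.ktilde => a.dualGrp k l)) := hl
  refine Submodule.finiteDimensional_of_le
    (S₂ := Submodule.span ℂ (Set.range fun k : D.ktilde => a.dualGrp k l)) ?_
  rw [Submodule.span_le]
  rintro _ ⟨k', rfl⟩
  exact Submodule.subset_span ⟨k' * k, a.dualGrp_mul k' k l⟩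

theorem GKAct.dualLie_mem (a : GKAct D V) (ha : a.IsGKModule) (X : D.lieG) (l : Module.Dual ℂ V)
    (hl : l ∈ a.finDual) : a.dualLie X l ∈ a.finDual := by
  have hl' : FiniteDimensional ℂ
    (Submodule.span ℂ (Set.range fun k : D.ktilde => a.dualGrp k l)) := hl
  set F := Submodule.span ℂ (Set.range fun k : D.ktilde => a.dualGrp k l) with hF
  have : FiniteDimensional ℝ D.lieG := by
    change FiniteDimensional ℝ D.lieG.toSubmodule
    infer_instance
  let b := Module.finBasis ℝ D.lieG
  have hb : FiniteDimensional ℂ (⨆ i, F.map (a.dualLie (b i)) : Submodule ℂ (Module.Dual ℂ V)) :=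
    inferInstance
  have key : ∀ (Y : D.lieG), ∀ m ∈ F, a.dualLie Y m ∈ ⨆ i, F.map (a.dualLie (b i)) := by
    intro Y m hm
    have hY : a.dualLie Y m = ∑ i, ((b.repr Y i : ℝ) : ℂ) • a.dualLie (b i) m := by
      refine LinearMap.ext fun v => ?_
      have e : a.lie Y v = ∑ i, ((b.repr Y i : ℝ) : ℂ) • a.lie (b i) v := by
        conv_lhs => rw [← b.sum_repr Y]
        rw [map_sum, LinearMap.sum_apply]
        exact Finset.sum_congr rfl fun i _ => a.lie_smul_apply _ _ _
      simp [GKAct.dualLie, e]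
    rw [hY]
    refine Submodule.sum_mem _ fun i _ => Submodule.smul_mem _ _ ?_
    exact Submodule.mem_iSup_of_mem i (Submodule.mem_map_of_mem hm)
  refine Submodule.finiteDimensional_of_le (S₂ := ⨆ i, F.map (a.dualLie (b i))) ?_
  rw [Submodule.span_le]
  rintro _ ⟨k, rfl⟩
  have e : a.dualGrp k (a.dualLie X l) = a.dualLie (D.Ad k X) (a.dualGrp k l) := by
    refine LinearMap.ext fun v => ?_
    have h := ha.equivariant k⁻¹ (D.Ad k X) v
    have h2 : D.Ad k⁻¹ (D.Ad k X) = X := by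
      have := D.Ad_inv_Ad k⁻¹ X
      rwa [inv_inv] at this
    rw [h2] at h
    change -(l (a.lie X (a.grp k⁻¹ v))) = -(l (a.grp k⁻¹ (a.lie (D.Ad k X) v)))
    rw [h]
  change a.dualGrp k (a.dualLie X l) ∈ _
  rw [e]
  exact key _ _ (Submodule.subset_span ⟨k, rfl⟩)

/-- `V^* = Hom_ℂ(V, ℂ)_{K̃-finite}` as a vector space of its own. -/
def GKAct.DualSpace (a : GKAct D V) : Type _ := a.finDual

instance (a : GKAct D V) : AddCommGroup a.DualSpace := inferInstanceAs (AddCommGroup a.finDual)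

instance (a : GKAct D V) : Module ℂ a.DualSpace := inferInstanceAs (Module ℂ a.finDual)

/-- The contragredient module on `V^* = Hom_ℂ(V, ℂ)_{K̃-finite}`. -/
def GKAct.contragredient (a : GKAct D V) (ha : a.IsGKModule) : GKAct D a.DualSpace where
  lie := mkLie (fun X => (a.dualLie X).restrict (a.dualLie_mem ha X))
    (fun X Y => LinearMap.ext fun l => Subtype.ext <| LinearMap.ext fun v => by
      change -(l.1 (a.lie (X + Y) v)) = -(l.1 (a.lie X v)) + -(l.1 (a.lie Y v))
      rw [map_add, LinearMap.add_apply, map_add, neg_add])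
    (fun c X l => Subtype.ext <| LinearMap.ext fun v => by
      change -(l.1 (a.lie (c • X) v)) = (c : ℂ) * -(l.1 (a.lie X v))
      rw [a.lie_smul_apply, map_smul, smul_eq_mul, mul_neg])
    (fun X Y l => Subtype.ext <| LinearMap.ext fun v => by
      change -(l.1 (a.lie ⁅X, Y⁆ v)) = - -(l.1 (a.lie Y (a.lie X v))) - - -(l.1 (a.lie X (a.lie Y v)))
      rw [a.lie_lie_apply, map_sub]
      ring)
  grp :=
    { toFun := fun k => (a.dualGrp k).restrict (a.dualGrp_mem k)
      map_one' := LinearMap.ext fun l => Subtype.ext <| LinearMap.ext fun v => by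
        change l.1 (a.grp (1 : D.ktilde)⁻¹ v) = l.1 v
        rw [inv_one, map_one]
        rfl
      map_mul' := fun k k' => LinearMap.ext fun l => Subtype.ext (a.dualGrp_mul k k' l.1) }

/-! ### Coinvariants and invariants -/

/-- `V(𝔤, K̃) = span {X v, k v - v}`. -/
def GKAct.gkSpan (a : GKAct D V) : Submodule ℂ V :=
  Submodule.span ℂ ({u | ∃ (X : D.lieG) (v : V), u = a.lie X v} ∪
    {u | ∃ (k : D.ktilde) (v : V), u = a.grp k v - v})

/-- `V(𝔭) = span {X v | X ∈ 𝔭}`. -/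
def GKAct.pSpan (a : GKAct D V) : Submodule ℂ V :=
  Submodule.span ℂ {u | ∃ (X : D.lieG) (v : V), D.IsP X ∧ u = a.lie X v}

/-- The operator by which `k ∈ K̃` acts on the coinvariants `V_𝔭 = V / V(𝔭)`. -/
def GKAct.grpP (a : GKAct D V)
    (heq : ∀ (k : D.ktilde) (X : D.lieG) (v : V),
      a.grp k (a.lie X v) = a.lie (D.Ad k X) (a.grp k v)) (k : D.ktilde) :
    Module.End ℂ (V ⧸ a.pSpan) :=
  a.pSpan.mapQ a.pSpan (a.grp k) (by
    rw [GKAct.pSpan, Submodule.span_le]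
    rintro _ ⟨X, v, hX, rfl⟩
    exact Submodule.subset_span ⟨D.Ad k X, a.grp k v, hX.Ad k, heq k X v⟩)

/-- The subspace `(V_𝔭)^{K̃}` of `V_𝔭`. -/
def GKAct.pCoinvInvariants (a : GKAct D V)
    (heq : ∀ (k : D.ktilde) (X : D.lieG) (v : V),
      a.grp k (a.lie X v) = a.lie (D.Ad k X) (a.grp k v)) :
    Submodule ℂ (V ⧸ a.pSpan) where
  carrier := {c | ∀ k, a.grpP heq k c = c}
  zero_mem' _ := map_zero _
  add_mem' {x y} hx hy k := by rw [map_add, hx k, hy k]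
  smul_mem' c {x} hx k := by rw [map_smul, hx k]

end GK

/-! ### The Fock model as a module for the members of a dual pair -/

namespace DualPair

variable {N : ℕ}

/-- The Fock model `𝒴` with the actions of `𝔤` and `K̃`. -/
def fock (D : DualPair N) : GKAct D (Fock N) where
  lie := (fockSp N).comp (LieSubalgebra.inclusion D.lieG_le)
  grp := (fockU N).comp (Subgroup.inclusion inf_le_left)

theorem fock_lie_apply (D : DualPair N) (X : D.lieG) : D.fock.lie X = fockOp (X : Mat N) := rfl

theorem fock_grp_apply (D : DualPair N) (k : D.ktilde) :
    D.fock.grp k = fockU N ⟨k.1, k.2.1⟩ := rfl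

theorem fock_equivariant (D : DualPair N) (k : D.ktilde) (X : D.lieG) (f : Fock N) :
    D.fock.grp k (D.fock.lie X f) = D.fock.lie (D.Ad k X) (D.fock.grp k f) :=
  LinearMap.congr_fun (fockU_fockOp ⟨k.1, k.2.1⟩ (X : Mat N)) f

theorem fock_lie_comm (D : DualPair N) (X : D.lieG) (X' : D.swap.lieG) (f : Fock N) :
    D.fock.lie X (D.swap.fock.lie X' f) = D.swap.fock.lie X' (D.fock.lie X f) := by
  have h := lie_fockOp (D.lieG_le X.2) (D.swap.lieG_le X'.2)
  have h0 : ⁅(X : Mat N), (X' : Mat N)⁆ = 0 := by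
    rw [LieRing.of_associative_ring_bracket, D.lieG_lie_lieG' X X', sub_self]
  have hz : fockOp (0 : Mat N) = 0 := map_zero (fockSp N)
  rw [h0, hz, LieRing.of_associative_ring_bracket, sub_eq_zero] at h
  exact LinearMap.congr_fun h f

theorem fock_grp_lie_comm (D : DualPair N) (k : D.ktilde) (X' : D.swap.lieG) (f : Fock N) :
    D.fock.grp k (D.swap.fock.lie X' f) = D.swap.fock.lie X' (D.fock.grp k f) := by
  have h := LinearMap.congr_fun (fockU_fockOp ⟨k.1, k.2.1⟩ (X' : Mat N)) f
  have hc : (k.1.1 : Mat N) * (X' : Mat N) = (X' : Mat N) * (k.1.1 : Mat N) :=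
    (D.swap.mem_lieG_iff.1 X'.2).2 k.1.1 k.2.2
  have e : (k.1.1 : Mat N) * (X' : Mat N) * ((k.1.1⁻¹ : Sp N) : Mat N) = (X' : Mat N) := by
    rw [hc, Matrix.mul_assoc, ← Submonoid.coe_mul, mul_inv_cancel, Submonoid.coe_one,
      Matrix.mul_one]
  rw [e] at h
  exact h

theorem fock_grp_comm (D : DualPair N) (k : D.ktilde) (k' : D.swap.ktilde) (f : Fock N) :
    D.fock.grp k (D.swap.fock.grp k' f) = D.swap.fock.grp k' (D.fock.grp k f) := by
  have hc : k.1.1 * k'.1.1 = k'.1.1 * k.1.1 := by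
    have h : k.1.1 ∈ Subgroup.centralizer (D.G' : Set (Sp N)) := by
      rw [D.centralizer_G']
      exact k.2.2
    exact ((Subgroup.mem_centralizer_iff.1 h) k'.1.1 k'.2.2).symm
  have e : (⟨k.1, k.2.1⟩ : utilde N) * ⟨k'.1, k'.2.1⟩ = ⟨k'.1, k'.2.1⟩ * ⟨k.1, k.2.1⟩ :=
    Subtype.ext (Prod.ext hc (mul_comm _ _))
  have h := congrArg (fockU N) e
  rw [map_mul, map_mul] at h
  exact LinearMap.congr_fun h f

/-! ### Full theta lifts -/

variable {V' : Type*} [AddCommGroup V'] [Module ℂ V']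

/-- The intersection of the kernels of all `(𝔤', K̃')`-homomorphisms `𝒴 → ρ'`. -/
def howeKernel (D : DualPair N) (ρ' : GKAct D.swap V') : Submodule ℂ (Fock N) :=
  ⨅ T : {T : Fock N →ₗ[ℂ] V' // IsIntertwining D.swap.fock ρ' T}, LinearMap.ker T.1

/-- A `(𝔤, K̃)`-module `Θ` is the full theta lift of `ρ'` if `𝒴 / ⋂ ker T ≅ ρ' ⊗ Θ`, compatibly
with the actions of `𝔤'`, `K̃'` (on `ρ'`) and of `𝔤`, `K̃` (on `Θ`). -/
def IsFullThetaLift (D : DualPair N) (ρ' : GKAct D.swap V') {T : Type*} [AddCommGroup T]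
    [Module ℂ T] (Θ : GKAct D T) : Prop :=
  Θ.IsGKModule ∧
    ∃ e : (Fock N ⧸ D.howeKernel ρ') ≃ₗ[ℂ] V' ⊗[ℂ] T,
      (∀ (X' : D.swap.lieG) (y : Fock N),
        e ((D.howeKernel ρ').mkQ (D.swap.fock.lie X' y))
          = (ρ'.lie X').rTensor T (e ((D.howeKernel ρ').mkQ y))) ∧
      (∀ (k' : D.swap.ktilde) (y : Fock N),
        e ((D.howeKernel ρ').mkQ (D.swap.fock.grp k' y))
          = (ρ'.grp k').rTensor T (e ((D.howeKernel ρ').mkQ y))) ∧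
      (∀ (X : D.lieG) (y : Fock N),
        e ((D.howeKernel ρ').mkQ (D.fock.lie X y))
          = (Θ.lie X).lTensor V' (e ((D.howeKernel ρ').mkQ y))) ∧
      (∀ (k : D.ktilde) (y : Fock N),
        e ((D.howeKernel ρ').mkQ (D.fock.grp k y))
          = (Θ.grp k).lTensor V' (e ((D.howeKernel ρ').mkQ y)))

/-- `E = V_{ρ'^*} ⊗ 𝒴` with its (diagonal) actions of `𝔤'` and `K̃'`. The nontrivial element `(1, -1)`
of the kernel of `K̃' → K'` acts on `𝒴` by `-1`; if `ρ'` is genuine, it acts by `-1` on `V_{ρ'^*}` as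
well, so that `K̃'` acts on `E` through `K'`, and (co)invariants of `K̃'` are those of `K'`. -/
def bigE' (D : DualPair N) (ρ' : GKAct D.swap V') (h : ρ'.IsGKModule) :
    GKAct D.swap (ρ'.DualSpace ⊗[ℂ] Fock N) :=
  (ρ'.contragredient h).tensor D.swap.fock

/-- `E = V_{ρ'^*} ⊗ 𝒴` with the actions of `𝔤` and `K̃` through `𝒴`. -/
def bigE (D : DualPair N) (ρ' : GKAct D.swap V') :
    GKAct D (ρ'.DualSpace ⊗[ℂ] Fock N) :=
  GKAct.onRight ρ'.DualSpace D.fock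

variable (D : DualPair N) (ρ' : GKAct D.swap V') (h : ρ'.IsGKModule)

theorem bigE_lie_lie (X : D.lieG) (X' : D.swap.lieG) (e : ρ'.DualSpace ⊗[ℂ] Fock N) :
    (D.bigE ρ').lie X ((D.bigE' ρ' h).lie X' e) = (D.bigE' ρ' h).lie X' ((D.bigE ρ').lie X e) := by
  induction e with
  | zero => simp only [map_zero]
  | add x y hx hy => simp only [map_add, hx, hy]
  | tmul l f =>
    change (D.fock.lie X).lTensor _ (((ρ'.contragredient h).lie X' l) ⊗ₜ[ℂ] f
        + l ⊗ₜ[ℂ] (D.swap.fock.lie X' f))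
      = ((ρ'.contragredient h).lie X' l) ⊗ₜ[ℂ] (D.fock.lie X f)
        + l ⊗ₜ[ℂ] (D.swap.fock.lie X' (D.fock.lie X f))
    rw [map_add, LinearMap.lTensor_tmul, LinearMap.lTensor_tmul, D.fock_lie_comm]

theorem bigE_lie_grp (X : D.lieG) (k' : D.swap.ktilde) (e : ρ'.DualSpace ⊗[ℂ] Fock N) :
    (D.bigE ρ').lie X ((D.bigE' ρ' h).grp k' e) = (D.bigE' ρ' h).grp k' ((D.bigE ρ').lie X e) := by
  induction e with
  | zero => simp only [map_zero]
  | add x y hx hy => simp only [map_add, hx, hy]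
  | tmul l f =>
    change ((ρ'.contragredient h).grp k' l) ⊗ₜ[ℂ] (D.fock.lie X (D.swap.fock.grp k' f))
      = ((ρ'.contragredient h).grp k' l) ⊗ₜ[ℂ] (D.swap.fock.grp k' (D.fock.lie X f))
    exact congrArg _ (D.swap.fock_grp_lie_comm k' X f).symm

theorem bigE_grp_lie (k : D.ktilde) (X' : D.swap.lieG) (e : ρ'.DualSpace ⊗[ℂ] Fock N) :
    (D.bigE ρ').grp k ((D.bigE' ρ' h).lie X' e) = (D.bigE' ρ' h).lie X' ((D.bigE ρ').grp k e) := by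
  induction e with
  | zero => simp only [map_zero]
  | add x y hx hy => simp only [map_add, hx, hy]
  | tmul l f =>
    change (D.fock.grp k).lTensor _ (((ρ'.contragredient h).lie X' l) ⊗ₜ[ℂ] f
        + l ⊗ₜ[ℂ] (D.swap.fock.lie X' f))
      = ((ρ'.contragredient h).lie X' l) ⊗ₜ[ℂ] (D.fock.grp k f)
        + l ⊗ₜ[ℂ] (D.swap.fock.lie X' (D.fock.grp k f))
    rw [map_add, LinearMap.lTensor_tmul, LinearMap.lTensor_tmul, D.fock_grp_lie_comm]

theorem bigE_grp_grp (k : D.ktilde) (k' : D.swap.ktilde) (e : ρ'.DualSpace ⊗[ℂ] Fock N) :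
    (D.bigE ρ').grp k ((D.bigE' ρ' h).grp k' e) = (D.bigE' ρ' h).grp k' ((D.bigE ρ').grp k e) := by
  induction e with
  | zero => simp only [map_zero]
  | add x y hx hy => simp only [map_add, hx, hy]
  | tmul l f =>
    change ((ρ'.contragredient h).grp k' l) ⊗ₜ[ℂ] (D.fock.grp k (D.swap.fock.grp k' f))
      = ((ρ'.contragredient h).grp k' l) ⊗ₜ[ℂ] (D.swap.fock.grp k' (D.fock.grp k f))
    exact congrArg _ (D.fock_grp_comm k k' f)

theorem bigE'_equivariant (k' : D.swap.ktilde) (X' : D.swap.lieG)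
    (e : ρ'.DualSpace ⊗[ℂ] Fock N) :
    (D.bigE' ρ' h).grp k' ((D.bigE' ρ' h).lie X' e)
      = (D.bigE' ρ' h).lie (D.swap.Ad k' X') ((D.bigE' ρ' h).grp k' e) := by
  induction e with
  | zero => simp only [map_zero]
  | add x y hx hy => simp only [map_add, hx, hy]
  | tmul l f =>
    have hl : (ρ'.contragredient h).grp k' ((ρ'.contragredient h).lie X' l)
        = (ρ'.contragredient h).lie (D.swap.Ad k' X') ((ρ'.contragredient h).grp k' l) := by
      refine Subtype.ext (LinearMap.ext fun v => ?_)
      have h1 := h.equivariant k'⁻¹ (D.swap.Ad k' X') v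
      have h2 : D.swap.Ad k'⁻¹ (D.swap.Ad k' X') = X' := by
        have := D.swap.Ad_inv_Ad k'⁻¹ X'
        rwa [inv_inv] at this
      rw [h2] at h1
      change -(l.1 (ρ'.lie X' (ρ'.grp k'⁻¹ v)))
        = -(l.1 (ρ'.grp k'⁻¹ (ρ'.lie (D.swap.Ad k' X') v)))
      rw [h1]
    change TensorProduct.map ((ρ'.contragredient h).grp k') (D.swap.fock.grp k')
        (((ρ'.contragredient h).lie X' l) ⊗ₜ[ℂ] f + l ⊗ₜ[ℂ] (D.swap.fock.lie X' f))
      = ((ρ'.contragredient h).lie (D.swap.Ad k' X') ((ρ'.contragredient h).grp k' l))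
          ⊗ₜ[ℂ] (D.swap.fock.grp k' f)
        + ((ρ'.contragredient h).grp k' l)
          ⊗ₜ[ℂ] (D.swap.fock.lie (D.swap.Ad k' X') (D.swap.fock.grp k' f))
    rw [map_add, TensorProduct.map_tmul, TensorProduct.map_tmul, hl, D.swap.fock_equivariant]

/-- The `(𝔤, K̃)`-module `(V_{ρ'^*} ⊗ 𝒴)_{𝔤', K'}`. -/
def coinvariants : GKAct D ((ρ'.DualSpace ⊗[ℂ] Fock N) ⧸ (D.bigE' ρ' h).gkSpan) :=
  (D.bigE ρ').quot (D.bigE' ρ' h).gkSpan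
    (fun X => by
      change (D.bigE' ρ' h).gkSpan ≤ (D.bigE' ρ' h).gkSpan.comap ((D.bigE ρ').lie X)
      conv_lhs => rw [GKAct.gkSpan]
      rw [Submodule.span_le]
      rintro _ (⟨X', v, rfl⟩ | ⟨k', v, rfl⟩)
      · exact Submodule.subset_span (Or.inl ⟨X', _, D.bigE_lie_lie ρ' h X X' v⟩)
      · refine Submodule.subset_span (Or.inr ⟨k', (D.bigE ρ').lie X v, ?_⟩)
        rw [map_sub, D.bigE_lie_grp])
    (fun k => by
      change (D.bigE' ρ' h).gkSpan ≤ (D.bigE' ρ' h).gkSpan.comap ((D.bigE ρ').grp k)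
      conv_lhs => rw [GKAct.gkSpan]
      rw [Submodule.span_le]
      rintro _ (⟨X', v, rfl⟩ | ⟨k', v, rfl⟩)
      · exact Submodule.subset_span (Or.inl ⟨X', _, D.bigE_grp_lie ρ' h k X' v⟩)
      · refine Submodule.subset_span (Or.inr ⟨k', (D.bigE ρ').grp k v, ?_⟩)
        rw [map_sub, D.bigE_grp_grp])

/-- The `(𝔤, K̃)`-module `(V_{ρ'^*} ⊗ 𝒴)_{𝔭'}`. -/
def pCoinvariants : GKAct D ((ρ'.DualSpace ⊗[ℂ] Fock N) ⧸ (D.bigE' ρ' h).pSpan) :=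
  (D.bigE ρ').quot (D.bigE' ρ' h).pSpan
    (fun X => by
      change (D.bigE' ρ' h).pSpan ≤ (D.bigE' ρ' h).pSpan.comap ((D.bigE ρ').lie X)
      conv_lhs => rw [GKAct.pSpan]
      rw [Submodule.span_le]
      rintro _ ⟨X', v, hX', rfl⟩
      exact Submodule.subset_span ⟨X', _, hX', D.bigE_lie_lie ρ' h X X' v⟩)
    (fun k => by
      change (D.bigE' ρ' h).pSpan ≤ (D.bigE' ρ' h).pSpan.comap ((D.bigE ρ').grp k)
      conv_lhs => rw [GKAct.pSpan]
      rw [Submodule.span_le]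
      rintro _ ⟨X', v, hX', rfl⟩
      exact Submodule.subset_span ⟨X', _, hX', D.bigE_grp_lie ρ' h k X' v⟩)

/-- The `(𝔤, K̃)`-module `((V_{ρ'^*} ⊗ 𝒴)_{𝔭'})^{K'}`. -/
def pCoinvariantsInvariants :
    GKAct D ((D.bigE' ρ' h).pCoinvInvariants (D.bigE'_equivariant ρ' h)) :=
  (D.pCoinvariants ρ' h).sub _
    (fun X v hv k' => by
      have hv' := hv k'
      induction v using Submodule.Quotient.induction_on with
      | H v =>
        have e := congrArg ((D.bigE' ρ' h).pSpan.mkQ) (D.bigE_lie_grp ρ' h X k' v)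
        exact e.symm.trans (congrArg ((D.pCoinvariants ρ' h).lie X) hv'))
    (fun k v hv k' => by
      have hv' := hv k'
      induction v using Submodule.Quotient.induction_on with
      | H v =>
        have e := congrArg ((D.bigE' ρ' h).pSpan.mkQ) (D.bigE_grp_grp ρ' h k k' v)
        exact e.symm.trans (congrArg ((D.pCoinvariants ρ' h).grp k) hv'))

end DualPair

end ThetaLift

end

/-! Write V for the space of ρ', V* for its contragredient, Y for the Fock model and C for the
coinvariants of V* ⊗ Y under 𝔤' and K̃'. A functional on C is an invariant pairing of V* with Y. If
V were finite-dimensional, such a pairing would be an intertwining map Y → V, and the classes [l ⊗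
y] would be the contractions of an element of V ⊗ C depending linearly on y; the map Y → V ⊗ C
obtained in this way is the universal quotient. For infinite-dimensional V a pairing only gives a
map from Y to the full dual of V*, so the point is that l ↦ [l ⊗ y] still comes from V ⊗ C
(`exists_contract_eq`). Since y lies in a finite-dimensional K̃'-stable subspace M, this follows
once every invariant functional on V* ⊗ M is given by an invariant of M* ⊗ V
(`exists_dualPairing_eq`), and that holds because these invariants form a finite-dimensional space
(`finiteDimensional_invariants`).

The resulting map `coinvMap` has the Howe kernel as its kernel, because K̃'-finite functionals
separate the points of V. It is onto because, by Schur's lemma and Jacobson density, a subspace of V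
⊗ C stable under the actions on V is everything as soon as its contractions span C
(`eq_top_of_contract`). For any other lift Θ, contraction defines a map C → Θ. It is bijective
because every intertwining map Y → V factors through V ⊗ Θ and, by Schur's lemma, is there
contraction with a functional on Θ (`coinvDesc_bijective`).

Finiteness of the invariants is Harish-Chandra's admissibility theorem, proved by leading symbols.
An irreducible module is generated by a finite-dimensional K̃-stable subspace and is filtered by the
length of words in the Lie algebra. The graded module is annihilated by the symbols of 𝔨, by the
linear forms vanishing on 𝔤, and by the symbols of the Casimir operators tr Ω^m, which are scalars
by a Schur lemma for countable dimension. The common zeros of these symbols are nilpotent matrices T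
in the complexified 𝔭. Such a T is [h, T] for some h in 𝔨, so by Euler's identity every homogeneous
K̃-invariant polynomial of positive degree vanishes at T. The Nullstellensatz and Hilbert's
averaging argument then push all covariants of large degree into the annihilator, and all invariants
of F ⊗ V lie in a single finite-dimensional step of the filtration.

The second description of the lift comes from averaging over the compact group K̃'. Modulo the image
of 𝔭' only 𝔨' and K̃' remain to be divided out, and for a compact group coinvariants and invariants
agree. -/

noncomputable section

namespace ThetaLift

/-! ### Functions with values in a finite-dimensional subspace -/

section FiniteFunctions

variable {X : Type*} [TopologicalSpace X]
variable {V W U : Type*} [AddCommGroup V] [Module ℂ V] [AddCommGroup W] [Module ℂ W]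
  [AddCommGroup U] [Module ℂ U]

variable (X V) in
/-- The finite sums `x ↦ ∑ c_i(x) v_i` with continuous scalar functions `c_i`. -/
def finCont : Submodule ℂ (X → V) :=
  Submodule.span ℂ {F | ∃ (c : X → ℂ) (v : V), Continuous c ∧ F = fun x => c x • v}

theorem smul_mem_finCont {c : X → ℂ} (hc : Continuous c) (v : V) :
    (fun x => c x • v) ∈ finCont X V :=
  Submodule.subset_span ⟨c, v, hc, rfl⟩

theorem const_mem_finCont (v : V) : (fun _ => v) ∈ finCont X V := by
  simpa using smul_mem_finCont (X := X) (c := fun _ => 1) continuous_const v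

theorem sum_mem_finCont {ι : Type*} (s : Finset ι) {F : ι → X → V}
    (h : ∀ i ∈ s, F i ∈ finCont X V) : (fun x => ∑ i ∈ s, F i x) ∈ finCont X V := by
  have := Submodule.sum_mem _ h
  convert this using 1
  ext x
  simp

theorem finCont_map (T : V →ₗ[ℂ] W) {F : X → V} (hF : F ∈ finCont X V) :
    (fun x => T (F x)) ∈ finCont X W := by
  induction hF using Submodule.span_induction with
  | mem F h =>
    obtain ⟨c, v, hc, rfl⟩ := h
    simpa using smul_mem_finCont hc (T v)
  | zero => simp only [Pi.zero_apply, map_zero]; exact (finCont X W).zero_mem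
  | add F G _ _ hF hG => simpa using! (finCont X W).add_mem hF hG
  | smul a F _ hF => simpa using! (finCont X W).smul_mem a hF

theorem finCont_bilin (B : V →ₗ[ℂ] W →ₗ[ℂ] U) {F : X → V} {G : X → W} (hF : F ∈ finCont X V)
    (hG : G ∈ finCont X W) : (fun x => B (F x) (G x)) ∈ finCont X U := by
  induction hF using Submodule.span_induction with
  | mem F h =>
    obtain ⟨c, v, hc, rfl⟩ := h
    induction hG using Submodule.span_induction with
    | mem G h =>
      obtain ⟨d, w, hd, rfl⟩ := h
      simpa [smul_smul, mul_comm] using smul_mem_finCont (hd.mul hc) (B v w)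
    | zero => simp only [Pi.zero_apply, map_zero]; exact (finCont X U).zero_mem
    | add F G _ _ hF hG => simpa using! (finCont X U).add_mem hF hG
    | smul a F _ hF =>
      convert (finCont X U).smul_mem a hF using 1
      ext x
      simp [smul_comm a]
  | zero => simp only [Pi.zero_apply, map_zero, LinearMap.zero_apply]; exact (finCont X U).zero_mem
  | add F G _ _ hF hG => simpa using! (finCont X U).add_mem hF hG
  | smul a F _ hF => simpa using! (finCont X U).smul_mem a hF

theorem continuous_of_mem_finCont {F : X → V} (hF : F ∈ finCont X V) (l : Module.Dual ℂ V) :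
    Continuous fun x => l (F x) := by
  induction hF using Submodule.span_induction with
  | mem F h =>
    obtain ⟨c, v, hc, rfl⟩ := h
    simpa using! hc.mul continuous_const
  | zero => simpa using! continuous_const
  | add F G _ _ hF hG => simpa using! hF.add hG
  | smul a F _ hF => simpa using! continuous_const.mul hF

theorem continuous_iff_mem_finCont {c : X → ℂ} : c ∈ finCont X ℂ ↔ Continuous c :=
  ⟨fun h => continuous_of_mem_finCont h LinearMap.id,
    fun h => by simpa using smul_mem_finCont h (1 : ℂ)⟩

theorem finiteDimensional_of_mem_finCont {F : X → V} (hF : F ∈ finCont X V) :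
    FiniteDimensional ℂ (Submodule.span ℂ (Set.range F)) := by
  induction hF using Submodule.span_induction with
  | mem F h =>
    obtain ⟨c, v, hc, rfl⟩ := h
    refine Submodule.finiteDimensional_of_le (S₂ := Submodule.span ℂ {v}) ?_
    rw [Submodule.span_le]
    rintro _ ⟨x, rfl⟩
    exact Submodule.smul_mem _ _ (Submodule.mem_span_singleton_self v)
  | zero =>
    refine Submodule.finiteDimensional_of_le (S₂ := ⊥) ?_
    rw [Submodule.span_le]
    rintro _ ⟨x, rfl⟩
    simp
  | add F G _ _ hF hG =>
    refine Submodule.finiteDimensional_of_le (S₂ := Submodule.span ℂ (Set.range F) ⊔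
      Submodule.span ℂ (Set.range G)) ?_
    rw [Submodule.span_le]
    rintro _ ⟨x, rfl⟩
    exact Submodule.add_mem_sup (Submodule.subset_span ⟨x, rfl⟩) (Submodule.subset_span ⟨x, rfl⟩)
  | smul a F _ hF =>
    refine Submodule.finiteDimensional_of_le (S₂ := Submodule.span ℂ (Set.range F)) ?_
    rw [Submodule.span_le]
    rintro _ ⟨x, rfl⟩
    exact Submodule.smul_mem _ _ (Submodule.subset_span ⟨x, rfl⟩)

/-- A family of functionals separating the points of a finite-dimensional subspace `S` provides
coordinates on `S`. -/
theorem exists_coordinates {ι : Type*} (Λ : ι → Module.Dual ℂ V) (S : Submodule ℂ V)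
    [FiniteDimensional ℂ S] (hS : ∀ v ∈ S, (∀ i, Λ i v = 0) → v = 0) :
    ∃ (s : Finset ι) (w : ι → V), ∀ v ∈ S, v = ∑ i ∈ s, Λ i v • w i := by
  classical
  let r : ι → Module.Dual ℂ S := fun i => (Λ i).comp S.subtype
  have hfg : (Submodule.span ℂ (Set.range r)).FG := IsNoetherian.noetherian _
  -- As S is finite-dimensional, finitely many of the restrictions already span all of them and
  -- still separate the points of S. A left inverse of the resulting injection S → ℂ^s supplies the
  -- vectors w.
  obtain ⟨t, ht, hspan⟩ := (Submodule.fg_span_iff_fg_span_finset_subset _).1 hfg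
  obtain ⟨s, rfl⟩ : ∃ s : Finset ι, s.image r = t := by
    have := (Finset.subset_set_image_iff (s := Set.univ) (f := r) (t := t)).1 (by simpa using ht)
    obtain ⟨s, -, hs⟩ := this
    exact ⟨s, hs⟩
  let ev : S →ₗ[ℂ] (s → ℂ) := LinearMap.pi fun i => r i
  have hker : LinearMap.ker ev = ⊥ := by
    rw [LinearMap.ker_eq_bot']
    intro v hv
    refine Subtype.ext (hS v v.2 fun i => ?_)
    have hi : r i ∈ Submodule.span ℂ ((s.image r : Finset _) : Set (Module.Dual ℂ S)) := by
      rw [← hspan]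
      exact Submodule.subset_span ⟨i, rfl⟩
    have : ∀ f ∈ Submodule.span ℂ ((s.image r : Finset _) : Set (Module.Dual ℂ S)), f v = 0 := by
      intro f hf
      induction hf using Submodule.span_induction with
      | mem f hf =>
        simp only [Finset.coe_image, Set.mem_image] at hf
        obtain ⟨j, hj, rfl⟩ := hf
        exact congrFun hv ⟨j, hj⟩
      | zero => rfl
      | add f g _ _ hf hg => simp [hf, hg]
      | smul a f _ hf => simp [hf]
    exact this _ hi
  obtain ⟨g, hg⟩ := LinearMap.exists_leftInverse_of_injective ev hker
  -- The value outside `s` is immaterial, since the sum runs over `s`.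
  refine ⟨s, fun i => if hi : i ∈ s then (g (Pi.single ⟨i, hi⟩ 1) : V) else 0, fun v hv => ?_⟩
  have h1 : g (ev ⟨v, hv⟩) = ⟨v, hv⟩ := LinearMap.congr_fun hg _
  have h2 : ev ⟨v, hv⟩ = ∑ i : s, Λ i v • (Pi.single i 1 : s → ℂ) := by
    ext j
    simp [ev, r, Finset.sum_apply, Pi.single_apply]
  rw [h2, map_sum] at h1
  have h3 := congrArg Subtype.val h1
  rw [← Finset.sum_coe_sort s]
  simpa using h3.symm

/-- Coordinates on S are given by finitely many Λ i, so scalar continuity along the Λ i is enough,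
and V itself needs no topology. For spaces of functionals the Λ i will be evaluations at vectors. -/
theorem mem_finCont_of_separating {ι : Type*} (Λ : ι → Module.Dual ℂ V) (S : Submodule ℂ V)
    [FiniteDimensional ℂ S] (hS : ∀ v ∈ S, (∀ i, Λ i v = 0) → v = 0) {F : X → V}
    (hF : ∀ x, F x ∈ S) (hc : ∀ i, Continuous fun x => Λ i (F x)) : F ∈ finCont X V := by
  obtain ⟨s, w, h⟩ := exists_coordinates Λ S hS
  have : F = fun x => ∑ i ∈ s, Λ i (F x) • w i := funext fun x => h _ (hF x)
  rw [this]
  exact sum_mem_finCont s fun i _ => smul_mem_finCont (hc i) (w i)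

theorem mem_finCont_of_dual {F : X → V}
    (hF : FiniteDimensional ℂ (Submodule.span ℂ (Set.range F)))
    (hc : ∀ l : Module.Dual ℂ V, Continuous fun x => l (F x)) : F ∈ finCont X V :=
  mem_finCont_of_separating (fun l : Module.Dual ℂ V => l) (Submodule.span ℂ (Set.range F))
    (fun v _ h => (Module.forall_dual_apply_eq_zero_iff ℂ v).1 h)
    (fun x => Submodule.subset_span ⟨x, rfl⟩) hc

/-! ### Derivatives of such functions -/

variable (V) in
/-- The pairs `(F, F'(0))`, where `F(t) = ∑ c_i(t) v_i` is a finite sum with scalar functions `c_i`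
differentiable at `0`. -/
def finDeriv : Submodule ℂ ((ℝ → V) × V) :=
  Submodule.span ℂ {p | ∃ (c : ℝ → ℂ) (c' : ℂ) (v : V), HasDerivAt c c' 0 ∧
    p = (fun t => c t • v, c' • v)}

theorem smul_mem_finDeriv {c : ℝ → ℂ} {c' : ℂ} (hc : HasDerivAt c c' 0) (v : V) :
    ((fun t => c t • v, c' • v) : (ℝ → V) × V) ∈ finDeriv V :=
  Submodule.subset_span ⟨c, c', v, hc, rfl⟩

theorem const_mem_finDeriv (v : V) : ((fun _ => v, 0) : (ℝ → V) × V) ∈ finDeriv V := by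
  simpa using smul_mem_finDeriv (hasDerivAt_const (0 : ℝ) (1 : ℂ)) v

theorem sum_mem_finDeriv {ι : Type*} (s : Finset ι) {F : ι → ℝ → V} {F' : ι → V}
    (h : ∀ i ∈ s, (F i, F' i) ∈ finDeriv V) :
    ((fun t => ∑ i ∈ s, F i t, ∑ i ∈ s, F' i) : (ℝ → V) × V) ∈ finDeriv V := by
  have := Submodule.sum_mem _ h
  convert this using 1
  refine Prod.ext ?_ (by simp [Prod.snd_sum])
  ext x
  simp [Prod.fst_sum]

theorem finDeriv_map (T : V →ₗ[ℂ] W) {p : (ℝ → V) × V} (hp : p ∈ finDeriv V) :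
    ((fun t => T (p.1 t), T p.2) : (ℝ → W) × W) ∈ finDeriv W := by
  induction hp using Submodule.span_induction with
  | mem p h =>
    obtain ⟨c, c', v, hc, rfl⟩ := h
    simpa using smul_mem_finDeriv hc (T v)
  | zero =>
    simp only [Prod.fst_zero, Prod.snd_zero, Pi.zero_apply, map_zero]
    exact (finDeriv W).zero_mem
  | add F G _ _ hF hG => simpa using! (finDeriv W).add_mem hF hG
  | smul a F _ hF => simpa using! (finDeriv W).smul_mem a hF

/-- This is the product rule: on pure terms it is the rule for the scalar coefficients, and the
expression is linear in each pair. -/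
theorem finDeriv_bilin (B : V →ₗ[ℂ] W →ₗ[ℂ] U) {p : (ℝ → V) × V} {q : (ℝ → W) × W}
    (hp : p ∈ finDeriv V) (hq : q ∈ finDeriv W) :
    ((fun t => B (p.1 t) (q.1 t), B p.2 (q.1 0) + B (p.1 0) q.2) : (ℝ → U) × U)
      ∈ finDeriv U := by
  induction hp using Submodule.span_induction with
  | mem p h =>
    obtain ⟨c, c', v, hc, rfl⟩ := h
    induction hq using Submodule.span_induction with
    | mem q h =>
      obtain ⟨d, d', w, hd, rfl⟩ := h
      simpa [smul_smul, add_smul, mul_comm, add_comm] using smul_mem_finDeriv (hc.mul hd) (B v w)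
    | zero =>
    simp only [Prod.fst_zero, Prod.snd_zero, Pi.zero_apply, map_zero, add_zero]
    exact (finDeriv U).zero_mem
    | add F G _ _ hF hG =>
      convert (finDeriv U).add_mem hF hG using 1
      refine Prod.ext ?_ ?_
      · ext; simp
      · simp; abel
    | smul a F _ hF =>
      convert (finDeriv U).smul_mem a hF using 1
      refine Prod.ext ?_ ?_
      · ext; simp [smul_comm a]
      · simp [smul_comm a]
  | zero =>
    simp only [Prod.fst_zero, Prod.snd_zero, Pi.zero_apply, map_zero, LinearMap.zero_apply, add_zero]
    exact (finDeriv U).zero_mem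
  | add F G _ _ hF hG =>
    convert (finDeriv U).add_mem hF hG using 1
    refine Prod.ext ?_ ?_
    · ext; simp
    · simp; abel
  | smul a F _ hF =>
    convert (finDeriv U).smul_mem a hF using 1
    refine Prod.ext ?_ ?_
    · ext; simp
    · simp

theorem hasDerivAt_of_mem_finDeriv {F : ℝ → V} {F' : V} (hF : (F, F') ∈ finDeriv V)
    (l : Module.Dual ℂ V) : HasDerivAt (fun t => l (F t)) (l F') 0 := by
  suffices h : ∀ p ∈ finDeriv V, HasDerivAt (fun t => l (p.1 t)) (l p.2) 0 from h _ hF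
  intro p hp
  induction hp using Submodule.span_induction with
  | mem p h =>
    obtain ⟨c, c', v, hc, rfl⟩ := h
    simpa using! hc.mul_const (l v)
  | zero => simpa using! hasDerivAt_const (0 : ℝ) (0 : ℂ)
  | add F G _ _ hF hG => simpa using! hF.add hG
  | smul a F _ hF => simpa using! hF.const_mul a

theorem hasDerivAt_iff_mem_finDeriv {c : ℝ → ℂ} {c' : ℂ} :
    (c, c') ∈ finDeriv ℂ ↔ HasDerivAt c c' 0 :=
  ⟨fun h => hasDerivAt_of_mem_finDeriv h LinearMap.id,
    fun h => by simpa using smul_mem_finDeriv h (1 : ℂ)⟩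

theorem mem_finDeriv_of_separating {ι : Type*} (Λ : ι → Module.Dual ℂ V) (S : Submodule ℂ V)
    [FiniteDimensional ℂ S] (hΛ : ∀ v, (∀ i, Λ i v = 0) → v = 0) {F : ℝ → V} {F' : V}
    (hF : ∀ x, F x ∈ S) (hc : ∀ i, HasDerivAt (fun t => Λ i (F t)) (Λ i F') 0) :
    (F, F') ∈ finDeriv V := by
  -- The vector F' is not known to lie in S, so S is enlarged by it; this is why separation is
  -- required on all of V.
  obtain ⟨s, w, h⟩ := exists_coordinates Λ (S ⊔ Submodule.span ℂ {F'}) fun v _ => hΛ v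
  have h1 : F = fun x => ∑ i ∈ s, Λ i (F x) • w i :=
    funext fun x => h _ (Submodule.mem_sup_left (hF x))
  have h2 : F' = ∑ i ∈ s, Λ i F' • w i :=
    h _ (Submodule.mem_sup_right (Submodule.mem_span_singleton_self _))
  rw [h1, h2]
  exact sum_mem_finDeriv s fun i _ => smul_mem_finDeriv (hc i) (w i)

end FiniteFunctions

/-! ### Locally finite continuous representations, and tests by functionals. -/

section LFC

variable {K : Type*} [Group K] [TopologicalSpace K]
variable {V : Type*} [AddCommGroup V] [Module ℂ V]

/-- A representation is locally finite and continuous if every orbit map lies in `finCont`. -/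
def IsLFC (ρ : K →* Module.End ℂ V) : Prop := ∀ v, (fun k => ρ k v) ∈ finCont K V

theorem eq_of_dual {v w : V} (h : ∀ l : Module.Dual ℂ V, l v = l w) : v = w := by
  rw [← sub_eq_zero, ← Module.forall_dual_apply_eq_zero_iff ℂ]
  intro l
  rw [map_sub, h, sub_self]

/-- A vector outside S is detected by a functional vanishing on S. This stands in for closedness:
averages and derivatives of vectors of S are seen to lie in S by testing one functional at a time.
-/
theorem mem_of_dual {S : Submodule ℂ V} {v : V}
    (h : ∀ l : Module.Dual ℂ V, (∀ w ∈ S, l w = 0) → l v = 0) : v ∈ S := by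
  by_contra hv
  obtain ⟨l, hl, hS⟩ := Submodule.exists_le_ker_of_notMem hv
  exact hl (h l fun w hw => hS hw)

theorem IsLFC.continuous {ρ : K →* Module.End ℂ V} (hρ : IsLFC ρ) (v : V) (l : Module.Dual ℂ V) :
    Continuous fun k => l (ρ k v) :=
  continuous_of_mem_finCont (hρ v) l

end LFC

/-! ### Averaging over a compact group -/

section Mean

variable {K : Type*} [Group K] [TopologicalSpace K] [IsTopologicalGroup K] [CompactSpace K]

/-- The mean value of a function on a compact group. -/
def haarMean (f : K → ℂ) : ℂ :=
  letI : MeasurableSpace K := borel K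
  haveI : BorelSpace K := ⟨rfl⟩
  ∫ k, f k ∂(MeasureTheory.Measure.haarMeasure (⊤ : TopologicalSpace.PositiveCompacts K))

theorem haarMean_properties :
    (∀ z : ℂ, haarMean (fun _ : K => z) = z) ∧
    (∀ f g : K → ℂ, Continuous f → Continuous g →
      haarMean (fun k => f k + g k) = haarMean f + haarMean g) ∧
    (∀ (z : ℂ) (f : K → ℂ), haarMean (fun k => z * f k) = z * haarMean f) ∧
    (∀ (x : K) (f : K → ℂ), haarMean (fun k => f (x * k)) = haarMean f) ∧
    (∀ (x : K) (f : K → ℂ), haarMean (fun k => f (k * x)) = haarMean f) := by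
  let _ : MeasurableSpace K := borel K
  have _ : BorelSpace K := ⟨rfl⟩
  set μ := MeasureTheory.Measure.haarMeasure (⊤ : TopologicalSpace.PositiveCompacts K) with hμ
  have hprob : MeasureTheory.IsProbabilityMeasure μ :=
    ⟨MeasureTheory.Measure.haarMeasure_self (K₀ := ⊤)⟩
  have hInt : ∀ f : K → ℂ, Continuous f → MeasureTheory.Integrable f μ := fun f hf =>
    hf.integrable_of_hasCompactSupport (HasCompactSupport.of_compactSpace f)
  -- A right translate of the normalised Haar measure is again a Haar probability measure, so
  -- uniqueness gives unimodularity.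
  have hright : μ.IsMulRightInvariant := by
    refine ⟨fun g => ?_⟩
    have : MeasureTheory.IsProbabilityMeasure (MeasureTheory.Measure.map (· * g) μ) :=
      MeasureTheory.Measure.isProbabilityMeasure_map
        (measurable_mul_const g).aemeasurable
    exact MeasureTheory.Measure.isHaarMeasure_eq_of_isProbabilityMeasure _ _
  refine ⟨fun z => ?_, fun f g hf hg => ?_, fun z f => ?_, fun x f => ?_, fun x f => ?_⟩
  · simp [haarMean, ← hμ]
  · exact MeasureTheory.integral_add (hInt f hf) (hInt g hg)
  · exact MeasureTheory.integral_const_mul _ _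
  · exact MeasureTheory.integral_mul_left_eq_self _ _
  · exact MeasureTheory.integral_mul_right_eq_self _ _

theorem haarMean_const (z : ℂ) : haarMean (fun _ : K => z) = z := haarMean_properties.1 z

theorem haarMean_add {f g : K → ℂ} (hf : Continuous f) (hg : Continuous g) :
    haarMean (fun k => f k + g k) = haarMean f + haarMean g := haarMean_properties.2.1 f g hf hg

theorem haarMean_const_mul (z : ℂ) (f : K → ℂ) : haarMean (fun k => z * f k) = z * haarMean f :=
  haarMean_properties.2.2.1 z f

theorem haarMean_mul_left (x : K) (f : K → ℂ) : haarMean (fun k => f (x * k)) = haarMean f :=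
  haarMean_properties.2.2.2.1 x f

theorem haarMean_mul_right (x : K) (f : K → ℂ) : haarMean (fun k => f (k * x)) = haarMean f :=
  haarMean_properties.2.2.2.2 x f

variable {V W : Type*} [AddCommGroup V] [Module ℂ V] [AddCommGroup W] [Module ℂ W]

/-- The integral of a vector-valued function is characterised by its values on functionals. For c(k)
v it is the mean of c times v, and sums follow from additivity of the mean on continuous functions.
-/
theorem exists_average {F : K → V} (hF : F ∈ finCont K V) :
    ∃ v : V, ∀ l : Module.Dual ℂ V, l v = haarMean fun k => l (F k) := by
  induction hF using Submodule.span_induction with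
  | mem F h =>
    obtain ⟨c, v, hc, rfl⟩ := h
    refine ⟨haarMean c • v, fun l => ?_⟩
    have := haarMean_const_mul (l v) c
    simp only [map_smul, smul_eq_mul]
    rw [mul_comm, ← this]
    simp only [mul_comm]
  | zero => exact ⟨0, fun l => by simpa using! (haarMean_const (K := K) 0).symm⟩
  | add F G hF' hG' hF hG =>
    obtain ⟨v, hv⟩ := hF
    obtain ⟨w, hw⟩ := hG
    refine ⟨v + w, fun l => ?_⟩
    rw [map_add, hv, hw, ← haarMean_add (continuous_of_mem_finCont hF' l)
      (continuous_of_mem_finCont hG' l)]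
    simp
  | smul a F _ hF =>
    obtain ⟨v, hv⟩ := hF
    refine ⟨a • v, fun l => ?_⟩
    rw [map_smul, hv, smul_eq_mul, ← haarMean_const_mul]
    simp

/-- The projection `v ↦ ∫ k v dk` onto the invariants. -/
def average (ρ : K →* Module.End ℂ V) (hρ : IsLFC ρ) : V →ₗ[ℂ] V where
  toFun v := (exists_average (hρ v)).choose
  map_add' v w := by
    refine eq_of_dual fun l => ?_
    rw [map_add, (exists_average (hρ _)).choose_spec, (exists_average (hρ v)).choose_spec,
      (exists_average (hρ w)).choose_spec, ← haarMean_add (hρ.continuous v l) (hρ.continuous w l)]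
    simp
  map_smul' a v := by
    refine eq_of_dual fun l => ?_
    rw [RingHom.id_apply, map_smul, (exists_average (hρ _)).choose_spec,
      (exists_average (hρ v)).choose_spec, smul_eq_mul, ← haarMean_const_mul]
    simp

variable {ρ : K →* Module.End ℂ V} (hρ : IsLFC ρ) {σ : K →* Module.End ℂ W} (hσ : IsLFC σ)

theorem dual_average (v : V) (l : Module.Dual ℂ V) :
    l (average ρ hρ v) = haarMean fun k => l (ρ k v) :=
  (exists_average (hρ v)).choose_spec l

theorem apply_average (k : K) (v : V) : ρ k (average ρ hρ v) = average ρ hρ v := by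
  refine eq_of_dual fun l => ?_
  rw [dual_average, ← haarMean_mul_left k fun x => l (ρ x v)]
  have := dual_average hρ v (l.comp (ρ k))
  simpa using this

theorem average_apply (k : K) (v : V) : average ρ hρ (ρ k v) = average ρ hρ v := by
  refine eq_of_dual fun l => ?_
  rw [dual_average, dual_average, ← haarMean_mul_right k fun x => l (ρ x v)]
  simp

theorem average_of_invariant {v : V} (h : ∀ k, ρ k v = v) : average ρ hρ v = v := by
  refine eq_of_dual fun l => ?_
  rw [dual_average]
  simp only [h]
  exact haarMean_const _

theorem map_average (T : V →ₗ[ℂ] W) {v : V} (h : ∀ k, T (ρ k v) = σ k (T v)) :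
    T (average ρ hρ v) = average σ hσ (T v) := by
  refine eq_of_dual fun l => ?_
  rw [dual_average]
  have := dual_average hρ v (l.comp T)
  simpa [h] using this

/-- A functional that kills all kv - v is constant on the orbit of v, so it takes the same value on
the average as on v. -/
theorem average_sub_mem (v : V) :
    average ρ hρ v - v ∈ Submodule.span ℂ (Set.range fun k => ρ k v - v) := by
  refine mem_of_dual fun l hl => ?_
  rw [map_sub, dual_average, sub_eq_zero]
  have : ∀ k, l (ρ k v) = l v := fun k => by
    have := hl _ (Submodule.subset_span ⟨k, rfl⟩)
    rwa [map_sub, sub_eq_zero] at this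
  simp only [this]
  exact haarMean_const _

end Mean

/-! ### The group `K̃` -/

section Group

variable {N : ℕ}

instance : IsTopologicalGroup (Sp N) where
  continuous_inv := by
    rw [continuous_induced_rng]
    have : (Subtype.val ∘ fun g : Sp N => g⁻¹)
        = fun g : Sp N => -(Matrix.J (Fin N) ℝ) * (g : Mat N)ᵀ * Matrix.J (Fin N) ℝ :=
      funext fun g => SymplecticGroup.coe_inv g
    rw [this]
    have h : Continuous fun g : Sp N => (g : Mat N) := continuous_subtype_val
    exact (continuous_const.matrix_mul h.matrix_transpose).matrix_mul continuous_const

theorem continuous_holPart : Continuous (holPart : Mat N → Matrix (Fin N) (Fin N) ℂ) := by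
  refine continuous_pi fun i => continuous_pi fun j => ?_
  have h : ∀ p q, Continuous fun X : Mat N => X p q := fun p q => by fun_prop
  have e : (fun X : Mat N => holPart X i j) = fun X : Mat N =>
      (((X (.inl i) (.inl j) + X (.inr i) (.inr j)) / 2 : ℝ) : ℂ)
        + (((X (.inr i) (.inl j) - X (.inl i) (.inr j)) / 2 : ℝ) : ℂ) * Complex.I := by
    funext X
    apply Complex.ext <;> simp [holPart]
  rw [e]
  fun_prop

/-- The columns are unit vectors, so every entry lies in [-1, 1]. -/
theorem isCompact_orthogonal : IsCompact {M : Mat N | Mᵀ * M = 1} := by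
  have hc : IsClosed {M : Mat N | Mᵀ * M = 1} :=
    isClosed_eq (by fun_prop) continuous_const
  have hb : IsCompact (Set.univ.pi fun _ => Set.univ.pi fun _ => Set.Icc (-1) 1 : Set (Mat N)) :=
    isCompact_univ_pi fun _ => isCompact_univ_pi fun _ => isCompact_Icc
  refine hb.of_isClosed_subset hc fun (M : Mat N) (hM : Mᵀ * M = 1) => ?_
  intro i _ j _
  have h := congrFun (congrFun hM j) j
  rw [Matrix.mul_apply, Matrix.one_apply_eq] at h
  have h1 : M i j * M i j ≤ 1 := by
    rw [← h]
    exact Finset.single_le_sum (f := fun k => Mᵀ j k * M k j)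
      (fun k _ => mul_self_nonneg (M k j)) (Finset.mem_univ i)
  exact abs_le.1 (abs_le_one_iff_mul_self_le_one.2 h1)

variable (D : DualPair N)

theorem ktilde_embedding :
    Topology.IsEmbedding fun k : D.ktilde => ((k.1.1 : Mat N), (k.1.2 : ℂ)) := by
  have h1 : Topology.IsEmbedding (Subtype.val : Sp N → Mat N) := Topology.IsEmbedding.subtypeVal
  have h2 : Topology.IsEmbedding (Units.val : ℂˣ → ℂ) := Units.isEmbedding_val₀
  exact (h1.prodMap h2).comp Topology.IsEmbedding.subtypeVal

theorem det_holPart_ne_zero {M : Mat N} (hM : M ∈ Matrix.symplecticGroup (Fin N) ℝ)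
    (h : Mᵀ * M = 1) : (holPart M).det ≠ 0 := by
  have := congrArg Matrix.det (holPart_mul_inv (g := ⟨M, hM⟩) h)
  rw [Matrix.det_mul, Matrix.det_one] at this
  exact left_ne_zero_of_mul (by rw [this]; exact one_ne_zero)

/-- Because G is the centralizer of G', membership in G is a family of linear equations, so K̃ is
realised as a set cut out by equations. That ζ ≠ 0 is automatic from ζ² = det k. Closedness, and
with it compactness of K̃, can be read off. -/
theorem range_ktilde :
    Set.range (fun k : D.ktilde => ((k.1.1 : Mat N), (k.1.2 : ℂ)))
      = {p | p.1 * Matrix.J (Fin N) ℝ * p.1ᵀ = Matrix.J (Fin N) ℝ ∧ p.1ᵀ * p.1 = 1 ∧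
          (∀ h ∈ D.G', (h : Mat N) * p.1 = p.1 * h) ∧ p.2 ^ 2 = (holPart p.1).det} := by
  ext ⟨M, z⟩
  constructor
  · rintro ⟨k, hk⟩
    obtain ⟨rfl, rfl⟩ := Prod.mk.inj hk
    refine ⟨SymplecticGroup.mem_iff.1 k.1.1.2, k.2.1.1, fun h hh => ?_, k.2.1.2⟩
    have hG : k.1.1 ∈ Subgroup.centralizer (D.G' : Set (Sp N)) := by
      rw [D.centralizer_G']
      exact k.2.2
    exact congrArg Subtype.val (Subgroup.mem_centralizer_iff.1 hG h hh)
  · rintro ⟨h1, h2, h3, h4⟩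
    have hM := SymplecticGroup.mem_iff.2 h1
    have hz : z ≠ 0 := fun h0 => det_holPart_ne_zero hM h2 (by
      change z ^ 2 = (holPart M).det at h4
      rw [← h4, h0]; simp)
    have hG : (⟨M, hM⟩ : Sp N) ∈ D.G := by
      rw [← D.centralizer_G', Subgroup.mem_centralizer_iff]
      exact fun h hh => Subtype.ext (h3 h hh)
    exact ⟨⟨(⟨M, hM⟩, Units.mk0 z hz), ⟨⟨h2, h4⟩, hG⟩⟩, rfl⟩

instance : CompactSpace D.ktilde := by
  rw [← isCompact_univ_iff, (ktilde_embedding D).isInducing.isCompact_iff, Set.image_univ,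
    range_ktilde]
  have hdet : Continuous fun M : Mat N => (holPart M).det :=
    Continuous.matrix_det continuous_holPart
  obtain ⟨C, hC⟩ := (isCompact_orthogonal (N := N)).exists_bound_of_continuousOn hdet.continuousOn
  -- If |det| ≤ C on orthogonal matrices, then |ζ|² ≤ C, which gives |ζ| ≤ C + 1.
  refine ((isCompact_orthogonal (N := N)).prod
    (isCompact_closedBall (0 : ℂ) (C + 1))).of_isClosed_subset ?_ ?_
  · have hf : Continuous (fun p : Mat N × ℂ => p.1) := continuous_fst
    refine (isClosed_eq (by fun_prop) continuous_const).inter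
      ((isClosed_eq (by fun_prop) continuous_const).inter (IsClosed.inter ?_
        (isClosed_eq (by fun_prop) (hdet.comp hf))))
    have : {p : Mat N × ℂ | ∀ h ∈ D.G', (h : Mat N) * p.1 = p.1 * h}
        = ⋂ h ∈ D.G', {p : Mat N × ℂ | (h : Mat N) * p.1 = p.1 * h} := by
      ext p; simp
    change IsClosed {p : Mat N × ℂ | ∀ h ∈ D.G', (h : Mat N) * p.1 = p.1 * h}
    rw [this]
    exact isClosed_biInter fun h _ => isClosed_eq (by fun_prop) (by fun_prop)
  · rintro ⟨M, z⟩ ⟨-, h2, -, h4⟩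
    refine ⟨h2, ?_⟩
    have h5 := hC M h2
    change z ^ 2 = (holPart M).det at h4
    rw [← h4, norm_pow] at h5
    simp only [mem_closedBall_zero_iff]
    nlinarith [norm_nonneg z, sq_nonneg (‖z‖ - 1)]

theorem continuous_ktilde_val : Continuous fun k : D.ktilde => (k.1.1 : Mat N) :=
  continuous_subtype_val.comp (continuous_fst.comp continuous_subtype_val)

theorem continuous_ktilde_root : Continuous fun k : D.ktilde => ((k.1.2⁻¹ : ℂˣ) : ℂ) :=
  Units.continuous_val.comp
    ((continuous_snd.comp continuous_subtype_val).inv)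

/-! ### One-parameter subgroups -/

theorem exp_smul_add (X : Mat N) (s t : ℝ) :
    NormedSpace.exp ((s + t) • X) = NormedSpace.exp (s • X) * NormedSpace.exp (t • X) := by
  rw [add_smul, Matrix.exp_add_of_commute]
  exact ((Commute.refl X).smul_left s).smul_right t

theorem hasDerivAt_exp_linear {A : Type*} [NormedRing A] [NormedAlgebra ℝ A]
    [FiniteDimensional ℝ A] (x : A) (L : A →ₗ[ℝ] ℝ) :
    HasDerivAt (fun t : ℝ => L (NormedSpace.exp (t • x))) (L x) 0 := by
  have : CompleteSpace A := FiniteDimensional.complete ℝ A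
  have h0 : HasDerivAt (fun t : ℝ => NormedSpace.exp (t • x)) x 0 := by
    simpa using hasDerivAt_exp_smul_const (𝕂 := ℝ) x 0
  exact (LinearMap.toContinuousLinearMap L).hasFDerivAt.comp_hasDerivAt (0 : ℝ) h0

theorem hasDerivAt_exp_entry (X : Mat N) (i j : Fin N ⊕ Fin N) :
    HasDerivAt (fun t : ℝ => NormedSpace.exp (t • X) i j) (X i j) 0 := by
  let _ : NormedRing (Mat N) := Matrix.linftyOpNormedRing
  let _ : NormedAlgebra ℝ (Mat N) := Matrix.linftyOpNormedAlgebra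
  exact hasDerivAt_exp_linear X
    { toFun := fun M => M i j, map_add' := fun _ _ => rfl, map_smul' := fun _ _ => rfl }

theorem hasDerivAt_holPart_exp (X : Mat N) (i j : Fin N) :
    HasDerivAt (fun t : ℝ => holPart (NormedSpace.exp (t • X)) i j) (holPart X i j) 0 := by
  have e : ∀ Y : Mat N, holPart Y i j =
      (((Y (.inl i) (.inl j) + Y (.inr i) (.inr j)) / 2 : ℝ) : ℂ)
        + (((Y (.inr i) (.inl j) - Y (.inl i) (.inr j)) / 2 : ℝ) : ℂ) * Complex.I := by
    intro Y
    apply Complex.ext <;> simp [holPart]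
  simp only [e]
  have h := hasDerivAt_exp_entry X
  exact (((h _ _).add (h _ _)).div_const 2).ofReal_comp.add
    ((((h _ _).sub (h _ _)).div_const 2).ofReal_comp.mul_const Complex.I)

/-- The derivative of the determinant at the identity is the trace. -/
theorem hasDerivAt_det {n : Type*} [Fintype n] [DecidableEq n] {A : ℝ → Matrix n n ℂ}
    {A' : Matrix n n ℂ} (hA : ∀ i j, HasDerivAt (fun t => A t i j) (A' i j) 0) (h0 : A 0 = 1) :
    HasDerivAt (fun t => (A t).det) A'.trace 0 := by
  have h1 : HasDerivAt (fun t => ∑ σ : Equiv.Perm n, (Equiv.Perm.sign σ : ℂ) * ∏ i, A t (σ i) i)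
      (∑ σ : Equiv.Perm n, (Equiv.Perm.sign σ : ℂ) *
        ∑ i, (∏ j ∈ Finset.univ.erase i, A 0 (σ j) j) • A' (σ i) i) 0 :=
    HasDerivAt.fun_sum fun σ _ => (HasDerivAt.fun_finsetProd fun i _ => hA (σ i) i).const_mul _
  have h2 : (∑ σ : Equiv.Perm n, (Equiv.Perm.sign σ : ℂ) *
        ∑ i, (∏ j ∈ Finset.univ.erase i, A 0 (σ j) j) • A' (σ i) i) = A'.trace := by
    rw [Finset.sum_eq_single 1]
    · simp [h0, Matrix.trace]
    · intro σ _ hσ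
      refine mul_eq_zero_of_right _ (Finset.sum_eq_zero fun i _ => ?_)
      -- A nontrivial permutation moves at least two points, so after the factor i is removed an
      -- off-diagonal entry of A 0 = 1 remains in the product.
      obtain ⟨j, hj, hji⟩ : ∃ j, σ j ≠ j ∧ j ≠ i := by
        by_contra! hcon
        apply hσ
        ext j
        by_cases hj : σ j = j
        · simpa using hj
        · have := hcon j hj
          subst this
          by_contra
          have h3 := hcon (σ j) fun h => hj (σ.injective h)
          exact hj h3
      rw [Finset.prod_eq_zero (Finset.mem_erase.2 ⟨hji, Finset.mem_univ j⟩)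
        (by rw [h0, Matrix.one_apply_ne hj]), zero_smul]
    · simp
  rw [h2] at h1
  simpa only [Matrix.det_apply', zsmul_eq_mul] using h1

/-- A square root, continuous at `0`, of a function differentiable at `0`. -/
theorem hasDerivAt_of_sq {f g : ℝ → ℂ} {d : ℂ} (hg : ContinuousAt g 0) (hg0 : g 0 = 1)
    (hfg : ∀ t, g t ^ 2 = f t) (hf : HasDerivAt f d 0) : HasDerivAt g (d / 2) 0 := by
  rw [hasDerivAt_iff_tendsto_slope] at hf ⊢
  have h1 : Filter.Tendsto (fun t => g t + 1) (nhdsWithin 0 {0}ᶜ) (nhds 2) := by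
    have : Filter.Tendsto (fun t => g t + 1) (nhds 0) (nhds (g 0 + 1)) :=
      hg.tendsto.add tendsto_const_nhds
    rw [hg0, one_add_one_eq_two] at this
    exact this.mono_left nhdsWithin_le_nhds
  have h2 : ∀ᶠ t in nhdsWithin (0 : ℝ) {0}ᶜ, g t + 1 ≠ 0 := h1.eventually_ne two_ne_zero
  refine (hf.div h1 two_ne_zero).congr' ?_
  filter_upwards [h2] with t ht
  simp only [slope, vsub_eq_sub, sub_zero, Pi.div_apply, ← hfg, hg0, one_pow]
  -- The difference quotient of f is that of g times g t + 1, and this factor tends to 2.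
  rw [show g t ^ 2 - 1 = (g t - 1) * (g t + 1) by ring, ← smul_mul_assoc,
    mul_div_cancel_right₀ _ ht]

/-- A multiplicative function differentiable at `0` is an exponential function. -/
theorem eq_exp_of_mul {f : ℝ → ℂ} {d : ℂ} (h0 : f 0 = 1) (hmul : ∀ s t, f (s + t) = f s * f t)
    (hd : HasDerivAt f d 0) (t : ℝ) : f t = Complex.exp (t * d) := by
  have hf : ∀ s : ℝ, HasDerivAt f (f s * d) s := by
    intro s
    have h1 : HasDerivAt (fun t => f s * f (t - s)) (f s * d) s := by
      have h2 : HasDerivAt f d (s - s) := by rwa [sub_self]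
      have h3 := HasDerivAt.scomp (h := fun t : ℝ => t - s) s h2 ((hasDerivAt_id s).sub_const s)
      rw [one_smul] at h3
      exact h3.const_mul (f s)
    refine h1.congr_of_eventuallyEq (Filter.Eventually.of_forall fun t => ?_)
    change f t = f s * f (t - s)
    rw [← hmul, add_sub_cancel]
  have hg : ∀ s : ℝ, HasDerivAt (fun t : ℝ => Complex.exp (-(t * d))) (Complex.exp (-(s * d)) * -d)
      s := by
    intro s
    have h1 : HasDerivAt (fun t : ℝ => -((t : ℂ) * d)) (-d) s := by
      simpa using! ((hasDerivAt_id s).ofReal_comp.mul_const d).neg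
    exact h1.cexp
  -- The quotient of f by the exponential has derivative zero and equals 1 at 0.
  have hc : ∀ s : ℝ, HasDerivAt (fun t : ℝ => f t * Complex.exp (-(t * d))) 0 s := by
    intro s
    have h := (hf s).mul (hg s)
    rwa [show f s * d * Complex.exp (-(s * d)) + f s * (Complex.exp (-(s * d)) * -d) = 0 by ring]
      at h
  have := is_const_of_deriv_eq_zero (fun s => (hc s).differentiableAt) (fun s => (hc s).deriv) t 0
  simp only [h0, Complex.ofReal_zero, zero_mul, neg_zero, Complex.exp_zero, mul_one] at this
  rw [Complex.exp_neg] at this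
  field_simp at this
  exact this

/-- Skewness puts exp (tX) into U. Its complex determinant is multiplicative in t, hence equals
e^{td} with d the trace of the complex linear part of X, and e^{td/2} is a continuous multiplicative
choice of square root. Through this lift every element of 𝔨 acts as a derivative of the action of
K̃. -/
theorem exists_lift_exp {X : Mat N} (hX : X ∈ D.lieG) (hs : Xᵀ = -X) :
    ∃ γ : Multiplicative ℝ →* D.ktilde, Continuous γ ∧
      ∀ t : ℝ, ((γ (Multiplicative.ofAdd t)).1.1 : Mat N) = NormedSpace.exp (t • X) := by
  choose g hgG hg using hX
  have hU : ∀ t, g t ∈ maxU N := fun t => by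
    change (g t : Mat N)ᵀ * (g t : Mat N) = 1
    rw [hg, ← Matrix.exp_transpose, Matrix.transpose_smul, hs, smul_neg, ← neg_smul,
      ← exp_smul_add, neg_add_cancel, zero_smul, NormedSpace.exp_zero]
  have hmul : ∀ s t, g (s + t) = g s * g t := fun s t => Subtype.ext (by
    rw [hg, Submonoid.coe_mul, hg, hg, exp_smul_add])
  have h0 : g 0 = 1 := Subtype.ext (by
    rw [hg, zero_smul, NormedSpace.exp_zero, Submonoid.coe_one])
  set d := (holPart X).trace
  have hdet : ∀ t : ℝ, (holPart (g t : Mat N)).det = Complex.exp (t * d) := by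
    refine eq_exp_of_mul (f := fun t => (holPart (g t : Mat N)).det) ?_ ?_ ?_
    · simp only [h0, Submonoid.coe_one, holPart_one, Matrix.det_one]
    · intro s t
      simp only [hmul, Submonoid.coe_mul, holPart_mul_of_mem_maxU (hU s), Matrix.det_mul]
    · simp only [hg]
      refine hasDerivAt_det (hasDerivAt_holPart_exp X) ?_
      rw [zero_smul, NormedSpace.exp_zero, holPart_one]
  let z : ℝ → ℂˣ := fun t => Units.mk0 (Complex.exp (t * d / 2)) (Complex.exp_ne_zero _)
  have hz : ∀ t, (g t, z t) ∈ D.ktilde := fun t => ⟨⟨hU t, by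
    change Complex.exp (t * d / 2) ^ 2 = (holPart (g t : Mat N)).det
    rw [hdet, ← Complex.exp_nat_mul]
    congr 1
    push_cast
    ring⟩, hgG t⟩
  refine ⟨{ toFun := fun t => ⟨(g t.toAdd, z t.toAdd), hz _⟩, map_one' := ?_, map_mul' := ?_ },
    ?_, fun t => hg t⟩
  · refine Subtype.ext (Prod.ext h0 (Units.ext ?_))
    simp [z]
  · intro s t
    refine Subtype.ext (Prod.ext (hmul _ _) (Units.ext ?_))
    change Complex.exp (((s.toAdd + t.toAdd : ℝ) : ℂ) * d / 2)
      = Complex.exp (s.toAdd * d / 2) * Complex.exp (t.toAdd * d / 2)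
    rw [← Complex.exp_add]
    congr 1
    push_cast
    ring
  · rw [(ktilde_embedding D).continuous_iff]
    have hto : Continuous fun t : Multiplicative ℝ => t.toAdd := continuous_toAdd
    refine Continuous.prodMk ?_ ?_
    · have : Continuous fun t : ℝ => (g t : Mat N) := by
        simp only [hg]
        let _ : NormedRing (Mat N) := Matrix.linftyOpNormedRing
        let _ : NormedAlgebra ℝ (Mat N) := Matrix.linftyOpNormedAlgebra
        let _ : NormedAlgebra ℚ (Mat N) := NormedAlgebra.restrictScalars ℚ ℝ (Mat N)
        exact NormedSpace.exp_continuous.comp (continuous_id.smul continuous_const)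
      exact this.comp hto
    · have : Continuous fun t : ℝ => Complex.exp (t * d / 2) := by fun_prop
      exact this.comp hto

/-! ### The Cartan decomposition -/

/-- The Lie algebra of G is the commutant of G' in sp, so it is the stability of G' under the Cartan
involution that matters: with h also hᵀ lies in G', and transposing the commutation of X with hᵀ
gives that of Xᵀ with h. The splitting of the Lie algebra into symmetric and skew parts rests on
this. -/
theorem transpose_mem_lieG (hD : D.Adapted) {X : Mat N} (hX : X ∈ D.lieG) : Xᵀ ∈ D.lieG := by
  rw [D.mem_lieG_iff] at hX ⊢
  obtain ⟨h1, h2⟩ := hX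
  refine ⟨?_, fun h hh => ?_⟩
  · rw [mem_sp_iff] at h1 ⊢
    have h3 : Matrix.J (Fin N) ℝ * (Xᵀ * Matrix.J (Fin N) ℝ) * Matrix.J (Fin N) ℝ
      = Matrix.J (Fin N) ℝ * (Matrix.J (Fin N) ℝ * -X) * Matrix.J (Fin N) ℝ := by rw [h1]
    have hJ := Matrix.J_squared (Fin N) ℝ
    rw [← Matrix.mul_assoc, Matrix.mul_assoc _ _ (Matrix.J (Fin N) ℝ), hJ, ← Matrix.mul_assoc, hJ] at h3
    simp at h3
    rw [Matrix.transpose_transpose, Matrix.mul_neg, h3]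
  · have h3 : cartanInv h ∈ D.G' := hD.2 h hh
    have h4 : (⟨(h : Mat N)ᵀ, SymplecticGroup.transpose_mem h.2⟩ : Sp N) ∈ D.G' := by
      rw [← inv_inv (⟨(h : Mat N)ᵀ, SymplecticGroup.transpose_mem h.2⟩ : Sp N)]
      exact inv_mem h3
    have h5 := congrArg Matrix.transpose (h2 _ h4)
    simpa [Matrix.transpose_mul] using h5.symm

end Group

/-! ### Permanence properties of `(𝔤, K̃)`-modules -/

section Modules

variable {N : ℕ} {D : DualPair N}
variable {V W : Type*} [AddCommGroup V] [Module ℂ V] [AddCommGroup W] [Module ℂ W]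

/-- The axioms of a `(𝔤, K̃)`-module in terms of `finCont` and `finDeriv`. -/
structure GKAct.IsSmooth (a : GKAct D V) : Prop where
  lfc : IsLFC a.grp
  deriv : ∀ γ : Multiplicative ℝ →* D.ktilde, Continuous γ →
    ∀ X : D.lieG, (∀ t : ℝ, ((γ (Multiplicative.ofAdd t)).1.1 : Mat N)
      = NormedSpace.exp (t • (X : Mat N))) →
    ∀ v : V, ((fun t : ℝ => a.grp (γ (Multiplicative.ofAdd t)) v, a.lie X v) : (ℝ → V) × V)
      ∈ finDeriv V
  equivariant : ∀ (k : D.ktilde) (X : D.lieG) (v : V),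
    a.grp k (a.lie X v) = a.lie (D.Ad k X) (a.grp k v)

theorem GKAct.IsGKModule.isSmooth {a : GKAct D V} (h : a.IsGKModule) : a.IsSmooth where
  lfc v := mem_finCont_of_dual (h.locallyFinite v) (h.continuous v)
  deriv γ hγ X hX v := by
    have := h.locallyFinite v
    exact mem_finDeriv_of_separating (fun l : Module.Dual ℂ V => l)
      (Submodule.span ℂ (Set.range fun k : D.ktilde => a.grp k v))
      (fun v h => (Module.forall_dual_apply_eq_zero_iff ℂ v).1 h)
      (fun t => Submodule.subset_span ⟨_, rfl⟩) (h.differential γ hγ X hX v)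
  equivariant := h.equivariant

theorem GKAct.IsSmooth.isGKModule {a : GKAct D V} (h : a.IsSmooth) : a.IsGKModule where
  locallyFinite v := finiteDimensional_of_mem_finCont (h.lfc v)
  continuous v := h.lfc.continuous v
  differential γ hγ X hX v := hasDerivAt_of_mem_finDeriv (h.deriv γ hγ X hX v)
  equivariant := h.equivariant

theorem GKAct.IsSmooth.quot {a : GKAct D V} (h : a.IsSmooth) (S : Submodule ℂ V)
    (hl : ∀ X, ∀ v ∈ S, a.lie X v ∈ S) (hk : ∀ k, ∀ v ∈ S, a.grp k v ∈ S) :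
    (a.quot S hl hk).IsSmooth where
  lfc v := by
    induction v using Submodule.Quotient.induction_on with
    | H v => exact finCont_map S.mkQ (h.lfc v)
  deriv γ hγ X hX v := by
    induction v using Submodule.Quotient.induction_on with
    | H v => exact finDeriv_map S.mkQ (h.deriv γ hγ X hX v)
  equivariant k X v := by
    induction v using Submodule.Quotient.induction_on with
    | H v => exact congrArg S.mkQ (h.equivariant k X v)

theorem IsLFC.tensor {K : Type*} [Group K] [TopologicalSpace K] {ρ : K →* Module.End ℂ V}
    {σ : K →* Module.End ℂ W} {τ : K →* Module.End ℂ (V ⊗[ℂ] W)} (hρ : IsLFC ρ) (hσ : IsLFC σ)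
    (hτ : ∀ k v w, τ k (v ⊗ₜ[ℂ] w) = ρ k v ⊗ₜ[ℂ] σ k w) : IsLFC τ := by
  intro e
  induction e with
  | zero => simpa using const_mem_finCont (0 : V ⊗[ℂ] W)
  | add x y hx hy => simpa using! (finCont K (V ⊗[ℂ] W)).add_mem hx hy
  | tmul v w =>
    simpa [hτ] using finCont_bilin (TensorProduct.mk ℂ V W) (hρ v) (hσ w)

theorem GKAct.IsSmooth.tensor {a : GKAct D V} {b : GKAct D W} (ha : a.IsSmooth) (hb : b.IsSmooth) :
    (a.tensor b).IsSmooth where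
  lfc := ha.lfc.tensor hb.lfc fun _ _ _ => rfl
  deriv γ hγ X hX e := by
    induction e with
    | zero => simpa using const_mem_finDeriv (0 : V ⊗[ℂ] W)
    | add x y hx hy => simpa using! (finDeriv (V ⊗[ℂ] W)).add_mem hx hy
    | tmul v w =>
      have h := finDeriv_bilin (TensorProduct.mk ℂ V W) (ha.deriv γ hγ X hX v)
        (hb.deriv γ hγ X hX w)
      have h0 : γ (Multiplicative.ofAdd 0) = 1 := map_one γ
      simp only [h0, map_one] at h
      exact h
  equivariant k X e := by
    induction e with
    | zero => simp only [map_zero]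
    | add x y hx hy => simp only [map_add, hx, hy]
    | tmul v w =>
      change TensorProduct.map (a.grp k) (b.grp k) ((a.lie X v) ⊗ₜ[ℂ] w + v ⊗ₜ[ℂ] (b.lie X w))
        = (a.lie (D.Ad k X) (a.grp k v)) ⊗ₜ[ℂ] (b.grp k w)
          + (a.grp k v) ⊗ₜ[ℂ] (b.lie (D.Ad k X) (b.grp k w))
      rw [map_add, TensorProduct.map_tmul, TensorProduct.map_tmul, ha.equivariant, hb.equivariant]

theorem GKAct.IsSmooth.onRight {b : GKAct D W} (hb : b.IsSmooth) :
    (GKAct.onRight V b).IsSmooth where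
  lfc e := by
    induction e with
    | zero => simpa using const_mem_finCont (0 : V ⊗[ℂ] W)
    | add x y hx hy => simpa using! (finCont D.ktilde (V ⊗[ℂ] W)).add_mem hx hy
    | tmul v w => exact finCont_map (TensorProduct.mk ℂ V W v) (hb.lfc w)
  deriv γ hγ X hX e := by
    induction e with
    | zero => simpa using const_mem_finDeriv (0 : V ⊗[ℂ] W)
    | add x y hx hy => simpa using! (finDeriv (V ⊗[ℂ] W)).add_mem hx hy
    | tmul v w => exact finDeriv_map (TensorProduct.mk ℂ V W v) (hb.deriv γ hγ X hX w)
  equivariant k X e := by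
    induction e with
    | zero => simp only [map_zero]
    | add x y hx hy => simp only [map_add, hx, hy]
    | tmul v w => exact congrArg (TensorProduct.mk ℂ V W v) (hb.equivariant k X w)

theorem GKAct.contragredient_grp_apply (a : GKAct D V) (ha : a.IsGKModule) (k : D.ktilde)
    (l : a.DualSpace) (v : V) :
    ((a.contragredient ha).grp k l).1 v = l.1 (a.grp k⁻¹ v) := rfl

theorem GKAct.contragredient_lie_apply (a : GKAct D V) (ha : a.IsGKModule) (X : D.lieG)
    (l : a.DualSpace) (v : V) :
    ((a.contragredient ha).lie X l).1 v = -l.1 (a.lie X v) := rfl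

/-- Evaluation of a `K̃`-finite functional at a vector. -/
def GKAct.evalDual (a : GKAct D V) : V →ₗ[ℂ] Module.Dual ℂ a.DualSpace :=
  LinearMap.flip (a.finDual.subtype)

theorem GKAct.evalDual_apply (a : GKAct D V) (v : V) (l : a.DualSpace) :
    a.evalDual v l = l.1 v := rfl

theorem GKAct.evalDual_separates (a : GKAct D V) (l : a.DualSpace)
    (h : ∀ v, a.evalDual v l = 0) : l = 0 :=
  Subtype.ext (LinearMap.ext h)

theorem GKAct.finiteDimensional_span_contragredient (a : GKAct D V) (ha : a.IsGKModule)
    (l : a.DualSpace) : FiniteDimensional ℂ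
      (Submodule.span ℂ (Set.range fun k => (a.contragredient ha).grp k l)) := by
  have hl : FiniteDimensional ℂ
    (Submodule.span ℂ (Set.range fun k : D.ktilde => a.dualGrp k l.1)) := l.2
  let ι : a.DualSpace →ₗ[ℂ] Module.Dual ℂ V := a.finDual.subtype
  have hι : Function.Injective ι := Subtype.val_injective
  have e : (Submodule.span ℂ (Set.range fun k => (a.contragredient ha).grp k l)).map ι
      = Submodule.span ℂ (Set.range fun k : D.ktilde => a.dualGrp k l.1) := by
    rw [Submodule.map_span, ← Set.range_comp]
    rfl
  rw [← e] at hl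
  exact Module.Finite.equiv (Submodule.equivMapOfInjective ι hι _).symm

/-- Evaluations at the vectors of V separate functionals, so continuity and derivatives are tested
on them. Since k acts through k⁻¹, the chain rule for t ↦ -t produces the sign in the dual action of
the Lie algebra. -/
theorem GKAct.contragredient_isSmooth (a : GKAct D V) (ha : a.IsGKModule) :
    (a.contragredient ha).IsSmooth where
  lfc l := by
    have := a.finiteDimensional_span_contragredient ha l
    exact mem_finCont_of_separating a.evalDual
      (Submodule.span ℂ (Set.range fun k => (a.contragredient ha).grp k l))
      (fun l _ => a.evalDual_separates l) (fun k => Submodule.subset_span ⟨k, rfl⟩)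
      (fun v => (ha.continuous v l.1).comp continuous_inv)
  deriv γ hγ X hX l := by
    have := a.finiteDimensional_span_contragredient ha l
    refine mem_finDeriv_of_separating a.evalDual
      (Submodule.span ℂ (Set.range fun k => (a.contragredient ha).grp k l))
      a.evalDual_separates (fun k => Submodule.subset_span ⟨_, rfl⟩) (fun v => ?_)
    have h1 := ha.differential γ hγ X hX v l.1
    have h2 : HasDerivAt (fun t : ℝ => l.1 (a.grp (γ (Multiplicative.ofAdd t)) v))
      (l.1 (a.lie X v)) (-0) := by rwa [neg_zero]
    have h3 := HasDerivAt.scomp (h := fun t : ℝ => -t) 0 h2 (hasDerivAt_id 0).neg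
    rw [neg_one_smul] at h3
    refine h3.congr_of_eventuallyEq (Filter.Eventually.of_forall fun t => ?_)
    change l.1 (a.grp (γ (Multiplicative.ofAdd t))⁻¹ v)
      = l.1 (a.grp (γ (Multiplicative.ofAdd (-t))) v)
    rw [ofAdd_neg, map_inv γ]
  equivariant k X l := by
    refine Subtype.ext (LinearMap.ext fun v => ?_)
    have h1 := ha.equivariant k⁻¹ (D.Ad k X) v
    have h2 : D.Ad k⁻¹ (D.Ad k X) = X := by
      have := D.Ad_inv_Ad k⁻¹ X
      rwa [inv_inv] at this
    rw [h2] at h1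
    change -(l.1 (a.lie X (a.grp k⁻¹ v))) = -(l.1 (a.grp k⁻¹ (a.lie (D.Ad k X) v)))
    rw [h1]

/-! ### The Fock model is a `(𝔤, K̃)`-module -/

theorem finCont_substW {X : Type*} [TopologicalSpace X] {A : X → Matrix (Fin N) (Fin N) ℂ}
    (hA : Continuous A) (f : Fock N) : (fun x => substW (A x) f) ∈ finCont X (Fock N) := by
  induction f using MvPolynomial.induction_on with
  | C c => simpa [substW] using const_mem_finCont (MvPolynomial.C c : Fock N)
  | add p q hp hq => simpa using! (finCont X (Fock N)).add_mem hp hq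
  | mul_X p i hp =>
    have hX : (fun x => substW (A x) (MvPolynomial.X i)) ∈ finCont X (Fock N) := by
      simp only [substW, MvPolynomial.aeval_X]
      exact sum_mem_finCont _ fun j _ =>
        smul_mem_finCont (hA.matrix_elem i j) (MvPolynomial.X j : Fock N)
    simpa using finCont_bilin (LinearMap.mul ℂ (Fock N)) hp hX

/-- Both the derivative of the substitution at A 0 = 1 and the first order operator obey the Leibniz
rule, so only the variables have to be checked. -/
theorem finDeriv_substW {A : ℝ → Matrix (Fin N) (Fin N) ℂ} {A' : Matrix (Fin N) (Fin N) ℂ}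
    (hA : ∀ i j, HasDerivAt (fun t => A t i j) (A' i j) 0) (h0 : A 0 = 1) (f : Fock N) :
    ((fun t => substW (A t) f, opE mulW diffW A' f) : (ℝ → Fock N) × Fock N)
      ∈ finDeriv (Fock N) := by
  have hE : ∀ f : Fock N, (opE mulW diffW A' : Module.End ℂ (Fock N)) f
      = ∑ i, ∑ j, A' i j • (MvPolynomial.X j * diffW i f) := fun f => by
    simp [opE, mulW]
  induction f using MvPolynomial.induction_on with
  | C c =>
    have : (opE mulW diffW A' : Module.End ℂ (Fock N)) (MvPolynomial.C c) = 0 := by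
      simp [hE, diffW]
    rw [this]
    simpa [substW] using const_mem_finDeriv (MvPolynomial.C c : Fock N)
  | add p q hp hq => simpa using! (finDeriv (Fock N)).add_mem hp hq
  | mul_X p i hp =>
    have hX : ((fun t => substW (A t) (MvPolynomial.X i),
        ∑ j, A' i j • (MvPolynomial.X j : Fock N)) : (ℝ → Fock N) × Fock N)
          ∈ finDeriv (Fock N) := by
      simp only [substW, MvPolynomial.aeval_X]
      exact sum_mem_finDeriv _ fun j _ => smul_mem_finDeriv (hA i j) (MvPolynomial.X j : Fock N)
    have h := finDeriv_bilin (LinearMap.mul ℂ (Fock N)) hp hX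
    simp only [h0, substW_one, LinearMap.mul_apply', AlgHom.id_apply] at h
    convert h using 2
    · funext t
      simp
    · have hd : ∀ j : Fin N, diffW j (p * MvPolynomial.X i)
          = diffW j p * MvPolynomial.X i + p * (if i = j then 1 else 0) := by
        intro j
        classical
        simp [diffW, MvPolynomial.pderiv_X, Pi.single_apply, add_comm, mul_comm]
      simp only [hE, hd, mul_add, smul_add, Finset.sum_add_distrib, Finset.sum_mul,
        Finset.mul_sum]
      congr 1
      · refine Finset.sum_congr rfl fun a _ => Finset.sum_congr rfl fun b _ => ?_
        rw [smul_mul_assoc, mul_assoc]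
      · rw [Finset.sum_eq_single i]
        · refine Finset.sum_congr rfl fun b _ => ?_
          rw [if_pos rfl, mul_one, mul_smul_comm, mul_comm]
        · intro b _ hb
          simp [Ne.symm hb]
        · simp

/-- The group acts by a substitution times ζ⁻¹. Differentiating the substitution gives the first
order term of `fockOp`, and differentiating the square root ζ⁻¹ of det k⁻¹ gives the term -½ tr α.
The quadratic terms are absent because elements of 𝔨 act complex linearly on W. -/
theorem fock_isSmooth (D : DualPair N) : D.fock.IsSmooth where
  lfc f := by
    have h1 : Continuous fun k : D.ktilde => holPart ((k.1.1⁻¹ : Sp N) : Mat N) :=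
      continuous_holPart.comp ((continuous_ktilde_val D).comp continuous_inv)
    have h2 := finCont_substW h1 f
    have h3 := continuous_iff_mem_finCont.2 (continuous_ktilde_root D)
    exact finCont_bilin (LinearMap.lsmul ℂ (Fock N)) h3 h2
  deriv γ hγ X hX f := by
    -- A one-parameter group of orthogonal matrices has a skew generator; lying also in sp, it has
    -- no conjugate linear part.
    have hskew : (X : Mat N)ᵀ = -(X : Mat N) := by
      have := DualPair.skew_of_exp_mat (x := (X : Mat N)) (y := (X : Mat N)ᵀ) (j := 1) fun t => by
        rw [← Matrix.transpose_smul, Matrix.exp_transpose, ← hX t, Matrix.mul_one]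
        exact (γ (Multiplicative.ofAdd t)).2.1.1
      simpa using this
    have hanti : antiPart (X : Mat N) = 0 := by
      have hb := sp_blocks (D.lieG_le X.2)
      have hs : ∀ i j, (X : Mat N) i j = -(X : Mat N) j i := fun i j => by
        have := congrFun (congrFun hskew j) i
        simpa using this
      ext i j
      apply Complex.ext <;> simp [antiPart]
      · linarith [(hb i j).1, hs (.inr i) (.inr j)]
      · linarith [(hb i j).2.1, hs (.inr i) (.inl j)]
    have hinv : ∀ t : ℝ, (((γ (Multiplicative.ofAdd t)).1.1⁻¹ : Sp N) : Mat N)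
        = NormedSpace.exp (t • -(X : Mat N)) := fun t => by
      have h := hX (-t)
      rw [ofAdd_neg, map_inv] at h
      rw [smul_neg, ← neg_smul, ← h]
      rfl
    have hdet : HasDerivAt (fun t : ℝ => (holPart (NormedSpace.exp (t • -(X : Mat N)))).det)
        (holPart (-(X : Mat N))).trace 0 :=
      hasDerivAt_det (hasDerivAt_holPart_exp _) (by
        rw [zero_smul, NormedSpace.exp_zero, holPart_one])
    have hneg : holPart (-(X : Mat N)) = -holPart (X : Mat N) := by
      simpa using holPart_linear (-1) 0 (X : Mat N) X
    have hroot : HasDerivAt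
        (fun t : ℝ => (((γ (Multiplicative.ofAdd t)).1.2⁻¹ : ℂˣ) : ℂ))
        ((holPart (-(X : Mat N))).trace / 2) 0 := by
      refine hasDerivAt_of_sq (Continuous.continuousAt ?_) ?_ (fun t => ?_) hdet
      · exact (continuous_ktilde_root D).comp (hγ.comp continuous_ofAdd)
      · simp
      · rw [← hinv]
        exact ((γ (Multiplicative.ofAdd t))⁻¹).2.1.2
    have h1 := finDeriv_substW (hasDerivAt_holPart_exp (-(X : Mat N)))
      (by rw [zero_smul, NormedSpace.exp_zero, holPart_one]) f
    have h2 := finDeriv_bilin (LinearMap.lsmul ℂ (Fock N)) (hasDerivAt_iff_mem_finDeriv.2 hroot) h1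
    convert h2 using 2
    · funext t
      change (((γ (Multiplicative.ofAdd t)).1.2⁻¹ : ℂˣ) : ℂ) • substW
        (holPart (((γ (Multiplicative.ofAdd t)).1.1⁻¹ : Sp N) : Mat N)) f = _
      rw [hinv]
      rfl
    · have e1 : opE mulW diffW (-holPart (X : Mat N))
          = -(opE mulW diffW (holPart (X : Mat N)) : Module.End ℂ (Fock N)) := by
        simpa using opE_linear (w := mulW) (d := diffW) (-1) 0 (holPart (X : Mat N)) 0
      rw [D.fock_lie_apply, fockOp, weylOp, hanti, hneg, e1]
      simp [opQ, conjM, holPart_one, substW_one, NormedSpace.exp_zero]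
      module
  equivariant := D.fock_equivariant

end Modules

/-! ### Coinvariants and invariants of coinvariants -/

section Coinvariants

variable {N : ℕ} {D : DualPair N}
variable {V W U : Type*} [AddCommGroup V] [Module ℂ V] [AddCommGroup W] [Module ℂ W]
  [AddCommGroup U] [Module ℂ U]

theorem GKIso.symm {a : GKAct D V} {b : GKAct D W} (h : GKIso a b) : GKIso b a := by
  obtain ⟨e, h1, h2⟩ := h
  refine ⟨e.symm, fun X v => ?_, fun k v => ?_⟩
  · rw [LinearEquiv.coe_coe, LinearEquiv.symm_apply_eq]
    simpa using (h1 X (e.symm v)).symm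
  · rw [LinearEquiv.coe_coe, LinearEquiv.symm_apply_eq]
    simpa using (h2 k (e.symm v)).symm

theorem GKIso.trans {a : GKAct D V} {b : GKAct D W} {c : GKAct D U} (h : GKIso a b)
    (h' : GKIso b c) : GKIso a c := by
  obtain ⟨e, h1, h2⟩ := h
  obtain ⟨f, h3, h4⟩ := h'
  refine ⟨e.trans f, fun X v => ?_, fun k v => ?_⟩
  · exact (congrArg f (h1 X v)).trans (h3 X (e v))
  · exact (congrArg f (h2 k v)).trans (h4 k (e v))

/-- An element of `𝔨` kills the coinvariants of `K̃`. -/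
theorem GKAct.IsSmooth.apply_lie_eq_zero {a : GKAct D V} (ha : a.IsSmooth) {X : D.lieG}
    (hX : (X : Mat N)ᵀ = -(X : Mat N)) (l : Module.Dual ℂ V)
    (v : V) (hl : ∀ k, l (a.grp k v) = l v) : l (a.lie X v) = 0 := by
  obtain ⟨γ, hγ, hγX⟩ := exists_lift_exp D X.2 hX
  have h := hasDerivAt_of_mem_finDeriv (ha.deriv γ hγ X hγX v) l
  simp only [hl] at h
  exact h.unique (hasDerivAt_const _ _)

/-- `K̃`-stable subspaces are stable under `𝔨`. -/
theorem GKAct.IsSmooth.lie_mem {a : GKAct D V} (ha : a.IsSmooth) {X : D.lieG}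
    (hX : (X : Mat N)ᵀ = -(X : Mat N)) {S : Submodule ℂ V} (hS : ∀ k, ∀ v ∈ S, a.grp k v ∈ S)
    {v : V} (hv : v ∈ S) : a.lie X v ∈ S := by
  refine mem_of_dual fun l hl => ha.apply_lie_eq_zero hX l v fun k => ?_
  rw [hl _ (hS k v hv), hl _ hv]

/-- The `𝔭`-component of an element of the Lie algebra. -/
def lieP (hT : ∀ X ∈ D.lieG, Xᵀ ∈ D.lieG) (X : D.lieG) : D.lieG :=
  (1 / 2 : ℝ) • (X + ⟨(X : Mat N)ᵀ, hT X X.2⟩)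

/-- The `𝔨`-component of an element of the Lie algebra. -/
def lieK (hT : ∀ X ∈ D.lieG, Xᵀ ∈ D.lieG) (X : D.lieG) : D.lieG :=
  (1 / 2 : ℝ) • (X - ⟨(X : Mat N)ᵀ, hT X X.2⟩)

theorem isP_lieP (hT : ∀ X ∈ D.lieG, Xᵀ ∈ D.lieG) (X : D.lieG) : D.IsP (lieP hT X) := by
  change ((1 / 2 : ℝ) • ((X : Mat N) + (X : Mat N)ᵀ))ᵀ = (1 / 2 : ℝ) • ((X : Mat N) + (X : Mat N)ᵀ)
  rw [Matrix.transpose_smul, Matrix.transpose_add, Matrix.transpose_transpose, add_comm]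

theorem transpose_lieK (hT : ∀ X ∈ D.lieG, Xᵀ ∈ D.lieG) (X : D.lieG) :
    (lieK hT X : Mat N)ᵀ = -(lieK hT X : Mat N) := by
  change ((1 / 2 : ℝ) • ((X : Mat N) - (X : Mat N)ᵀ))ᵀ
    = -((1 / 2 : ℝ) • ((X : Mat N) - (X : Mat N)ᵀ))
  rw [Matrix.transpose_smul, Matrix.transpose_sub, Matrix.transpose_transpose, ← smul_neg, neg_sub]

theorem lieP_add_lieK (hT : ∀ X ∈ D.lieG, Xᵀ ∈ D.lieG) (X : D.lieG) :
    lieP hT X + lieK hT X = X := by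
  rw [lieP, lieK]
  module

variable {a : GKAct D V}

theorem GKAct.pSpan_le_gkSpan : a.pSpan ≤ a.gkSpan := by
  rw [GKAct.pSpan, Submodule.span_le]
  rintro _ ⟨X, v, -, rfl⟩
  exact Submodule.subset_span (Or.inl ⟨X, v, rfl⟩)

/-- The action of `K̃` on `V_𝔭`. -/
def GKAct.pRep (a : GKAct D V) (heq : ∀ (k : D.ktilde) (X : D.lieG) (v : V),
    a.grp k (a.lie X v) = a.lie (D.Ad k X) (a.grp k v)) :
    D.ktilde →* Module.End ℂ (V ⧸ a.pSpan) where
  toFun := a.grpP heq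
  map_one' := by
    refine Submodule.linearMap_qext _ (LinearMap.ext fun v => ?_)
    simp [GKAct.grpP]
  map_mul' k k' := by
    refine Submodule.linearMap_qext _ (LinearMap.ext fun v => ?_)
    simp [GKAct.grpP]

theorem GKAct.IsSmooth.pRep_isLFC (ha : a.IsSmooth) : IsLFC (a.pRep ha.equivariant) := by
  intro v
  induction v using Submodule.Quotient.induction_on with
  | H v => exact finCont_map a.pSpan.mkQ (ha.lfc v)

/-- Modulo `pSpan` an element X acts through its 𝔨-component. Any functional composed with the
averaging is K̃-invariant, so its derivative along 𝔨 vanishes. The vectors kv - v die by invariance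
of the mean. -/
theorem GKAct.IsSmooth.average_eq_zero (ha : a.IsSmooth) (hT : ∀ X ∈ D.lieG, Xᵀ ∈ D.lieG) {v : V}
    (hv : v ∈ a.gkSpan) : average _ ha.pRep_isLFC (a.pSpan.mkQ v) = 0 := by
  suffices h : a.gkSpan ≤ LinearMap.ker ((average _ ha.pRep_isLFC).comp a.pSpan.mkQ) from h hv
  conv_lhs => rw [GKAct.gkSpan]
  rw [Submodule.span_le]
  rintro _ (⟨X, v, rfl⟩ | ⟨k, v, rfl⟩)
  · change average _ ha.pRep_isLFC (a.pSpan.mkQ (a.lie X v)) = 0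
    have h1 : a.pSpan.mkQ (a.lie (lieP hT X) v) = 0 :=
      (Submodule.Quotient.mk_eq_zero _).2 (Submodule.subset_span ⟨_, v, isP_lieP hT X, rfl⟩)
    have h2 : a.lie X v = a.lie (lieP hT X) v + a.lie (lieK hT X) v := by
      conv_lhs => rw [← lieP_add_lieK hT X]
      rw [map_add]
      rfl
    rw [h2, map_add, h1, zero_add]
    refine (Module.forall_dual_apply_eq_zero_iff ℂ _).1 fun l => ?_
    refine ha.apply_lie_eq_zero (transpose_lieK hT X)
      ((l.comp (average _ ha.pRep_isLFC)).comp a.pSpan.mkQ) v fun k => ?_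
    change l (average _ ha.pRep_isLFC (a.pRep ha.equivariant k (a.pSpan.mkQ v))) = _
    rw [average_apply]
    rfl
  · change average _ ha.pRep_isLFC (a.pSpan.mkQ (a.grp k v - v)) = 0
    rw [map_sub, map_sub, sub_eq_zero]
    exact average_apply ha.pRep_isLFC k (a.pSpan.mkQ v)

/-- The natural map `(V_𝔭)^{K̃} → V_{𝔤, K̃}`. -/
def GKAct.invariantsToCoinvariants (a : GKAct D V)
    (heq : ∀ (k : D.ktilde) (X : D.lieG) (v : V),
      a.grp k (a.lie X v) = a.lie (D.Ad k X) (a.grp k v)) :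
    a.pCoinvInvariants heq →ₗ[ℂ] V ⧸ a.gkSpan :=
  (Submodule.factor a.pSpan_le_gkSpan).comp (a.pCoinvInvariants heq).subtype

/-- An invariant class equals its own average, and averages of classes from `gkSpan` vanish; this is
injectivity. For surjectivity, the average of a class is invariant and differs from the class by
combinations of kv - v, which vanish in the coinvariants. -/
theorem GKAct.IsSmooth.invariantsToCoinvariants_bijective (ha : a.IsSmooth)
    (hT : ∀ X ∈ D.lieG, Xᵀ ∈ D.lieG) :
    Function.Bijective (a.invariantsToCoinvariants ha.equivariant) := by
  constructor
  · rw [← LinearMap.ker_eq_bot, LinearMap.ker_eq_bot']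
    rintro ⟨u, hu⟩ h0
    obtain ⟨v, rfl⟩ := Submodule.mkQ_surjective _ u
    have hv : v ∈ a.gkSpan := (Submodule.Quotient.mk_eq_zero _).1 h0
    refine Subtype.ext ?_
    change a.pSpan.mkQ v = 0
    rw [← ha.average_eq_zero hT hv]
    exact (average_of_invariant ha.pRep_isLFC hu).symm
  · intro c
    obtain ⟨v, rfl⟩ := Submodule.mkQ_surjective _ c
    refine ⟨⟨average _ ha.pRep_isLFC (a.pSpan.mkQ v), fun k => apply_average ha.pRep_isLFC k _⟩, ?_⟩
    have h1 := average_sub_mem ha.pRep_isLFC (a.pSpan.mkQ v)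
    have h2 : Submodule.span ℂ (Set.range fun k =>
        a.pRep ha.equivariant k (a.pSpan.mkQ v) - a.pSpan.mkQ v)
          ≤ LinearMap.ker (Submodule.factor a.pSpan_le_gkSpan) := by
      rw [Submodule.span_le]
      rintro _ ⟨k, rfl⟩
      change Submodule.factor a.pSpan_le_gkSpan (a.pSpan.mkQ (a.grp k v) - a.pSpan.mkQ v) = 0
      rw [← map_sub]
      exact (Submodule.Quotient.mk_eq_zero _).2 (Submodule.subset_span (Or.inr ⟨k, v, rfl⟩))
    have h3 := h2 h1
    rw [LinearMap.mem_ker, map_sub, sub_eq_zero] at h3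
    exact h3

end Coinvariants

/-! ### The two descriptions of the coinvariants for a dual pair. -/

section DualPairs

variable {N : ℕ} (D : DualPair N) {V' : Type*} [AddCommGroup V'] [Module ℂ V']
  (ρ' : GKAct D.swap V') (h : ρ'.IsGKModule)

theorem swap_adapted (hD : D.Adapted) : D.swap.Adapted := ⟨hD.2, hD.1⟩

theorem bigE'_isSmooth : (D.bigE' ρ' h).IsSmooth :=
  (ρ'.contragredient_isSmooth h).tensor (fock_isSmooth D.swap)

theorem coinvariants_isGKModule : (D.coinvariants ρ' h).IsGKModule :=
  GKAct.IsSmooth.isGKModule ((fock_isSmooth D).onRight.quot _ _ _)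

theorem gkIso_coinvariants_pCoinvariantsInvariants (hD : D.Adapted) :
    GKIso (D.coinvariants ρ' h) (D.pCoinvariantsInvariants ρ' h) := by
  have hb := (bigE'_isSmooth D ρ' h).invariantsToCoinvariants_bijective
    fun X hX => transpose_mem_lieG D.swap (swap_adapted D hD) hX
  refine GKIso.symm ⟨LinearEquiv.ofBijective _ hb, fun X u => ?_, fun k u => ?_⟩
  · obtain ⟨u, hu⟩ := u
    obtain ⟨v, rfl⟩ := Submodule.mkQ_surjective _ u
    rfl
  · obtain ⟨u, hu⟩ := u
    obtain ⟨v, rfl⟩ := Submodule.mkQ_surjective _ u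
    rfl

end DualPairs

/-! ### Filtrations generated by almost commuting operators -/

section Homogeneous

variable {ι : Type*}

/-- Every monomial of degree n + 1 is a variable times a monomial of degree n. The predicate carries
the degree because the intended predicates place a value in a filtration step that grows with the
degree. -/
theorem homogeneous_induction {P : ℕ → MvPolynomial ι ℂ → Prop} (one : P 0 1)
    (zero : ∀ n, P n 0) (hadd : ∀ n p q, P n p → P n q → P n (p + q))
    (smul : ∀ n (c : ℂ) p, P n p → P n (c • p))
    (X_mul : ∀ n i q, q ∈ MvPolynomial.homogeneousSubmodule ι ℂ n → P n q →
      P (n + 1) (MvPolynomial.X i * q))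
    (n : ℕ) (q : MvPolynomial ι ℂ) (hq : q ∈ MvPolynomial.homogeneousSubmodule ι ℂ n) :
    P n q := by
  classical
  have mono : ∀ (n : ℕ) (s : ι →₀ ℕ), s.degree = n → P n (MvPolynomial.monomial s 1) := by
    intro n
    induction n with
    | zero =>
      intro s hs
      rw [Finsupp.degree_eq_zero_iff] at hs
      rw [hs]
      exact one
    | succ n ih =>
      intro s hs
      obtain ⟨i, hi⟩ : ∃ i, s i ≠ 0 := by
        by_contra! hcon
        have : s = 0 := Finsupp.ext hcon
        simp [this] at hs
      have he : s = Finsupp.single i 1 + (s - Finsupp.single i 1) := by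
        rw [add_tsub_cancel_of_le]
        rw [Finsupp.single_le_iff]
        omega
      have hd : (s - Finsupp.single i 1).degree = n := by
        have := congrArg Finsupp.degree he
        rw [map_add, hs, Finsupp.degree_single] at this
        omega
      have hm : (MvPolynomial.monomial s (1 : ℂ))
          = MvPolynomial.X i * MvPolynomial.monomial (s - Finsupp.single i 1) 1 := by
        conv_lhs => rw [he]
        rw [MvPolynomial.X, MvPolynomial.monomial_mul, one_mul]
      rw [hm]
      refine X_mul n i _ ?_ (ih _ hd)
      rw [MvPolynomial.mem_homogeneousSubmodule]
      exact MvPolynomial.isHomogeneous_monomial _ hd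
  rw [MvPolynomial.as_sum q]
  refine Finset.sum_induction _ (P n) (hadd n) (zero n) fun s hs => ?_
  have hd : s.degree = n := by
    have := hq (MvPolynomial.mem_support_iff.1 hs)
    rwa [Finsupp.degree_eq_weight_one]
  have : MvPolynomial.monomial s (MvPolynomial.coeff s q)
      = MvPolynomial.coeff s q • MvPolynomial.monomial s (1 : ℂ) := by
    rw [MvPolynomial.smul_monomial, smul_eq_mul, mul_one]
  rw [this]
  exact smul n _ _ (mono n s hd)

theorem homogeneousComponent_homogeneous_mul {c q : MvPolynomial ι ℂ} {m : ℕ}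
    (hc : c ∈ MvPolynomial.homogeneousSubmodule ι ℂ m) (n : ℕ) :
    MvPolynomial.homogeneousComponent (n + m) (c * q)
      = c * MvPolynomial.homogeneousComponent n q := by
  conv_lhs => rw [← MvPolynomial.sum_homogeneousComponent q]
  rw [Finset.mul_sum, map_sum]
  have h : ∀ i, MvPolynomial.homogeneousComponent (n + m)
      (c * MvPolynomial.homogeneousComponent i q)
        = if i = n then c * MvPolynomial.homogeneousComponent i q else 0 := by
    intro i
    have hm : c * MvPolynomial.homogeneousComponent i q
        ∈ MvPolynomial.homogeneousSubmodule ι ℂ (m + i) :=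
      MvPolynomial.IsHomogeneous.mul hc (MvPolynomial.homogeneousComponent_isHomogeneous i q)
    rw [MvPolynomial.homogeneousComponent_of_mem hm]
    by_cases hi : i = n
    · rw [if_pos (by omega), if_pos hi]
    · rw [if_neg (by omega), if_neg hi]
  rw [Finset.sum_congr rfl fun i _ => h i, Finset.sum_ite_eq']
  split_ifs with hn
  · rfl
  · rw [MvPolynomial.homogeneousComponent_eq_zero _ _ (by simpa using hn), mul_zero]

theorem homogeneousComponent_mul_of_lt {c q : MvPolynomial ι ℂ} {m n : ℕ}
    (hc : c ∈ MvPolynomial.homogeneousSubmodule ι ℂ m) (hn : n < m) :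
    MvPolynomial.homogeneousComponent n (c * q) = 0 := by
  conv_lhs => rw [← MvPolynomial.sum_homogeneousComponent q]
  rw [Finset.mul_sum, map_sum]
  refine Finset.sum_eq_zero fun i _ => ?_
  have hm : c * MvPolynomial.homogeneousComponent i q
      ∈ MvPolynomial.homogeneousSubmodule ι ℂ (m + i) :=
    MvPolynomial.IsHomogeneous.mul hc (MvPolynomial.homogeneousComponent_isHomogeneous i q)
  rw [MvPolynomial.homogeneousComponent_of_mem hm, if_neg (by omega)]

end Homogeneous

/-! ### The word filtration and leading symbols. -/

section Filtration

variable {ι : Type*} {U : Type*} [AddCommGroup U] [Module ℂ U]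

/-- The filtration `F_{n+1} = H + ∑ x_i F_n`, `F_0 = 0`. -/
def wordFilt (x : ι → Module.End ℂ U) (H : Submodule ℂ U) : ℕ → Submodule ℂ U
  | 0 => ⊥
  | n + 1 => H ⊔ ⨆ i, (wordFilt x H n).map (x i)

variable {x : ι → Module.End ℂ U} {H : Submodule ℂ U}

theorem le_wordFilt_succ (n : ℕ) : H ≤ wordFilt x H (n + 1) := le_sup_left

theorem apply_mem_wordFilt {n : ℕ} {u : U} (hu : u ∈ wordFilt x H n) (i : ι) :
    x i u ∈ wordFilt x H (n + 1) :=
  Submodule.mem_sup_right (Submodule.mem_iSup_of_mem i (Submodule.mem_map_of_mem hu))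

theorem wordFilt_succ_le {n : ℕ} {S : Submodule ℂ U} (hH : H ≤ S)
    (hx : ∀ i, ∀ u ∈ wordFilt x H n, x i u ∈ S) : wordFilt x H (n + 1) ≤ S := by
  refine sup_le hH (iSup_le fun i => ?_)
  rintro _ ⟨u, hu, rfl⟩
  exact hx i u hu

theorem wordFilt_le_succ (n : ℕ) : wordFilt x H n ≤ wordFilt x H (n + 1) := by
  induction n with
  | zero => exact bot_le
  | succ n ih =>
    exact wordFilt_succ_le (le_wordFilt_succ _) fun i u hu => apply_mem_wordFilt (ih hu) i

theorem wordFilt_mono : Monotone (wordFilt x H) := monotone_nat_of_le_succ wordFilt_le_succ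

instance finiteDimensional_wordFilt [Finite ι] [FiniteDimensional ℂ H] (n : ℕ) :
    FiniteDimensional ℂ (wordFilt x H n) := by
  induction n with
  | zero => rw [wordFilt]; infer_instance
  | succ n ih => rw [wordFilt]; infer_instance

theorem span_apply_mem_wordFilt {n : ℕ} {u : U} (hu : u ∈ wordFilt x H n) {y : Module.End ℂ U}
    (hy : y ∈ Submodule.span ℂ (Set.range x)) : y u ∈ wordFilt x H (n + 1) := by
  induction hy using Submodule.span_induction with
  | mem y h =>
    obtain ⟨i, rfl⟩ := h
    exact apply_mem_wordFilt hu i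
  | zero => exact Submodule.zero_mem _
  | add y z _ _ hy hz => exact Submodule.add_mem _ hy hz
  | smul c y _ hy => exact Submodule.smul_mem _ c hy

theorem word_apply_mem {n : ℕ} {u : U} (hu : u ∈ wordFilt x H n) (w : List ι) :
    (w.map x).prod u ∈ wordFilt x H (n + w.length) := by
  induction w with
  | nil => simpa using hu
  | cons i w ih =>
    rw [List.map_cons, List.prod_cons, List.length_cons, ← add_assoc]
    exact apply_mem_wordFilt ih i

/-- Permuting the letters of a word changes it only by a shorter word. -/
theorem word_perm (hx : ∀ i j, x i * x j - x j * x i ∈ Submodule.span ℂ (Set.range x))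
    {w w' : List ι} (hw : w.Perm w') {h : U} (hh : h ∈ H) :
    (w.map x).prod h - (w'.map x).prod h ∈ wordFilt x H w.length := by
  induction hw with
  | nil => simp
  | cons i _ ih =>
    simp only [List.map_cons, List.prod_cons, List.length_cons, Module.End.mul_apply]
    rw [← map_sub]
    exact apply_mem_wordFilt ih i
  | swap i j w =>
    -- Exchanging two adjacent letters leaves a commutator, which is a combination of single
    -- letters: two letters are replaced by one.
    have h1 : (w.map x).prod h ∈ wordFilt x H (1 + w.length) :=
      word_apply_mem (n := 1) (le_wordFilt_succ 0 hh) w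
    have h2 := span_apply_mem_wordFilt h1 (hx j i)
    simp only [List.map_cons, List.prod_cons, List.length_cons, Module.End.mul_apply]
    simpa [add_comm, add_left_comm, add_assoc] using h2
  | trans h1 _ ih1 ih2 =>
    rw [← h1.length_eq] at ih2
    have := Submodule.add_mem _ ih1 ih2
    rwa [sub_add_sub_cancel] at this

variable (x) in
/-- A linear map from polynomials to operators, sending each monomial to a product of the `x_i` in
some order. -/
def wordMap : MvPolynomial ι ℂ →ₗ[ℂ] Module.End ℂ U :=
  (MvPolynomial.basisMonomials ι ℂ).constr ℂ fun s => ((Finsupp.toMultiset s).toList.map x).prod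

theorem wordMap_monomial (s : ι →₀ ℕ) : wordMap x (MvPolynomial.monomial s 1)
    = ((Finsupp.toMultiset s).toList.map x).prod := by
  have := (MvPolynomial.basisMonomials ι ℂ).constr_basis ℂ
    (fun s => ((Finsupp.toMultiset s).toList.map x).prod) s
  rwa [MvPolynomial.coe_basisMonomials] at this

theorem wordMap_one : wordMap x 1 = 1 := by
  have := wordMap_monomial (x := x) 0
  simpa using this

/-- The two terms are words in the same n + 1 letters in different orders, so `word_perm` bounds the
difference. Such words lie a priori in step n + 2, the index being shifted because step 0 is zero.
Up to lower order, multiplication by X_i thus corresponds to x_i. -/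
theorem wordMap_X_mul (hx : ∀ i j, x i * x j - x j * x i ∈ Submodule.span ℂ (Set.range x))
    {n : ℕ} {q : MvPolynomial ι ℂ} (hq : q ∈ MvPolynomial.homogeneousSubmodule ι ℂ n) (i : ι)
    {h : U} (hh : h ∈ H) :
    x i (wordMap x q h) - wordMap x (MvPolynomial.X i * q) h ∈ wordFilt x H (n + 1) := by
  classical
  rw [MvPolynomial.as_sum q]
  simp only [Finset.mul_sum, map_sum, LinearMap.sum_apply, ← Finset.sum_sub_distrib]
  refine Submodule.sum_mem _ fun s hs => ?_
  have hd : s.degree = n := by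
    have := hq (MvPolynomial.mem_support_iff.1 hs)
    rwa [Finsupp.degree_eq_weight_one]
  have e : MvPolynomial.monomial s (MvPolynomial.coeff s q)
      = MvPolynomial.coeff s q • MvPolynomial.monomial s (1 : ℂ) := by
    rw [MvPolynomial.smul_monomial, smul_eq_mul, mul_one]
  rw [e, mul_smul_comm, map_smul, map_smul, LinearMap.smul_apply, LinearMap.smul_apply, map_smul,
    ← smul_sub]
  refine Submodule.smul_mem _ _ ?_
  have e2 : MvPolynomial.X i * MvPolynomial.monomial s (1 : ℂ)
      = MvPolynomial.monomial (Finsupp.single i 1 + s) 1 := by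
    rw [MvPolynomial.X, MvPolynomial.monomial_mul, one_mul]
  rw [e2, wordMap_monomial, wordMap_monomial]
  have hperm : (i :: (Finsupp.toMultiset s).toList).Perm
      (Finsupp.toMultiset (Finsupp.single i 1 + s)).toList := by
    rw [← Multiset.coe_eq_coe, ← Multiset.cons_coe, Multiset.coe_toList, Multiset.coe_toList,
      map_add, Finsupp.toMultiset_single, one_smul, Multiset.singleton_add]
  have := word_perm hx hperm hh
  have hl : (i :: (Finsupp.toMultiset s).toList).length = n + 1 := by
    rw [List.length_cons, Multiset.length_toList, Finsupp.card_toMultiset, ← hd]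
    rfl
  rw [hl] at this
  simpa using this

theorem wordMap_mem (hx : ∀ i j, x i * x j - x j * x i ∈ Submodule.span ℂ (Set.range x))
    {n : ℕ} {q : MvPolynomial ι ℂ} (hq : q ∈ MvPolynomial.homogeneousSubmodule ι ℂ n)
    {h : U} (hh : h ∈ H) : wordMap x q h ∈ wordFilt x H (n + 1) := by
  refine homogeneous_induction (P := fun n q => wordMap x q h ∈ wordFilt x H (n + 1))
    ?_ ?_ ?_ ?_ ?_ n q hq
  · rw [wordMap_one]
    exact le_wordFilt_succ 0 hh
  · intro n
    simp
  · intro n p q hp hq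
    rw [map_add]
    exact Submodule.add_mem _ hp hq
  · intro n c p hp
    rw [map_smul]
    exact Submodule.smul_mem _ c hp
  · intro n i q hq ih
    have h1 := wordFilt_le_succ _ (wordMap_X_mul hx hq i hh)
    have h2 := apply_mem_wordFilt ih i
    have := Submodule.sub_mem _ h2 h1
    rwa [sub_sub_cancel] at this

/-- A homogeneous polynomial `c` of degree `m` lowers the filtration if it annihilates the
associated graded module. -/
def IsLowering (x : ι → Module.End ℂ U) (H : Submodule ℂ U) (m : ℕ) (c : MvPolynomial ι ℂ) : Prop :=
  c ∈ MvPolynomial.homogeneousSubmodule ι ℂ m ∧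
    ∀ n, ∀ q ∈ MvPolynomial.homogeneousSubmodule ι ℂ n, ∀ h ∈ H,
      wordMap x (c * q) h ∈ wordFilt x H (n + m)

/-- A combination of the x_i would normally raise the filtration by one. If it preserves every step,
its symbol annihilates the graded module. -/
theorem isLowering_linear [Fintype ι]
    (hx : ∀ i j, x i * x j - x j * x i ∈ Submodule.span ℂ (Set.range x)) (c : ι → ℂ)
    (hc : ∀ n, ∀ u ∈ wordFilt x H n, (∑ i, c i • x i) u ∈ wordFilt x H n) :
    IsLowering x H 1 (∑ i, c i • MvPolynomial.X i) := by
  refine ⟨Submodule.sum_mem _ fun i _ => Submodule.smul_mem _ _ (MvPolynomial.isHomogeneous_X _ _),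
    fun n q hq h hh => ?_⟩
  have h1 : ∑ i, c i • (x i (wordMap x q h) - wordMap x (MvPolynomial.X i * q) h)
      ∈ wordFilt x H (n + 1) :=
    Submodule.sum_mem _ fun i _ => Submodule.smul_mem _ _ (wordMap_X_mul hx hq i hh)
  have h2 := hc _ _ (wordMap_mem hx hq hh)
  have h3 := Submodule.sub_mem _ h2 h1
  convert h3 using 1
  simp [Finset.sum_mul, smul_sub, Finset.sum_sub_distrib]

/-- Powers of the generic matrix are mapped to powers of the matrix of operators, up to lower order
terms. -/
theorem matrix_pow_apply_sub {I : Type*} [Fintype I] [DecidableEq I]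
    {x : I × I → Module.End ℂ U}
    (hx : ∀ i j, x i * x j - x j * x i ∈ Submodule.span ℂ (Set.range x))
    {n : ℕ} {q : MvPolynomial (I × I) ℂ}
    (hq : q ∈ MvPolynomial.homogeneousSubmodule (I × I) ℂ n) {h : U} (hh : h ∈ H) (m : ℕ)
    (a b : I) :
    (((Matrix.of fun a b => (MvPolynomial.X (a, b) : MvPolynomial (I × I) ℂ)) ^ m) a b
      ∈ MvPolynomial.homogeneousSubmodule (I × I) ℂ m) ∧
    (((Matrix.of fun a b => x (a, b)) ^ m) a b) (wordMap x q h)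
      - wordMap x (((Matrix.of fun a b => (MvPolynomial.X (a, b) : MvPolynomial (I × I) ℂ)) ^ m) a b
        * q) h ∈ wordFilt x H (n + m) := by
  induction m generalizing a b with
  | zero =>
    simp only [pow_zero, Matrix.one_apply]
    by_cases hab : a = b
    · simp only [hab, if_true, one_mul, Module.End.one_apply, sub_self]
      exact ⟨MvPolynomial.isHomogeneous_one _ _, Submodule.zero_mem _⟩
    · simp [hab]
  | succ m ih =>
    have hhom : ∀ c, (MvPolynomial.X (a, c) : MvPolynomial (I × I) ℂ) *
        ((Matrix.of fun a b => (MvPolynomial.X (a, b) : MvPolynomial (I × I) ℂ)) ^ m) c b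
          ∈ MvPolynomial.homogeneousSubmodule (I × I) ℂ (m + 1) := fun c => by
      rw [add_comm]
      exact MvPolynomial.IsHomogeneous.mul (MvPolynomial.isHomogeneous_X _ _) (ih c b).1
    rw [pow_succ', pow_succ', Matrix.mul_apply, Matrix.mul_apply]
    refine ⟨Submodule.sum_mem _ fun c _ => hhom c, ?_⟩
    rw [Finset.sum_mul, map_sum, LinearMap.sum_apply, LinearMap.sum_apply, ← Finset.sum_sub_distrib]
    refine Submodule.sum_mem _ fun c _ => ?_
    have h1 := apply_mem_wordFilt (ih c b).2 (a, c)
    have h2 := wordMap_X_mul hx (MvPolynomial.IsHomogeneous.mul (ih c b).1 hq) (a, c) hh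
    rw [add_comm m n] at h2
    have h3 := Submodule.add_mem _ h1 h2
    rw [map_sub, sub_add_sub_cancel] at h3
    simpa [mul_assoc, add_assoc] using h3

/-- The trace of a power of the operator matrix has as leading symbol the trace of that power of the
generic matrix. A scalar operator does not raise the filtration at all, so in positive degree m + 1
this symbol acts by zero on the graded module. -/
theorem isLowering_trace {I : Type*} [Fintype I] [DecidableEq I]
    {x : I × I → Module.End ℂ U}
    (hx : ∀ i j, x i * x j - x j * x i ∈ Submodule.span ℂ (Set.range x)) (m : ℕ) (c : ℂ)
    (hc : ((Matrix.of fun a b => x (a, b)) ^ (m + 1)).trace = c • 1) :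
    IsLowering x H (m + 1)
      ((Matrix.of fun a b => (MvPolynomial.X (a, b) : MvPolynomial (I × I) ℂ)) ^ (m + 1)).trace := by
  have h1 := fun (q : MvPolynomial (I × I) ℂ) n
    (hq : q ∈ MvPolynomial.homogeneousSubmodule (I × I) ℂ n) h hh a =>
      matrix_pow_apply_sub (H := H) hx hq (h := h) hh (m + 1) a a
  refine ⟨Submodule.sum_mem _ fun a _ => (matrix_pow_apply_sub (H := H) hx
    (MvPolynomial.isHomogeneous_one _ _) (Submodule.zero_mem H) (m + 1) a a).1,
    fun n q hq h hh => ?_⟩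
  have h2 := Submodule.sum_mem _ fun a (_ : a ∈ Finset.univ) => (h1 q n hq h hh a).2
  rw [Finset.sum_sub_distrib] at h2
  have h3 : ∑ a, (((Matrix.of fun a b => x (a, b)) ^ (m + 1)) a a) (wordMap x q h)
      = c • wordMap x q h := by
    have := LinearMap.congr_fun hc (wordMap x q h)
    rw [Matrix.trace, LinearMap.sum_apply] at this
    exact this
  rw [h3] at h2
  have h4 : c • wordMap x q h ∈ wordFilt x H (n + (m + 1)) :=
    Submodule.smul_mem _ _ (wordFilt_mono (by omega) (wordMap_mem hx hq hh))
  have h5 := Submodule.sub_mem _ h4 h2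
  rw [sub_sub_cancel] at h5
  rw [Matrix.trace, Finset.sum_mul, map_sum, LinearMap.sum_apply]
  exact h5

end Filtration

/-! ### Polynomials with coefficients in a vector space -/

section TensorComponent

variable {ι : Type*} {H : Type*} [AddCommGroup H] [Module ℂ H]

variable (ι H) in
/-- The homogeneous component of degree `n` in `ℂ[X] ⊗ H`. -/
def tensorComponent (n : ℕ) :
    MvPolynomial ι ℂ ⊗[ℂ] H →ₗ[ℂ] MvPolynomial ι ℂ ⊗[ℂ] H :=
  (MvPolynomial.homogeneousComponent n).rTensor H

theorem tensorComponent_smul {c : MvPolynomial ι ℂ} {m : ℕ}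
    (hc : c ∈ MvPolynomial.homogeneousSubmodule ι ℂ m) (n : ℕ) (z : MvPolynomial ι ℂ ⊗[ℂ] H) :
    tensorComponent ι H (n + m) (c • z) = c • tensorComponent ι H n z := by
  induction z with
  | zero => simp
  | add y z hy hz => simp only [smul_add, map_add, hy, hz]
  | tmul q h =>
    simp only [tensorComponent, TensorProduct.smul_tmul', smul_eq_mul, LinearMap.rTensor_tmul,
      homogeneousComponent_homogeneous_mul hc]

theorem tensorComponent_smul_of_lt {c : MvPolynomial ι ℂ} {m n : ℕ}
    (hc : c ∈ MvPolynomial.homogeneousSubmodule ι ℂ m) (hn : n < m)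
    (z : MvPolynomial ι ℂ ⊗[ℂ] H) : tensorComponent ι H n (c • z) = 0 := by
  induction z with
  | zero => simp
  | add y z hy hz => simp only [smul_add, map_add, hy, hz, add_zero]
  | tmul q h =>
    simp only [tensorComponent, TensorProduct.smul_tmul', smul_eq_mul, LinearMap.rTensor_tmul,
      homogeneousComponent_mul_of_lt hc hn, TensorProduct.zero_tmul]

theorem exists_tensorComponent_eq_zero (z : MvPolynomial ι ℂ ⊗[ℂ] H) :
    ∃ B, ∀ n > B, tensorComponent ι H n z = 0 := by
  induction z with
  | zero => exact ⟨0, fun n _ => map_zero _⟩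
  | add y z hy hz =>
    obtain ⟨B, hB⟩ := hy
    obtain ⟨C, hC⟩ := hz
    refine ⟨max B C, fun n hn => ?_⟩
    rw [map_add, hB n (lt_of_le_of_lt (le_max_left _ _) hn),
      hC n (lt_of_le_of_lt (le_max_right _ _) hn), add_zero]
  | tmul q h =>
    refine ⟨q.totalDegree, fun n hn => ?_⟩
    rw [tensorComponent, LinearMap.rTensor_tmul, MvPolynomial.homogeneousComponent_eq_zero _ _ hn,
      TensorProduct.zero_tmul]

theorem tensorComponent_idem (n : ℕ) (z : MvPolynomial ι ℂ ⊗[ℂ] H) :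
    tensorComponent ι H n (tensorComponent ι H n z) = tensorComponent ι H n z := by
  induction z with
  | zero => simp
  | add y z hy hz => simp only [map_add, hy, hz]
  | tmul q h =>
    simp only [tensorComponent, LinearMap.rTensor_tmul]
    rw [MvPolynomial.homogeneousComponent_of_mem
      (MvPolynomial.homogeneousComponent_isHomogeneous n q), if_pos rfl]

end TensorComponent

/-! ### Invariant polynomials -/

section PolyRep

variable {ι : Type*} [Fintype ι]

/-- The substitution `X_i ↦ ∑ a_{ij} X_j`. -/
def linSubst (a : Matrix ι ι ℂ) : MvPolynomial ι ℂ →ₐ[ℂ] MvPolynomial ι ℂ :=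
  MvPolynomial.aeval fun i => ∑ j, a i j • (MvPolynomial.X j : MvPolynomial ι ℂ)

theorem linSubst_X (a : Matrix ι ι ℂ) (i : ι) :
    linSubst a (MvPolynomial.X i) = ∑ j, a i j • (MvPolynomial.X j : MvPolynomial ι ℂ) := by
  rw [linSubst, MvPolynomial.aeval_X]

theorem linSubst_mul (a b : Matrix ι ι ℂ) :
    linSubst (a * b) = (linSubst b).comp (linSubst a) := by
  refine MvPolynomial.algHom_ext fun i => ?_
  simp only [linSubst_X, AlgHom.comp_apply, map_sum, map_smul, Finset.smul_sum,
    Matrix.mul_apply, Finset.sum_smul, mul_smul]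
  exact Finset.sum_comm

theorem linSubst_one [DecidableEq ι] : linSubst (1 : Matrix ι ι ℂ) = AlgHom.id ℂ _ := by
  refine MvPolynomial.algHom_ext fun i => ?_
  simp [linSubst_X, Matrix.one_apply]

theorem linSubst_mem (a : Matrix ι ι ℂ) {n : ℕ} {q : MvPolynomial ι ℂ}
    (hq : q ∈ MvPolynomial.homogeneousSubmodule ι ℂ n) :
    linSubst a q ∈ MvPolynomial.homogeneousSubmodule ι ℂ n := by
  refine homogeneous_induction
    (P := fun n q => linSubst a q ∈ MvPolynomial.homogeneousSubmodule ι ℂ n) ?_ ?_ ?_ ?_ ?_ n q hq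
  · rw [map_one]
    exact MvPolynomial.isHomogeneous_one _ _
  · intro n
    rw [map_zero]
    exact Submodule.zero_mem _
  · intro n p q hp hq
    rw [map_add]
    exact Submodule.add_mem _ hp hq
  · intro n c p hp
    rw [map_smul]
    exact Submodule.smul_mem _ c hp
  · intro n i q _ hq
    rw [map_mul, add_comm, linSubst_X]
    exact MvPolynomial.IsHomogeneous.mul (Submodule.sum_mem (MvPolynomial.homogeneousSubmodule ι ℂ 1)
      fun j _ => Submodule.smul_mem _ _ (MvPolynomial.isHomogeneous_X _ _)) hq

theorem homogeneousComponent_linSubst (a : Matrix ι ι ℂ) (n : ℕ) (q : MvPolynomial ι ℂ) :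
    MvPolynomial.homogeneousComponent n (linSubst a q)
      = linSubst a (MvPolynomial.homogeneousComponent n q) := by
  conv_lhs => rw [← MvPolynomial.sum_homogeneousComponent q]
  rw [map_sum, map_sum]
  have h : ∀ i, MvPolynomial.homogeneousComponent n
      (linSubst a (MvPolynomial.homogeneousComponent i q))
        = if i = n then linSubst a (MvPolynomial.homogeneousComponent i q) else 0 := by
    intro i
    rw [MvPolynomial.homogeneousComponent_of_mem
      (linSubst_mem a (MvPolynomial.homogeneousComponent_isHomogeneous i q))]
    simp only [eq_comm]
  rw [Finset.sum_congr rfl fun i _ => h i, Finset.sum_ite_eq']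
  split_ifs with hn
  · rfl
  · rw [MvPolynomial.homogeneousComponent_eq_zero _ _ (by simpa using hn), map_zero]

variable [DecidableEq ι] {K : Type*} [Group K]

/-- The action on polynomials attached to a linear action on the variables. -/
def polyRep (A : K →* (Matrix ι ι ℂ)ᵐᵒᵖ) : K →* Module.End ℂ (MvPolynomial ι ℂ) where
  toFun k := (linSubst (A k).unop).toLinearMap
  map_one' := by
    rw [map_one, MulOpposite.unop_one, linSubst_one]
    rfl
  map_mul' k k' := by
    rw [map_mul, MulOpposite.unop_mul, linSubst_mul]
    rfl

theorem polyRep_apply (A : K →* (Matrix ι ι ℂ)ᵐᵒᵖ) (k : K) (q : MvPolynomial ι ℂ) :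
    polyRep A k q = linSubst (A k).unop q := rfl

variable {H : Type*} [AddCommGroup H] [Module ℂ H] {A : K →* (Matrix ι ι ℂ)ᵐᵒᵖ}

/-- The diagonal action on `ℂ[X] ⊗ H`. -/
def covRep (A : K →* (Matrix ι ι ℂ)ᵐᵒᵖ) (σ : K →* Module.End ℂ H) :
    K →* Module.End ℂ (MvPolynomial ι ℂ ⊗[ℂ] H) where
  toFun k := TensorProduct.map (polyRep A k) (σ k)
  map_one' := by rw [map_one, map_one]; exact TensorProduct.map_id
  map_mul' k k' := by
    rw [map_mul, map_mul]
    exact TensorProduct.map_comp _ _ _ _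

variable {σ : K →* Module.End ℂ H}

theorem covRep_tmul (k : K) (q : MvPolynomial ι ℂ) (h : H) :
    covRep A σ k (q ⊗ₜ[ℂ] h) = polyRep A k q ⊗ₜ[ℂ] σ k h := rfl

theorem covRep_smul (k : K) (q : MvPolynomial ι ℂ) (z : MvPolynomial ι ℂ ⊗[ℂ] H) :
    covRep A σ k (q • z) = polyRep A k q • covRep A σ k z := by
  induction z with
  | zero => simp
  | add y z hy hz => simp only [smul_add, map_add, hy, hz]
  | tmul p h =>
    simp only [covRep_tmul, TensorProduct.smul_tmul', smul_eq_mul, polyRep_apply, map_mul]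

theorem tensorComponent_covRep (k : K) (n : ℕ) (z : MvPolynomial ι ℂ ⊗[ℂ] H) :
    tensorComponent ι H n (covRep A σ k z) = covRep A σ k (tensorComponent ι H n z) := by
  induction z with
  | zero => simp
  | add y z hy hz => simp only [map_add, hy, hz]
  | tmul q h =>
    simp only [tensorComponent, covRep_tmul, LinearMap.rTensor_tmul, polyRep_apply,
      homogeneousComponent_linSubst]

variable [TopologicalSpace K]

theorem polyRep_isLFC (hA : Continuous fun k => (A k).unop) :
    IsLFC (polyRep A) := by
  intro q
  simp only [polyRep_apply]
  induction q using MvPolynomial.induction_on with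
  | C c => simpa [linSubst] using const_mem_finCont (MvPolynomial.C c : MvPolynomial ι ℂ)
  | add p q hp hq => simpa using! (finCont K (MvPolynomial ι ℂ)).add_mem hp hq
  | mul_X p i hp =>
    have hX : (fun k => linSubst (A k).unop (MvPolynomial.X i)) ∈ finCont K (MvPolynomial ι ℂ) := by
      simp only [linSubst_X]
      exact sum_mem_finCont _ fun j _ =>
        smul_mem_finCont (hA.matrix_elem i j) (MvPolynomial.X j : MvPolynomial ι ℂ)
    simpa using finCont_bilin (LinearMap.mul ℂ (MvPolynomial ι ℂ)) hp hX

theorem covRep_isLFC (hA : Continuous fun k => (A k).unop) (hσ : IsLFC σ) : IsLFC (covRep A σ) :=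
  (polyRep_isLFC hA).tensor hσ fun _ _ _ => rfl

variable [IsTopologicalGroup K] [CompactSpace K]

/-- Hilbert's argument: if all invariants without constant term lie in the radical of `J`, then all
invariants of large degree lie in `J`. -/
theorem exists_invariant_mem (hA : Continuous fun k => (A k).unop)
    (J : Ideal (MvPolynomial ι ℂ))
    (hJ : ∀ d, ∀ q ∈ MvPolynomial.homogeneousSubmodule ι ℂ (d + 1),
      (∀ k, polyRep A k q = q) → q ∈ J.radical) :
    ∃ m₀, ∀ m ≥ m₀, ∀ q ∈ MvPolynomial.homogeneousSubmodule ι ℂ m,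
      (∀ k, polyRep A k q = q) → q ∈ J := by
  classical
  have hlfc := polyRep_isLFC hA
  let S : Set (MvPolynomial ι ℂ) := {q | ∃ d, q ∈ MvPolynomial.homogeneousSubmodule ι ℂ (d + 1) ∧
    ∀ k, polyRep A k q = q}
  -- The ideal I of homogeneous invariants of positive degree is generated by finitely many of them
  -- and lies in the radical of `J`, a power of which lies in `J`. So it suffices that invariants of
  -- large degree lie in a high power of I.
  have hfg : (Ideal.span S).FG := IsNoetherian.noetherian _
  obtain ⟨s, hsS, hs⟩ := (Submodule.fg_span_iff_fg_span_finset_subset S).1 hfg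
  obtain ⟨r, hr⟩ := J.exists_radical_pow_le_of_fg (IsNoetherian.noetherian _)
  have hIJ : Ideal.span S ≤ J.radical := by
    rw [Ideal.span_le]
    rintro q ⟨d, hq, hinv⟩
    exact hJ d q hq hinv
  have hsS' : ∀ g ∈ s, ∃ d, g ∈ MvPolynomial.homogeneousSubmodule ι ℂ (d + 1) ∧
    ∀ k, polyRep A k g = g := fun g hg => hsS hg
  choose! deg hdeg hinv using hsS'
  -- The generator g has degree deg g + 1, so B bounds all degrees of generators, and r generators
  -- can be split off from an invariant of degree at least r B.
  let B := s.sup deg + 1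
  have hB : ∀ g ∈ s, deg g + 1 ≤ B := fun g hg => Nat.succ_le_succ (Finset.le_sup hg)
  have key : ∀ r m, r * B ≤ m → ∀ q ∈ MvPolynomial.homogeneousSubmodule ι ℂ m,
      (∀ k, polyRep A k q = q) → q ∈ Ideal.span S ^ r := by
    intro r
    induction r with
    | zero => intros; simp
    | succ r ih =>
      intro m hm q hq hqinv
      have hm1 : B ≤ m := le_trans (by nlinarith) hm
      obtain ⟨m', rfl⟩ : ∃ m', m = m' + 1 := ⟨m - 1, by omega⟩
      have hqI : q ∈ Submodule.span (MvPolynomial ι ℂ) (s : Set (MvPolynomial ι ℂ)) := by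
        rw [← hs]
        exact Submodule.subset_span ⟨m', hq, hqinv⟩
      obtain ⟨f, -, hf⟩ := Submodule.mem_span_finset.1 hqI
      have h1 : q = ∑ g ∈ s, average _ hlfc (f g) * g := by
        have h2 := average_of_invariant hlfc hqinv
        rw [← hf, map_sum] at h2
        rw [← hf, ← h2]
        refine Finset.sum_congr rfl fun g hg => ?_
        refine (map_average hlfc hlfc (LinearMap.mulRight ℂ g) fun k => ?_).symm
        have := hinv g hg k
        rw [polyRep_apply] at this
        simp only [polyRep_apply, LinearMap.mulRight_apply, map_mul, this]
      -- Passing to degree m' + 1 makes the coefficients homogeneous too, so that the induction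
      -- hypothesis applies to them.
      have h2 : q = ∑ g ∈ s, MvPolynomial.homogeneousComponent (m' + 1 - (deg g + 1))
          (average _ hlfc (f g)) * g := by
        have h3 : MvPolynomial.homogeneousComponent (m' + 1) q = q := by
          rw [MvPolynomial.homogeneousComponent_of_mem hq, if_pos rfl]
        conv_lhs => rw [← h3, h1, map_sum]
        refine Finset.sum_congr rfl fun g hg => ?_
        have h4 : m' + 1 = (m' + 1 - (deg g + 1)) + (deg g + 1) := by
          have := hB g hg
          omega
        conv_lhs => rw [h4, mul_comm, homogeneousComponent_homogeneous_mul (hdeg g hg)]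
        rw [mul_comm]
      rw [h2]
      refine Ideal.sum_mem _ fun g hg => ?_
      rw [pow_succ]
      refine Ideal.mul_mem_mul (ih _ ?_ _ (MvPolynomial.homogeneousComponent_isHomogeneous _ _) ?_) ?_
      · have := hB g hg
        rw [add_mul, one_mul] at hm
        omega
      · intro k
        rw [polyRep_apply, ← homogeneousComponent_linSubst, ← polyRep_apply, apply_average]
      · exact Ideal.subset_span ⟨deg g, hdeg g hg, hinv g hg⟩
  exact ⟨r * B, fun m hm q hq hqinv => hr (Ideal.pow_right_mono hIJ r (key r m hm q hq hqinv))⟩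

/-! ### Polynomial covariants -/

/-- The covariants generate a Noetherian module over the polynomials, and coefficients with respect
to finitely many covariant generators can be averaged to invariant polynomials. In total degree at
least m₀ plus the largest degree of a generator, a term either has a coefficient of degree at least
m₀, which lies in J by `exists_invariant_mem`, or a component of the generator beyond its degree
bound, which is zero. -/
theorem exists_covariant_mem [FiniteDimensional ℂ H] (hA : Continuous fun k => (A k).unop)
    (hσ : IsLFC σ) (J : Ideal (MvPolynomial ι ℂ))
    (hJ : ∀ d, ∀ q ∈ MvPolynomial.homogeneousSubmodule ι ℂ (d + 1),
      (∀ k, polyRep A k q = q) → q ∈ J.radical) :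
    ∃ n₀, ∀ n ≥ n₀, ∀ z : MvPolynomial ι ℂ ⊗[ℂ] H, tensorComponent ι H n z = z →
      (∀ k, covRep A σ k z = z) →
        z ∈ J • (⊤ : Submodule (MvPolynomial ι ℂ) (MvPolynomial ι ℂ ⊗[ℂ] H)) := by
  classical
  obtain ⟨m₀, hm₀⟩ := exists_invariant_mem hA J hJ
  have hlfc := polyRep_isLFC hA
  have hcov := covRep_isLFC hA hσ
  let S : Set (MvPolynomial ι ℂ ⊗[ℂ] H) := {z | ∀ k, covRep A σ k z = z}
  have hfg : (Submodule.span (MvPolynomial ι ℂ) S).FG := IsNoetherian.noetherian _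
  obtain ⟨s, hsS, hs⟩ := (Submodule.fg_span_iff_fg_span_finset_subset S).1 hfg
  choose bd hbd using exists_tensorComponent_eq_zero (ι := ι) (H := H)
  refine ⟨m₀ + s.sup bd, fun n hn z hz hinv => ?_⟩
  have hzs : z ∈ Submodule.span (MvPolynomial ι ℂ) (s : Set (MvPolynomial ι ℂ ⊗[ℂ] H)) := by
    rw [← hs]
    exact Submodule.subset_span hinv
  obtain ⟨f, -, hf⟩ := Submodule.mem_span_finset.1 hzs
  have h1 : z = ∑ g ∈ s, average _ hlfc (f g) • g := by
    have h2 := average_of_invariant hcov hinv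
    rw [← hf, map_sum] at h2
    rw [← hf, ← h2]
    refine Finset.sum_congr rfl fun g hg => ?_
    have hg' : ∀ k, covRep A σ k g = g := hsS hg
    refine (map_average hlfc hcov
      ((LinearMap.toSpanSingleton (MvPolynomial ι ℂ) _ g).restrictScalars ℂ) fun k => ?_).symm
    simp only [LinearMap.coe_restrictScalars, LinearMap.toSpanSingleton_apply, covRep_smul, hg']
  rw [← hz, h1, map_sum]
  refine Submodule.sum_mem _ fun g hg => ?_
  rw [← MvPolynomial.sum_homogeneousComponent (average _ hlfc (f g)), Finset.sum_smul, map_sum]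
  refine Submodule.sum_mem _ fun i _ => ?_
  have hi := MvPolynomial.homogeneousComponent_isHomogeneous i (average _ hlfc (f g))
  by_cases hin : n < i
  · rw [tensorComponent_smul_of_lt hi hin]
    exact Submodule.zero_mem _
  · obtain ⟨j, rfl⟩ : ∃ j, n = j + i := ⟨n - i, by omega⟩
    rw [tensorComponent_smul hi]
    by_cases him : m₀ ≤ i
    · refine Submodule.smul_mem_smul (hm₀ i him _ hi fun k => ?_) trivial
      rw [polyRep_apply, ← homogeneousComponent_linSubst, ← polyRep_apply, apply_average]
    · have hj : bd g < j := by
        have := Finset.le_sup (f := bd) hg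
        omega
      rw [hbd g j hj, smul_zero]
      exact Submodule.zero_mem _

end PolyRep

/-! ### Finiteness of invariants -/

section Symbol

variable {ι : Type*} {U : Type*} [AddCommGroup U] [Module ℂ U]
  {x : ι → Module.End ℂ U} {H : Submodule ℂ U}

variable (x H) in
/-- The map `ℂ[X] ⊗ H → U`, `q ⊗ h ↦ q(x) h`. -/
def symbolMap : MvPolynomial ι ℂ ⊗[ℂ] H →ₗ[ℂ] U :=
  TensorProduct.lift ((wordMap x).compl₂ H.subtype)

theorem symbolMap_tmul (q : MvPolynomial ι ℂ) (h : H) :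
    symbolMap x H (q ⊗ₜ[ℂ] h) = wordMap x q h := rfl

theorem symbolMap_X_smul (hx : ∀ i j, x i * x j - x j * x i ∈ Submodule.span ℂ (Set.range x))
    (n : ℕ) (z : MvPolynomial ι ℂ ⊗[ℂ] H) (i : ι) :
    x i (symbolMap x H (tensorComponent ι H n z))
      - symbolMap x H (tensorComponent ι H (n + 1) ((MvPolynomial.X i : MvPolynomial ι ℂ) • z))
        ∈ wordFilt x H (n + 1) := by
  rw [tensorComponent_smul (MvPolynomial.isHomogeneous_X _ _)]
  induction z with
  | zero => simp
  | add y z hy hz =>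
    have := Submodule.add_mem _ hy hz
    rw [sub_add_sub_comm] at this
    simpa only [map_add, smul_add] using this
  | tmul q h =>
    simp only [tensorComponent, LinearMap.rTensor_tmul, TensorProduct.smul_tmul', smul_eq_mul,
      symbolMap_tmul]
    exact wordMap_X_mul hx (MvPolynomial.homogeneousComponent_isHomogeneous n q) i h.2

/-- By induction on n: applying x_i to the value of a homogeneous symbol gives, up to lower order,
the value of X_i times the symbol. -/
theorem wordFilt_le_range (hx : ∀ i j, x i * x j - x j * x i ∈ Submodule.span ℂ (Set.range x))
    (n : ℕ) : wordFilt x H (n + 1)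
      ≤ LinearMap.range ((symbolMap x H).comp (tensorComponent ι H n)) ⊔ wordFilt x H n := by
  induction n with
  | zero =>
    refine wordFilt_succ_le (fun h hh => Submodule.mem_sup_left ⟨1 ⊗ₜ[ℂ] ⟨h, hh⟩, ?_⟩)
      fun i u hu => ?_
    · rw [LinearMap.comp_apply, tensorComponent, LinearMap.rTensor_tmul,
        MvPolynomial.homogeneousComponent_of_mem (MvPolynomial.isHomogeneous_one _ _), if_pos rfl,
        symbolMap_tmul, wordMap_one]
      rfl
    · rw [wordFilt, Submodule.mem_bot] at hu
      rw [hu, map_zero]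
      exact Submodule.zero_mem _
  | succ n ih =>
    refine wordFilt_succ_le ((le_wordFilt_succ n).trans le_sup_right) fun i u hu => ?_
    obtain ⟨_, ⟨z, rfl⟩, v, hv, rfl⟩ := Submodule.mem_sup.1 (ih hu)
    rw [map_add]
    refine Submodule.add_mem _ ?_ (Submodule.mem_sup_right (apply_mem_wordFilt hv i))
    have h1 := symbolMap_X_smul hx n z i
    rw [← sub_add_cancel (x i _) (symbolMap x H (tensorComponent ι H (n + 1)
      ((MvPolynomial.X i : MvPolynomial ι ℂ) • z)))]
    exact Submodule.add_mem _ (Submodule.mem_sup_right h1) (Submodule.mem_sup_left ⟨_, rfl⟩)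

variable (x H) in
/-- The ideal generated by the polynomials annihilating the associated graded module. -/
def loweringIdeal : Ideal (MvPolynomial ι ℂ) := Ideal.span {c | ∃ m, IsLowering x H m c}

/-- A symbol of degree n has its value in step n + 1 in general; a factor from the ideal gains one
step. On a generator c of degree m this is `IsLowering` applied to the component of degree n - m of
the other factor. -/
theorem symbolMap_mem_of_mem_loweringIdeal {z : MvPolynomial ι ℂ ⊗[ℂ] H}
    (hz : z ∈ loweringIdeal x H • (⊤ : Submodule (MvPolynomial ι ℂ) (MvPolynomial ι ℂ ⊗[ℂ] H)))
    (n : ℕ) : symbolMap x H (tensorComponent ι H n z) ∈ wordFilt x H n := by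
  have key : ∀ r ∈ loweringIdeal x H, ∀ (z : MvPolynomial ι ℂ ⊗[ℂ] H) (n : ℕ),
      symbolMap x H (tensorComponent ι H n (r • z)) ∈ wordFilt x H n := by
    intro r hr
    induction hr using Submodule.span_induction with
    | mem c hc =>
      obtain ⟨m, hc, hlow⟩ := hc
      intro z n
      by_cases hnm : n < m
      · rw [tensorComponent_smul_of_lt hc hnm, map_zero]
        exact Submodule.zero_mem _
      · obtain ⟨j, rfl⟩ : ∃ j, n = j + m := ⟨n - m, by omega⟩
        rw [tensorComponent_smul hc]
        induction z with
        | zero => simp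
        | add y z hy hz => simpa only [map_add, smul_add] using Submodule.add_mem _ hy hz
        | tmul q h =>
          exact hlow j _ (MvPolynomial.homogeneousComponent_isHomogeneous j q) h h.2
    | zero => intro z n; simp
    | add r s _ _ hr hs =>
      intro z n
      rw [add_smul, map_add, map_add]
      exact Submodule.add_mem _ (hr z n) (hs z n)
    | smul a r _ hr =>
      intro z n
      rw [smul_eq_mul, mul_comm, mul_smul]
      exact hr _ n
  induction hz using Submodule.smul_induction_on' with
  | smul r hr z _ => exact key r hr z n
  | add y _ z _ hy hz =>
    rw [map_add, map_add]
    exact Submodule.add_mem _ hy hz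

end Symbol

/-! ### Invariant vectors in a space filtered by words. -/

section Finiteness

variable {ι : Type*} [Fintype ι] [DecidableEq ι] {U : Type*} [AddCommGroup U] [Module ℂ U]
  {K : Type*} [Group K] [TopologicalSpace K]
  {x : ι → Module.End ℂ U} {H : Submodule ℂ U} {A : K →* (Matrix ι ι ℂ)ᵐᵒᵖ}
  {σ : K →* Module.End ℂ U}

/-- A space with almost commuting operators `x_i` and a representation of `K` which transforms the
`x_i` linearly and preserves a subspace `H`. -/
structure IsWordRep (x : ι → Module.End ℂ U) (H : Submodule ℂ U) (A : K →* (Matrix ι ι ℂ)ᵐᵒᵖ)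
    (σ : K →* Module.End ℂ U) : Prop where
  comm : ∀ i j, x i * x j - x j * x i ∈ Submodule.span ℂ (Set.range x)
  cont : Continuous fun k => (A k).unop
  lfc : IsLFC σ
  equivariant : ∀ k i u, σ k (x i u) = ∑ j, (A k).unop i j • x j (σ k u)
  stable : ∀ k, ∀ h ∈ H, σ k h ∈ H

namespace IsWordRep

theorem apply_mem (hw : IsWordRep x H A σ) (k : K) {n : ℕ} {u : U} (hu : u ∈ wordFilt x H n) :
    σ k u ∈ wordFilt x H n := by
  induction n generalizing u with
  | zero =>
    rw [wordFilt, Submodule.mem_bot] at hu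
    rw [hu, map_zero]
    exact Submodule.zero_mem _
  | succ n ih =>
    have h : wordFilt x H (n + 1) ≤ (wordFilt x H (n + 1)).comap (σ k) := by
      refine wordFilt_succ_le (fun h hh => le_wordFilt_succ n (hw.stable k h hh))
        fun i u hu => ?_
      rw [Submodule.mem_comap, hw.equivariant]
      exact Submodule.sum_mem _ fun j _ => Submodule.smul_mem _ _ (apply_mem_wordFilt (ih hu) j)
    exact h hu

/-- Moving σ k past a letter x_i substitutes for x_i the same linear combination as `polyRep` does
for X_i, so only reordering errors remain. -/
theorem apply_wordMap (hw : IsWordRep x H A σ) (k : K) {n : ℕ} {q : MvPolynomial ι ℂ}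
    (hq : q ∈ MvPolynomial.homogeneousSubmodule ι ℂ n) {h : U} (hh : h ∈ H) :
    σ k (wordMap x q h) - wordMap x (polyRep A k q) (σ k h) ∈ wordFilt x H n := by
  refine homogeneous_induction (P := fun n q => σ k (wordMap x q h)
    - wordMap x (polyRep A k q) (σ k h) ∈ wordFilt x H n) ?_ ?_ ?_ ?_ ?_ n q hq
  · simp [polyRep_apply, wordMap_one]
  · intro n
    simp
  · intro n p q hp hq
    have := Submodule.add_mem _ hp hq
    rw [sub_add_sub_comm] at this
    simpa only [map_add, LinearMap.add_apply] using this
  · intro n c p hp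
    have := Submodule.smul_mem _ c hp
    simpa only [map_smul, LinearMap.smul_apply, smul_sub] using this
  · intro n i q hq ih
    have h1 := hw.apply_mem k (wordMap_X_mul hw.comm hq i hh)
    have h2 : ∑ j, (A k).unop i j • (x j (σ k (wordMap x q h) - wordMap x (polyRep A k q) (σ k h)))
        ∈ wordFilt x H (n + 1) :=
      Submodule.sum_mem _ fun j _ => Submodule.smul_mem _ _ (apply_mem_wordFilt ih j)
    have h3 : ∑ j, (A k).unop i j • (x j (wordMap x (polyRep A k q) (σ k h))
        - wordMap x (MvPolynomial.X j * polyRep A k q) (σ k h)) ∈ wordFilt x H (n + 1) :=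
      Submodule.sum_mem _ fun j _ => Submodule.smul_mem _ _
        (wordMap_X_mul hw.comm (linSubst_mem _ hq) j (hw.stable k h hh))
    have h4 := Submodule.add_mem _ (Submodule.sub_mem _ h2 h1) h3
    convert h4 using 1
    have e : polyRep A k (MvPolynomial.X i * q)
        = ∑ j, (A k).unop i j • (MvPolynomial.X j * polyRep A k q) := by
      rw [polyRep_apply, map_mul, linSubst_X, Finset.sum_mul]
      simp only [smul_mul_assoc]
      rfl
    simp only [e, map_sub, map_sum, map_smul, LinearMap.sum_apply, LinearMap.smul_apply,
      hw.equivariant, smul_sub, Finset.sum_sub_distrib]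
    abel

/-- The representation on `H`. -/
def subRep (hw : IsWordRep x H A σ) : K →* Module.End ℂ H where
  toFun k := (σ k).restrict (hw.stable k)
  map_one' := LinearMap.ext fun v => Subtype.ext (by simp [LinearMap.restrict_apply])
  map_mul' k k' := LinearMap.ext fun v => Subtype.ext (by simp [LinearMap.restrict_apply])

theorem subRep_isLFC [FiniteDimensional ℂ H] (hw : IsWordRep x H A σ) : IsLFC hw.subRep := by
  intro h
  refine mem_finCont_of_separating (fun l : Module.Dual ℂ U => l.comp H.subtype) ⊤
    (fun v _ hv => Subtype.ext ((Module.forall_dual_apply_eq_zero_iff ℂ (v : U)).1 hv))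
    (fun _ => trivial) fun l => hw.lfc.continuous h l

theorem apply_symbolMap (hw : IsWordRep x H A σ) (k : K) (n : ℕ) (z : MvPolynomial ι ℂ ⊗[ℂ] H) :
    σ k (symbolMap x H (tensorComponent ι H n z))
      - symbolMap x H (covRep A hw.subRep k (tensorComponent ι H n z)) ∈ wordFilt x H n := by
  induction z with
  | zero => simp
  | add y z hy hz =>
    have := Submodule.add_mem _ hy hz
    rw [sub_add_sub_comm] at this
    simpa only [map_add] using this
  | tmul q h =>
    exact hw.apply_wordMap k (MvPolynomial.homogeneousComponent_isHomogeneous n q) h.2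

variable [IsTopologicalGroup K] [CompactSpace K]

/-- The symbol map is equivariant up to lower order, so an invariant vector of step n + 1 has a
symbol of degree n that can be averaged to an invariant one. For large n such a covariant lies in
the lowering ideal times the module, hence its value, and with it the vector, already lies in step
n. -/
theorem exists_invariants_le [FiniteDimensional ℂ H] (hw : IsWordRep x H A σ)
    (hJ : ∀ d, ∀ q ∈ MvPolynomial.homogeneousSubmodule ι ℂ (d + 1),
      (∀ k, polyRep A k q = q) → q ∈ (loweringIdeal x H).radical) :
    ∃ n₀, ∀ n u, u ∈ wordFilt x H n → (∀ k, σ k u = u) → u ∈ wordFilt x H n₀ := by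
  obtain ⟨n₀, hn₀⟩ := exists_covariant_mem hw.cont hw.subRep_isLFC _ hJ
  have hcov := covRep_isLFC hw.cont hw.subRep_isLFC
  have step : ∀ n ≥ n₀, ∀ u ∈ wordFilt x H (n + 1), (∀ k, σ k u = u) → u ∈ wordFilt x H n := by
    intro n hn u hu hinv
    obtain ⟨_, ⟨z, rfl⟩, v, hv, huv⟩ := Submodule.mem_sup.1 (wordFilt_le_range hw.comm n hu)
    rw [LinearMap.comp_apply] at huv
    set w := average _ hcov (tensorComponent ι H n z) with hwdef
    have hwc : tensorComponent ι H n w = w := by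
      rw [hwdef, map_average hcov hcov (tensorComponent ι H n)
        fun k => tensorComponent_covRep k n _, tensorComponent_idem]
    have h1 : symbolMap x H w ∈ wordFilt x H n := by
      rw [← hwc]
      exact symbolMap_mem_of_mem_loweringIdeal
        (hn₀ n hn w hwc fun k => apply_average hcov k _) n
    -- A functional that vanishes on step n does not see the lower order errors. Hence its value on
    -- symbol (k z) is l u for every k, and taking the mean replaces k z by the averaged symbol w.
    refine mem_of_dual fun l hl => ?_
    have h2 : l (symbolMap x H w) = l u := by
      have h3 := dual_average hcov (tensorComponent ι H n z) (l.comp (symbolMap x H))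
      rw [LinearMap.comp_apply, ← hwdef] at h3
      rw [h3, ← haarMean_const (K := K) (l u)]
      congr 1
      funext k
      have h4 := hl _ (hw.apply_symbolMap k n z)
      have h5 := hl _ (hw.apply_mem k hv)
      have h6 : l (σ k (symbolMap x H (tensorComponent ι H n z) + v)) = l u := by rw [huv, hinv]
      rw [map_sub, sub_eq_zero] at h4
      rw [map_add, map_add, h5, add_zero, h4] at h6
      exact h6
    rw [← h2]
    exact hl _ h1
  refine ⟨n₀, fun n => ?_⟩
  induction n with
  | zero => exact fun u hu _ => wordFilt_mono (Nat.zero_le _) hu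
  | succ n ih =>
    intro u hu hinv
    by_cases hn : n₀ ≤ n
    · exact ih u (step n hn u hu hinv) hinv
    · exact wordFilt_mono (by omega) hu

end IsWordRep

end Finiteness

/-! ### Nilpotent elements of `𝔭` -/

section Nilpotent

variable {I : Type*} [Fintype I] [DecidableEq I]

theorem trace_aeval_X_mul {T : Matrix I I ℂ} (hT : ∀ m : ℕ, (T ^ (m + 1)).trace = 0)
    (r : Polynomial ℂ) : (Polynomial.aeval T (Polynomial.X * r)).trace = 0 := by
  induction r using Polynomial.induction_on' with
  | add p q hp hq => rw [mul_add, map_add, Matrix.trace_add, hp, hq, add_zero]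
  | monomial n c =>
    rw [← Polynomial.C_mul_X_pow_eq_monomial, mul_left_comm, ← pow_succ', map_mul, map_pow,
      Polynomial.aeval_C, Polynomial.aeval_X, Algebra.algebraMap_eq_smul_one, smul_mul_assoc,
      one_mul, Matrix.trace_smul, hT, smul_zero]

/-- A complex matrix all of whose powers have trace zero is nilpotent. -/
theorem isNilpotent_of_trace_pow {T : Matrix I I ℂ} (hT : ∀ m : ℕ, (T ^ (m + 1)).trace = 0) :
    IsNilpotent T := by
  have hp : T.charpoly ≠ 0 := T.charpoly_monic.ne_zero
  -- Write the characteristic polynomial as X^a g with g prime to X. Bézout splits the identity into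
  -- e = u(T) T^(a+1) and v(T) g(T), whose product is zero, so e is idempotent. The exponent a + 1
  -- keeps a factor T in e even when a = 0, so that the trace of e is a combination of traces of
  -- positive powers of T.
  obtain ⟨g, hg, hXg⟩ := (FiniteMultiplicity.of_not_isUnit Polynomial.not_isUnit_X hp :
    FiniteMultiplicity (Polynomial.X : Polynomial ℂ) T.charpoly).exists_eq_pow_mul_and_not_dvd
  set a := multiplicity (Polynomial.X : Polynomial ℂ) T.charpoly
  have hco : IsCoprime ((Polynomial.X : Polynomial ℂ) ^ (a + 1)) g :=
    IsCoprime.pow_left ((Polynomial.irreducible_X.coprime_iff_not_dvd).2 hXg)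
  obtain ⟨u, v, huv⟩ := hco
  have hp0 : Polynomial.aeval T T.charpoly = 0 := Matrix.aeval_self_charpoly T
  set e := Polynomial.aeval T (Polynomial.X * (u * Polynomial.X ^ a)) with he
  have h1 : e + Polynomial.aeval T (v * g) = 1 := by
    rw [he, ← map_add, ← map_one (Polynomial.aeval (R := ℂ) T), ← huv]
    congr 1
    ring
  have h2 : e * Polynomial.aeval T (v * g) = 0 := by
    rw [he, ← map_mul]
    have : Polynomial.X * (u * Polynomial.X ^ a) * (v * g)
      = Polynomial.X * u * v * T.charpoly := by rw [hg]; ring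
    rw [this, map_mul, hp0, mul_zero]
  have hid : e * e = e := by
    have := congrArg (e * ·) h1
    simpa only [mul_add, h2, add_zero, mul_one] using this
  -- In characteristic zero the trace of an idempotent is its rank.
  have he0 : e = 0 := by
    have hL : IsIdempotentElem (Matrix.toLin' e) := by
      change Matrix.toLin' e * Matrix.toLin' e = Matrix.toLin' e
      rw [Module.End.mul_eq_comp, ← Matrix.toLin'_mul, hid]
    have ht : LinearMap.trace ℂ _ (Matrix.toLin' e) = 0 := by
      rw [Matrix.trace_toLin'_eq]
      exact trace_aeval_X_mul hT _
    exact Matrix.toLin'.map_eq_zero_iff.1 (LinearMap.IsIdempotentElem.eq_zero_of_trace_eq_zero hL ht)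
  refine ⟨a, ?_⟩
  rw [he0, zero_add] at h1
  calc T ^ a = T ^ a * Polynomial.aeval T (v * g) := by rw [h1, mul_one]
    _ = Polynomial.aeval T (v * T.charpoly) := by
        rw [← Polynomial.aeval_X (R := ℂ) T, ← map_pow, Polynomial.aeval_X, ← map_mul]
        congr 1
        conv_rhs => rw [hg]
        ring
    _ = 0 := by rw [map_mul, hp0, mul_zero]

/-- The trace form on a subspace stable under the conjugate transpose represents all
functionals. -/
theorem exists_trace_mul_eq {W : Submodule ℂ (Matrix I I ℂ)} (hW : ∀ X ∈ W, Xᴴ ∈ W)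
    (f : Module.Dual ℂ W) : ∃ Z ∈ W, ∀ X : W, (Z * (X : Matrix I I ℂ)).trace = f X := by
  let B : W →ₗ[ℂ] Module.Dual ℂ W :=
    LinearMap.mk₂ ℂ (fun Z X : W => ((Z : Matrix I I ℂ) * (X : Matrix I I ℂ)).trace)
      (fun _ _ _ => by simp [add_mul]) (fun _ _ _ => by simp)
      (fun _ _ _ => by simp [mul_add]) (fun _ _ _ => by simp)
  -- The trace of Z Zᴴ vanishes only for Z = 0, so the form is nondegenerate on the stable subspace,
  -- and equality of dimensions gives surjectivity.
  have hinj : Function.Injective B := by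
    rw [← LinearMap.ker_eq_bot, LinearMap.ker_eq_bot']
    intro Z hZ
    have h := LinearMap.congr_fun hZ ⟨_, hW Z Z.2⟩
    open ComplexOrder in
    exact Subtype.ext (Matrix.trace_mul_conjTranspose_self_eq_zero_iff.1 h)
  have hsurj : Function.Surjective B :=
    (LinearMap.injective_iff_surjective_of_finrank_eq_finrank
      Subspace.dual_finrank_eq.symm).1 hinj
  obtain ⟨Z, hZ⟩ := hsurj f
  exact ⟨Z, Z.2, fun X => LinearMap.congr_fun hZ X⟩

/-- A nilpotent element of `𝔭` is a commutator of itself with an element of `𝔨`. -/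
theorem exists_commutator_eq_self {𝔨 𝔭 : Submodule ℂ (Matrix I I ℂ)} (hk : ∀ X ∈ 𝔨, Xᴴ ∈ 𝔨)
    (hp : ∀ X ∈ 𝔭, Xᴴ ∈ 𝔭) (hkp : ∀ X ∈ 𝔨, ∀ Y ∈ 𝔭, X * Y - Y * X ∈ 𝔭)
    (hpp : ∀ X ∈ 𝔭, ∀ Y ∈ 𝔭, X * Y - Y * X ∈ 𝔨) {T : Matrix I I ℂ} (hT : T ∈ 𝔭)
    (hn : IsNilpotent T) : ∃ h ∈ 𝔨, h * T - T * h = T := by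
  let ad : 𝔨 →ₗ[ℂ] 𝔭 :=
    { toFun := fun h => ⟨h * T - T * h, hkp h h.2 T hT⟩
      map_add' := fun x y => Subtype.ext (by simp [add_mul, mul_add]; abel)
      map_smul' := fun c x => Subtype.ext (by simp [smul_sub]) }
  suffices h : (⟨T, hT⟩ : 𝔭) ∈ LinearMap.range ad by
    obtain ⟨h, hh⟩ := h
    exact ⟨h, h.2, congrArg Subtype.val hh⟩
  -- Let l vanish on [𝔨, T] and represent it as tr (Z ·) with Z ∈ 𝔭. Then [T, Z], an element of 𝔨,
  -- is orthogonal to 𝔨 and hence zero. So Z T is nilpotent, and l T = tr (Z T) = 0.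
  refine mem_of_dual fun l hl => ?_
  obtain ⟨Z, hZ, hZl⟩ := exists_trace_mul_eq hp l
  have h1 : ∀ h ∈ 𝔨, (h * (T * Z - Z * T)).trace = 0 := by
    intro h hh
    have h2 := hl (ad ⟨h, hh⟩) ⟨_, rfl⟩
    rw [← hZl] at h2
    change (Z * (h * T - T * h)).trace = 0 at h2
    rw [← h2, mul_sub, mul_sub, Matrix.trace_sub, Matrix.trace_sub, ← mul_assoc h T Z,
      Matrix.trace_mul_comm (h * T) Z, Matrix.trace_mul_comm h (Z * T), mul_assoc Z T h]
  have hc : T * Z - Z * T = 0 := by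
    open ComplexOrder in
    exact Matrix.trace_conjTranspose_mul_self_eq_zero_iff.1 (h1 _ (hk _ (hpp T hT Z hZ)))
  have hcomm : Commute Z T := (sub_eq_zero.1 hc).symm
  rw [← hZl ⟨T, hT⟩]
  exact (Matrix.isNilpotent_trace_of_isNilpotent (hcomm.isNilpotent_mul_left hn)).eq_zero

end Nilpotent

/-! ### Complexification of subspaces of real matrices. -/

section Complexification

variable {I : Type*}

/-- The complexification of a space of real matrices. -/
def complexify (S : Submodule ℝ (Matrix I I ℝ)) : Submodule ℂ (Matrix I I ℂ) where
  carrier := {T | T.map Complex.re ∈ S ∧ T.map Complex.im ∈ S}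
  zero_mem' := by
    constructor
    · convert S.zero_mem using 1
      ext i j; simp
    · convert S.zero_mem using 1
      ext i j; simp
  add_mem' {x y} hx hy := by
    constructor
    · convert S.add_mem hx.1 hy.1 using 1
      ext i j; simp
    · convert S.add_mem hx.2 hy.2 using 1
      ext i j; simp
  smul_mem' c {x} hx := by
    constructor
    · convert S.sub_mem (S.smul_mem c.re hx.1) (S.smul_mem c.im hx.2) using 1
      ext i j; simp
    · convert S.add_mem (S.smul_mem c.re hx.2) (S.smul_mem c.im hx.1) using 1
      ext i j; simp

theorem re_add_im (T : Matrix I I ℂ) : T = (T.map Complex.re).map Complex.ofReal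
    + Complex.I • (T.map Complex.im).map Complex.ofReal := by
  ext i j
  simp [mul_comm Complex.I]

theorem conjTranspose_mem_complexify {S : Submodule ℝ (Matrix I I ℝ)} (hS : ∀ X ∈ S, Xᵀ ∈ S)
    {T : Matrix I I ℂ} (hT : T ∈ complexify S) : Tᴴ ∈ complexify S := by
  constructor
  · convert hS _ hT.1 using 1
    ext i j; simp
  · convert S.neg_mem (hS _ hT.2) using 1
    ext i j; simp

theorem commutator_mem_complexify [Fintype I] {S S' S'' : Submodule ℝ (Matrix I I ℝ)}
    (h : ∀ X ∈ S, ∀ Y ∈ S', X * Y - Y * X ∈ S'') {X Y : Matrix I I ℂ} (hX : X ∈ complexify S)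
    (hY : Y ∈ complexify S') : X * Y - Y * X ∈ complexify S'' := by
  constructor
  · convert S''.sub_mem (h _ hX.1 _ hY.1) (h _ hX.2 _ hY.2) using 1
    ext i j
    simp [Matrix.mul_apply, Finset.sum_sub_distrib]
    abel
  · convert S''.add_mem (h _ hX.1 _ hY.2) (h _ hX.2 _ hY.1) using 1
    ext i j
    simp [Matrix.mul_apply, Finset.sum_add_distrib]
    abel

end Complexification

/-! ### Polynomials in matrix entries under conjugation by K̃. -/

section InvariantPolynomials

theorem hasDerivAt_eval {ι : Type*} [Fintype ι] {c : ι → ℝ → ℂ} {d : ι → ℂ} {t : ℝ}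
    (hc : ∀ i, HasDerivAt (c i) (d i) t) (q : MvPolynomial ι ℂ) :
    HasDerivAt (fun s => MvPolynomial.eval (fun i => c i s) q)
      (∑ i, d i * MvPolynomial.eval (fun i => c i t) (MvPolynomial.pderiv i q)) t := by
  classical
  induction q using MvPolynomial.induction_on with
  | C r => simpa using hasDerivAt_const t r
  | add p q hp hq =>
    simpa [mul_add, Finset.sum_add_distrib] using! hp.add hq
  | mul_X p i hp =>
    have h := hp.mul (hc i)
    simp only [map_mul, MvPolynomial.eval_X]
    refine h.congr_deriv ?_
    simp [Derivation.leibniz, MvPolynomial.pderiv_X, Pi.single_apply, mul_add,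
      Finset.sum_add_distrib, apply_ite, Finset.sum_mul]
    rw [add_comm]
    congr 1
    · ring
    · exact Finset.sum_congr rfl fun j _ => by ring

variable {N : ℕ} (D : DualPair N)

/-- The action of `K̃` on matrix entries: `(p, q) ↦ (k⁻¹ T k)_{pq}`. -/
def adMat : D.ktilde →* (Matrix ((Fin N ⊕ Fin N) × (Fin N ⊕ Fin N))
    ((Fin N ⊕ Fin N) × (Fin N ⊕ Fin N)) ℂ)ᵐᵒᵖ where
  toFun k := MulOpposite.op (Matrix.kroneckerMap (fun x y : ℝ => ((x * y : ℝ) : ℂ))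
    ((k.1.1⁻¹ : Sp N) : Mat N) ((k.1.1 : Sp N) : Mat N)ᵀ)
  map_one' := by
    refine MulOpposite.unop_injective ?_
    ext ⟨p, q⟩ ⟨d, c⟩
    by_cases h1 : p = d <;> by_cases h2 : q = c <;> simp [h1, h2]
  map_mul' k k' := by
    refine MulOpposite.unop_injective ?_
    ext ⟨p, q⟩ ⟨d, c⟩
    simp only [MulOpposite.unop_op, MulOpposite.unop_mul, Matrix.mul_apply,
      Matrix.kroneckerMap_apply, Subgroup.coe_mul, Prod.fst_mul, mul_inv_rev, Submonoid.coe_mul,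
      Matrix.transpose_apply, Fintype.sum_prod_type]
    rw [Finset.sum_mul_sum]
    push_cast
    exact Finset.sum_congr rfl fun e _ => Finset.sum_congr rfl fun f _ => by ring

theorem adMat_apply (k : D.ktilde) (p q d c : Fin N ⊕ Fin N) :
    (adMat D k).unop (p, q) (d, c)
      = ((((k.1.1⁻¹ : Sp N) : Mat N) p d * ((k.1.1 : Sp N) : Mat N) c q : ℝ) : ℂ) := rfl

theorem continuous_adMat : Continuous fun k => (adMat D k).unop := by
  refine continuous_matrix fun ⟨p, q⟩ ⟨d, c⟩ => ?_
  simp only [adMat_apply]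
  have h : ∀ i j, Continuous fun k : D.ktilde => (k.1.1 : Mat N) i j :=
    fun i j => (continuous_ktilde_val D).matrix_elem i j
  have h' : Continuous fun k : D.ktilde => ((k.1.1⁻¹ : Sp N) : Mat N) p d :=
    (h p d).comp (continuous_inv (G := D.ktilde))
  exact Complex.continuous_ofReal.comp (h'.mul (h c q))

theorem eval_polyRep_adMat (k : D.ktilde) (T : (Fin N ⊕ Fin N) × (Fin N ⊕ Fin N) → ℂ)
    (q : MvPolynomial ((Fin N ⊕ Fin N) × (Fin N ⊕ Fin N)) ℂ) :
    MvPolynomial.eval T (polyRep (adMat D) k q)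
      = MvPolynomial.eval (fun i => ∑ j, (adMat D k).unop i j * T j) q := by
  rw [polyRep_apply, linSubst, MvPolynomial.aeval_def, MvPolynomial.eval_eval₂]
  have : (MvPolynomial.eval T).comp (algebraMap ℂ
      (MvPolynomial ((Fin N ⊕ Fin N) × (Fin N ⊕ Fin N)) ℂ)) = RingHom.id ℂ := by
    ext; simp
  rw [this, MvPolynomial.eval₂_id]
  simp

end InvariantPolynomials

/-! ### Vanishing of invariant polynomials at nilpotent elements of 𝔭. -/

section InvariantsVanish

variable {N : ℕ} (D : DualPair N)

/-- The real Lie algebra of `K`. -/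
def kPart : Submodule ℝ (Mat N) where
  carrier := {X | X ∈ D.lieG ∧ Xᵀ = -X}
  zero_mem' := ⟨D.lieG.zero_mem, by simp⟩
  add_mem' hx hy := ⟨D.lieG.add_mem hx.1 hy.1, by
    rw [Matrix.transpose_add, hx.2, hy.2, neg_add]⟩
  smul_mem' c _ hx := ⟨D.lieG.smul_mem c hx.1, by rw [Matrix.transpose_smul, hx.2, smul_neg]⟩

/-- The real form of `𝔭`. -/
def pPart : Submodule ℝ (Mat N) where
  carrier := {X | X ∈ D.lieG ∧ Xᵀ = X}
  zero_mem' := ⟨D.lieG.zero_mem, by simp⟩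
  add_mem' hx hy := ⟨D.lieG.add_mem hx.1 hy.1, by rw [Matrix.transpose_add, hx.2, hy.2]⟩
  smul_mem' c _ hx := ⟨D.lieG.smul_mem c hx.1, by rw [Matrix.transpose_smul, hx.2]⟩

theorem commutator_kPart_pPart {X Y : Mat N} (hX : X ∈ kPart D) (hY : Y ∈ pPart D) :
    X * Y - Y * X ∈ pPart D := by
  refine ⟨D.lieG.lie_mem hX.1 hY.1, ?_⟩
  rw [Matrix.transpose_sub, Matrix.transpose_mul, Matrix.transpose_mul, hX.2, hY.2]
  noncomm_ring

theorem commutator_pPart_pPart {X Y : Mat N} (hX : X ∈ pPart D) (hY : Y ∈ pPart D) :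
    X * Y - Y * X ∈ kPart D := by
  refine ⟨D.lieG.lie_mem hX.1 hY.1, ?_⟩
  rw [Matrix.transpose_sub, Matrix.transpose_mul, Matrix.transpose_mul, hX.2, hY.2]
  noncomm_ring

variable {D}

/-- Infinitesimal invariance of invariant polynomials. -/
theorem sum_commutator_mul_pderiv {q : MvPolynomial ((Fin N ⊕ Fin N) × (Fin N ⊕ Fin N)) ℂ}
    (hq : ∀ k, polyRep (adMat D) k q = q) (T : Matrix (Fin N ⊕ Fin N) (Fin N ⊕ Fin N) ℂ)
    {Y : Mat N} (hY : Y ∈ kPart D) :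
    ∑ i : (Fin N ⊕ Fin N) × (Fin N ⊕ Fin N),
      (T * Y.map Complex.ofReal - Y.map Complex.ofReal * T) i.1 i.2
        * MvPolynomial.eval (fun i => T i.1 i.2) (MvPolynomial.pderiv i q) = 0 := by
  -- The function t ↦ q (exp (-tY) T exp (tY)) is constant, and the identity is its derivative at t
  -- = 0.
  obtain ⟨γ, hγ, hγY⟩ := exists_lift_exp D hY.1 hY.2
  have hinv : ∀ t : ℝ, (((γ (Multiplicative.ofAdd t)).1.1⁻¹ : Sp N) : Mat N)
      = NormedSpace.exp ((-t) • Y) := by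
    intro t
    rw [← hγY, ofAdd_neg, map_inv]
    rfl
  have h0 : ∀ i j, NormedSpace.exp ((0 : ℝ) • Y) i j = (1 : Mat N) i j := by
    intro i j
    rw [zero_smul, NormedSpace.exp_zero]
  have hpos : ∀ i j, HasDerivAt (fun t : ℝ => NormedSpace.exp (t • Y) i j) (Y i j) 0 :=
    hasDerivAt_exp_entry Y
  have hneg : ∀ i j, HasDerivAt (fun t : ℝ => NormedSpace.exp ((-t) • Y) i j) (-Y i j) 0 := by
    intro i j
    have h1 : HasDerivAt (fun t : ℝ => NormedSpace.exp (t • Y) i j) (Y i j) (-0) := by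
      rw [neg_zero]
      exact hpos i j
    have h2 := h1.scomp (0 : ℝ) (hasDerivAt_neg (0 : ℝ))
    simpa [Function.comp_def] using! h2
  have hc : ∀ i : (Fin N ⊕ Fin N) × (Fin N ⊕ Fin N), HasDerivAt
      (fun t : ℝ => ∑ j : (Fin N ⊕ Fin N) × (Fin N ⊕ Fin N),
        (adMat D (γ (Multiplicative.ofAdd t))).unop i j * T j.1 j.2)
      ((T * Y.map Complex.ofReal - Y.map Complex.ofReal * T) i.1 i.2) 0 := by
    rintro ⟨p, r⟩
    have h1 : ∀ j : (Fin N ⊕ Fin N) × (Fin N ⊕ Fin N), HasDerivAt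
        (fun t : ℝ => (adMat D (γ (Multiplicative.ofAdd t))).unop (p, r) j * T j.1 j.2)
        (((-Y p j.1 * (1 : Mat N) j.2 r + (1 : Mat N) p j.1 * Y j.2 r : ℝ) : ℂ) * T j.1 j.2) 0 := by
      rintro ⟨d, c⟩
      simp only [adMat_apply, hinv, hγY]
      have h2 := ((hneg p d).mul (hpos c r)).ofReal_comp.mul_const (T d c)
      simpa only [neg_zero, h0, Pi.mul_apply] using! h2
    refine (HasDerivAt.fun_sum fun j _ => h1 j).congr_deriv ?_
    simp only [Fintype.sum_prod_type, Matrix.sub_apply, Matrix.mul_apply, Matrix.map_apply,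
      Matrix.one_apply]
    push_cast
    simp only [add_mul, Finset.sum_add_distrib, mul_ite, ite_mul, mul_one, mul_zero, zero_mul,
      one_mul, Finset.sum_ite_eq', Finset.mem_univ, if_true,
      apply_ite (Complex.ofReal), Complex.ofReal_one, Complex.ofReal_zero, neg_mul,
      Finset.sum_neg_distrib]
    simp [mul_comm, sub_eq_add_neg, add_comm]
  have h := hasDerivAt_eval hc q
  have hγ0 : γ (Multiplicative.ofAdd 0) = 1 := map_one γ
  simp only [hγ0, map_one, MulOpposite.unop_one] at h
  have hT : (fun i => ∑ j : (Fin N ⊕ Fin N) × (Fin N ⊕ Fin N),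
      (1 : Matrix ((Fin N ⊕ Fin N) × (Fin N ⊕ Fin N)) ((Fin N ⊕ Fin N) × (Fin N ⊕ Fin N)) ℂ) i j
        * T j.1 j.2) = fun i => T i.1 i.2 := by
    funext i
    simp [Matrix.one_apply]
  rw [hT] at h
  have hconst : (fun t : ℝ => MvPolynomial.eval
      (fun i => ∑ j : (Fin N ⊕ Fin N) × (Fin N ⊕ Fin N),
        (adMat D (γ (Multiplicative.ofAdd t))).unop i j * T j.1 j.2) q)
      = fun _ => MvPolynomial.eval (fun i => T i.1 i.2) q := by
    funext t
    rw [← eval_polyRep_adMat D (γ (Multiplicative.ofAdd t)) (fun i => T i.1 i.2), hq]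
  rw [hconst] at h
  exact h.unique (hasDerivAt_const _ _)

/-- Invariant polynomials without constant term vanish at the nilpotent elements of `𝔭`. -/
theorem eval_eq_zero_of_isNilpotent (hT : ∀ X ∈ D.lieG, Xᵀ ∈ D.lieG) {d : ℕ}
    {q : MvPolynomial ((Fin N ⊕ Fin N) × (Fin N ⊕ Fin N)) ℂ}
    (hd : q ∈ MvPolynomial.homogeneousSubmodule _ ℂ (d + 1))
    (hq : ∀ k, polyRep (adMat D) k q = q) {T : Matrix (Fin N ⊕ Fin N) (Fin N ⊕ Fin N) ℂ}
    (hTp : T ∈ complexify (pPart D)) (hn : IsNilpotent T) :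
    MvPolynomial.eval (fun i => T i.1 i.2) q = 0 := by
  obtain ⟨h, hh, hhT⟩ := exists_commutator_eq_self
    (𝔨 := complexify (kPart D)) (𝔭 := complexify (pPart D))
    (fun X hX => conjTranspose_mem_complexify (S := kPart D)
      (fun Y hY => ⟨hT Y hY.1, by rw [hY.2, Matrix.transpose_neg, hY.2]⟩) hX)
    (fun X hX => conjTranspose_mem_complexify (S := pPart D)
      (fun Y hY => ⟨hT Y hY.1, by rw [hY.2, hY.2]⟩) hX)
    (fun X hX Y hY => commutator_mem_complexify
      (fun X hX Y hY => commutator_kPart_pPart D hX hY) hX hY)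
    (fun X hX Y hY => commutator_mem_complexify
      (fun X hX Y hY => commutator_pPart_pPart D hX hY) hX hY) hTp hn
  -- The real and imaginary parts of h lie in 𝔨, and the two infinitesimal invariances combine by
  -- complex linearity. As T = [h, T], the derivative of q at T in the direction T vanishes.
  have h1 := sum_commutator_mul_pderiv hq T hh.1
  have h2 := sum_commutator_mul_pderiv hq T hh.2
  have h3 : ∑ i : (Fin N ⊕ Fin N) × (Fin N ⊕ Fin N), T i.1 i.2
      * MvPolynomial.eval (fun i => T i.1 i.2) (MvPolynomial.pderiv i q) = 0 := by
    have e : T = -((T * (h.map Complex.re).map Complex.ofReal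
        - (h.map Complex.re).map Complex.ofReal * T)
        + Complex.I • (T * (h.map Complex.im).map Complex.ofReal
          - (h.map Complex.im).map Complex.ofReal * T)) := by
      conv_lhs => rw [← hhT, re_add_im h]
      simp only [add_mul, mul_add, smul_mul_assoc, mul_smul_comm, smul_sub]
      abel
    have e' : ∀ i : (Fin N ⊕ Fin N) × (Fin N ⊕ Fin N), T i.1 i.2
      = -((T * (h.map Complex.re).map Complex.ofReal
        - (h.map Complex.re).map Complex.ofReal * T) i.1 i.2
        + Complex.I * (T * (h.map Complex.im).map Complex.ofReal
          - (h.map Complex.im).map Complex.ofReal * T) i.1 i.2) := fun i =>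
      congrFun (congrFun e i.1) i.2
    rw [Finset.sum_congr rfl fun i _ => congrArg (· * MvPolynomial.eval (fun i => T i.1 i.2)
      (MvPolynomial.pderiv i q)) (e' i)]
    simp only [neg_mul, add_mul, Finset.sum_neg_distrib, Finset.sum_add_distrib, mul_assoc,
      ← Finset.mul_sum, h1, h2, mul_zero, add_zero, neg_zero]
  -- By Euler's identity this derivative is (d + 1) q(T).
  have h4 := congrArg (MvPolynomial.eval fun i => T i.1 i.2)
    (MvPolynomial.IsHomogeneous.sum_X_mul_pderiv hd)
  simp only [map_sum, map_mul, MvPolynomial.eval_X, map_nsmul, h3] at h4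
  have h5 := h4.symm
  rw [nsmul_eq_mul, mul_eq_zero] at h5
  exact h5.resolve_left (Nat.cast_ne_zero.2 (Nat.succ_ne_zero d))

end InvariantsVanish

/-! ### Projection onto the Lie algebra along its orthogonal complement for the trace form -/

section Projection

variable {N : ℕ} {D : DualPair N}

/-- The transpose Xᵀ is an admissible Y, and tr (X Xᵀ) is the sum of the squares of the entries. -/
theorem eq_zero_of_trace_mul (hT : ∀ X ∈ D.lieG, Xᵀ ∈ D.lieG) {X : Mat N} (hX : X ∈ D.lieG)
    (h : ∀ Y ∈ D.lieG, (X * Y).trace = 0) : X = 0 := by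
  have h1 := h _ (hT X hX)
  rw [← Matrix.conjTranspose_eq_transpose_of_trivial] at h1
  exact Matrix.trace_mul_conjTranspose_self_eq_zero_iff.1 h1

/-- The linear form `Y ↦ tr (X Y)` on the Lie algebra. -/
def traceForm (D : DualPair N) : Mat N →ₗ[ℝ] Module.Dual ℝ D.lieG :=
  LinearMap.mk₂ ℝ (fun X (Y : D.lieG) => (X * (Y : Mat N)).trace)
    (fun _ _ _ => by simp [add_mul]) (fun _ _ _ => by simp)
    (fun _ _ _ => by simp [mul_add]) (fun _ _ _ => by simp)

instance : FiniteDimensional ℝ D.lieG :=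
  inferInstanceAs (FiniteDimensional ℝ D.lieG.toSubmodule)

theorem traceForm_bijective (hT : ∀ X ∈ D.lieG, Xᵀ ∈ D.lieG) :
    Function.Bijective ((traceForm D).comp (D.lieG.toSubmodule.subtype : D.lieG →ₗ[ℝ] Mat N)) := by
  have hinj : Function.Injective
      ((traceForm D).comp (D.lieG.toSubmodule.subtype : D.lieG →ₗ[ℝ] Mat N)) := by
    rw [← LinearMap.ker_eq_bot, LinearMap.ker_eq_bot']
    intro X hX
    exact Subtype.ext (eq_zero_of_trace_mul hT X.2 fun Y hY => LinearMap.congr_fun hX ⟨Y, hY⟩)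
  exact ⟨hinj, (LinearMap.injective_iff_surjective_of_finrank_eq_finrank
    Subspace.dual_finrank_eq.symm).1 hinj⟩

/-- The projection onto the Lie algebra along its orthogonal complement for the trace form. -/
def projG (hT : ∀ X ∈ D.lieG, Xᵀ ∈ D.lieG) : Mat N →ₗ[ℝ] D.lieG :=
  (LinearEquiv.ofBijective _ (traceForm_bijective hT)).symm.toLinearMap.comp (traceForm D)

variable (hT : ∀ X ∈ D.lieG, Xᵀ ∈ D.lieG)

theorem trace_projG_mul (X : Mat N) {Y : Mat N} (hY : Y ∈ D.lieG) :
    ((projG hT X : Mat N) * Y).trace = (X * Y).trace :=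
  LinearMap.congr_fun ((LinearEquiv.ofBijective _ (traceForm_bijective hT)).apply_symm_apply
    (traceForm D X)) ⟨Y, hY⟩

theorem projG_eq {X : Mat N} {Z : D.lieG}
    (h : ∀ Y ∈ D.lieG, (X * Y).trace = ((Z : Mat N) * Y).trace) : projG hT X = Z := by
  have h1 : traceForm D X = (LinearEquiv.ofBijective _ (traceForm_bijective hT)) Z :=
    LinearMap.ext fun Y => h Y Y.2
  change (LinearEquiv.ofBijective _ (traceForm_bijective hT)).symm (traceForm D X) = Z
  rw [h1, LinearEquiv.symm_apply_apply]

theorem projG_coe (X : D.lieG) : projG hT X = X := projG_eq hT fun _ _ => rfl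

theorem projG_transpose (X : Mat N) : (projG hT Xᵀ : Mat N) = (projG hT X : Mat N)ᵀ := by
  have h : projG hT Xᵀ = ⟨(projG hT X : Mat N)ᵀ, hT _ (projG hT X).2⟩ := by
    refine projG_eq hT fun Y hY => ?_
    have h1 := trace_projG_mul hT X (hT Y hY)
    rw [← Matrix.trace_transpose, ← Matrix.trace_transpose (X * Yᵀ), Matrix.transpose_mul,
      Matrix.transpose_mul, Matrix.transpose_transpose, Matrix.trace_mul_comm,
      Matrix.trace_mul_comm Y] at h1
    exact h1.symm
  rw [h]

/-- Conjugation by K̃ preserves both the trace form and the Lie algebra, hence commutes with the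
orthogonal projection. `projG_commutator` is the infinitesimal version. -/
theorem projG_conj (k : D.ktilde) (X : Mat N) :
    projG hT ((k.1.1 : Mat N) * X * ((k.1.1⁻¹ : Sp N) : Mat N)) = D.Ad k (projG hT X) := by
  refine projG_eq hT fun Y hY => ?_
  have h1 := trace_projG_mul hT X (D.Ad k⁻¹ ⟨Y, hY⟩).2
  have e : ∀ Z : Mat N, ((k.1.1 : Mat N) * Z * ((k.1.1⁻¹ : Sp N) : Mat N) * Y).trace
      = (Z * (D.Ad k⁻¹ ⟨Y, hY⟩ : Mat N)).trace := by
    intro Z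
    have h2 : ((D.Ad k⁻¹ ⟨Y, hY⟩ : D.lieG) : Mat N)
        = ((k.1.1⁻¹ : Sp N) : Mat N) * Y * (k.1.1 : Mat N) := by
      change ((k.1.1⁻¹ : Sp N) : Mat N) * Y * ((k.1.1⁻¹⁻¹ : Sp N) : Mat N) = _
      rw [inv_inv]
    rw [h2, Matrix.mul_assoc, Matrix.mul_assoc, Matrix.trace_mul_comm]
    simp only [Matrix.mul_assoc]
  rw [e, ← h1]
  exact (e _).symm

theorem projG_commutator (Y : D.lieG) (X : Mat N) :
    projG hT ((Y : Mat N) * X - X * (Y : Mat N)) = ⁅Y, projG hT X⁆ := by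
  refine projG_eq hT fun Z hZ => ?_
  have e : ∀ M : Mat N, (((Y : Mat N) * M - M * (Y : Mat N)) * Z).trace
      = (M * (Z * (Y : Mat N) - (Y : Mat N) * Z)).trace := by
    intro M
    rw [sub_mul, mul_sub, Matrix.trace_sub, Matrix.trace_sub, Matrix.mul_assoc,
      Matrix.trace_mul_comm, Matrix.mul_assoc, Matrix.mul_assoc]
  rw [e]
  exact (trace_projG_mul hT X (D.lieG.lie_mem hZ Y.2)).symm.trans (e _).symm

end Projection

/-! ### The matrix Ω of operators and its equivariance. -/

section Omega

variable {N : ℕ} {D : DualPair N} {U : Type*} [AddCommGroup U] [Module ℂ U]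

/-- The matrix of operators by which the projections of the matrix units act. -/
def omega (hT : ∀ X ∈ D.lieG, Xᵀ ∈ D.lieG) (a : GKAct D U)
    (i : (Fin N ⊕ Fin N) × (Fin N ⊕ Fin N)) : Module.End ℂ U :=
  a.lie (projG hT (Matrix.single i.2 i.1 1))

variable (hT : ∀ X ∈ D.lieG, Xᵀ ∈ D.lieG) (a : GKAct D U)

theorem GKAct.lie_smul (c : ℝ) (X : D.lieG) : a.lie (c • X) = (c : ℂ) • a.lie X :=
  LinearMap.ext fun v => a.lie_smul_apply c X v

/-- The right-hand side is tr (C Ω); the exchanged indices in the definition of Ω are chosen for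
this. -/
theorem lie_projG (C : Mat N) : a.lie (projG hT C)
    = ∑ i : (Fin N ⊕ Fin N) × (Fin N ⊕ Fin N), (C i.2 i.1 : ℂ) • omega hT a i := by
  conv_lhs => rw [Matrix.matrix_eq_sum_single C]
  rw [Fintype.sum_prod_type, Finset.sum_comm, map_sum, map_sum]
  refine Finset.sum_congr rfl fun i _ => ?_
  rw [map_sum, map_sum]
  refine Finset.sum_congr rfl fun j _ => ?_
  have e : Matrix.single j i (C j i) = C j i • Matrix.single j i (1 : ℝ) := by
    rw [Matrix.smul_single, smul_eq_mul, mul_one]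
  rw [e, map_smul, a.lie_smul]
  rfl

theorem lie_mem_span_omega (X : D.lieG) :
    a.lie X ∈ Submodule.span ℂ (Set.range (omega hT a)) := by
  rw [← projG_coe hT X, lie_projG]
  exact Submodule.sum_mem _ fun i _ => Submodule.smul_mem _ _ (Submodule.subset_span ⟨i, rfl⟩)

/-- This comes from equivariance of the projection. In matrix notation the right-hand side is ΩY -
YΩ, so the matrix a(Y)·1 + Y commutes with Ω. -/
theorem lie_mul_omega_sub (Y : D.lieG) (p q : Fin N ⊕ Fin N) :
    a.lie Y * omega hT a (p, q) - omega hT a (p, q) * a.lie Y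
      = ∑ c, ((Y : Mat N) c q : ℂ) • omega hT a (p, c)
        - ∑ d, ((Y : Mat N) p d : ℂ) • omega hT a (d, q) := by
  rw [← LieRing.of_associative_ring_bracket, omega, ← LieHom.map_lie, ← projG_commutator,
    lie_projG, Fintype.sum_prod_type]
  simp only [Matrix.sub_apply, Complex.ofReal_sub, sub_smul, Finset.sum_sub_distrib]
  congr 1
  · rw [Finset.sum_eq_single p]
    · simp
    · intro d _ hd
      exact Finset.sum_eq_zero fun c _ => by simp [Matrix.mul_single_apply_of_ne _ _ _ _ _ hd]
    · simp
  · refine Finset.sum_congr rfl fun d _ => ?_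
    rw [Finset.sum_eq_single q]
    · simp
    · intro c _ hc
      simp [Matrix.single_mul_apply_of_ne _ _ _ _ _ hc]
    · simp

theorem grp_omega (heq : ∀ (k : D.ktilde) (X : D.lieG) (v : U),
      a.grp k (a.lie X v) = a.lie (D.Ad k X) (a.grp k v)) (k : D.ktilde)
    (i : (Fin N ⊕ Fin N) × (Fin N ⊕ Fin N)) (u : U) :
    a.grp k (omega hT a i u) = ∑ j, (adMat D k).unop i j • omega hT a j (a.grp k u) := by
  obtain ⟨p, q⟩ := i
  rw [omega, heq, ← projG_conj, lie_projG, LinearMap.sum_apply]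
  refine Finset.sum_congr rfl fun j _ => ?_
  obtain ⟨d, c⟩ := j
  rw [LinearMap.smul_apply, adMat_apply]
  congr 2
  rw [Matrix.mul_apply, Finset.sum_eq_single p]
  · simp [mul_comm]
  · intro e _ he
    simp [Matrix.mul_single_apply_of_ne _ _ _ _ _ he]
  · simp

theorem omega_isWordRep (hlfc : IsLFC a.grp) (heq : ∀ (k : D.ktilde) (X : D.lieG) (v : U),
      a.grp k (a.lie X v) = a.lie (D.Ad k X) (a.grp k v)) {H : Submodule ℂ U}
    (hH : ∀ k, ∀ v ∈ H, a.grp k v ∈ H) : IsWordRep (omega hT a) H (adMat D) a.grp where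
  comm i j := by
    rw [← LieRing.of_associative_ring_bracket, omega, omega, ← LieHom.map_lie]
    exact lie_mem_span_omega hT a _
  cont := continuous_adMat D
  lfc := hlfc
  equivariant := grp_omega hT a heq
  stable := hH

/-! ### Casimir operators -/

/-- Real scalars as operators. -/
def realScalar (U : Type*) [AddCommGroup U] [Module ℂ U] : ℝ →+* Module.End ℂ U :=
  (algebraMap ℂ (Module.End ℂ U)).comp Complex.ofRealHom

theorem realScalar_apply (c : ℝ) : realScalar U c = (c : ℂ) • 1 :=
  Algebra.algebraMap_eq_smul_one _

theorem realScalar_mul (c : ℝ) (x : Module.End ℂ U) : realScalar U c * x = (c : ℂ) • x := by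
  rw [realScalar_apply, smul_mul_assoc, one_mul]

theorem mul_realScalar (c : ℝ) (x : Module.End ℂ U) : x * realScalar U c = (c : ℂ) • x := by
  rw [realScalar_apply, mul_smul_comm, mul_one]

theorem trace_mapMatrix_mul_comm {I : Type*} [Fintype I] [DecidableEq I] (C : Matrix I I ℝ)
    (M : Matrix I I (Module.End ℂ U)) :
    ((realScalar U).mapMatrix C * M).trace = (M * (realScalar U).mapMatrix C).trace := by
  simp only [Matrix.trace, Matrix.diag, Matrix.mul_apply, RingHom.mapMatrix_apply,
    Matrix.map_apply, realScalar_mul, mul_realScalar]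
  exact Finset.sum_comm

/-- The operators `Ω_{pq}` as a matrix. -/
def omegaMat : Matrix (Fin N ⊕ Fin N) (Fin N ⊕ Fin N) (Module.End ℂ U) :=
  Matrix.of fun p q => omega hT a (p, q)

theorem trace_scalar_mul {I : Type*} [Fintype I] [DecidableEq I] {A : Type*} [Ring A] (x : A)
    (M : Matrix I I A) : (Matrix.scalar I x * M).trace = x * M.trace := by
  simp [Matrix.trace, Finset.mul_sum]

theorem trace_mul_scalar {I : Type*} [Fintype I] [DecidableEq I] {A : Type*} [Ring A] (x : A)
    (M : Matrix I I A) : (M * Matrix.scalar I x).trace = M.trace * x := by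
  simp [Matrix.trace, Finset.sum_mul]

/-- Since a(Y)·1 + Y commutes with Ω, it commutes with Ω^m. On taking traces the contribution of Y
cancels, because tr (Y M) = tr (M Y) when Y has numerical entries. -/
theorem casimir_comm_lie (m : ℕ) (Y : D.lieG) :
    (omegaMat hT a ^ m).trace * a.lie Y = a.lie Y * (omegaMat hT a ^ m).trace := by
  have h : Commute (Matrix.scalar (Fin N ⊕ Fin N) (a.lie Y)
      + (realScalar U).mapMatrix (Y : Mat N)) (omegaMat hT a) := by
    change _ * _ = _ * _
    refine Matrix.ext fun p q => ?_
    have h1 := lie_mul_omega_sub hT a Y p q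
    rw [sub_eq_sub_iff_add_eq_add] at h1
    simp only [add_mul, mul_add, Matrix.add_apply, Matrix.scalar_apply, Matrix.diagonal_mul,
      Matrix.mul_diagonal]
    simp only [omegaMat, Matrix.of_apply, Matrix.mul_apply, RingHom.mapMatrix_apply,
      Matrix.map_apply, realScalar_mul, mul_realScalar]
    rw [h1, add_comm]
  have h2 : _ * _ = _ * _ := h.pow_right m
  rw [add_mul, mul_add] at h2
  have h3 := congrArg Matrix.trace h2
  rw [Matrix.trace_add, Matrix.trace_add, trace_mapMatrix_mul_comm, trace_scalar_mul,
    trace_mul_scalar] at h3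
  exact (add_right_cancel h3).symm

/-- Moving a(k) past Ω conjugates Ω by the numerical matrix of k, so the product of that matrix with
a(k) commutes with Ω and its powers. The trace does not see conjugation by a numerical matrix. -/
theorem casimir_comm_grp (heq : ∀ (k : D.ktilde) (X : D.lieG) (v : U),
      a.grp k (a.lie X v) = a.lie (D.Ad k X) (a.grp k v)) (m : ℕ) (k : D.ktilde) :
    (omegaMat hT a ^ m).trace * a.grp k = a.grp k * (omegaMat hT a ^ m).trace := by
  set L := (realScalar U).mapMatrix (k.1.1 : Mat N)
  set L' := (realScalar U).mapMatrix ((k.1.1⁻¹ : Sp N) : Mat N)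
  set S := Matrix.scalar (Fin N ⊕ Fin N) (a.grp k)
  have hLL' : L * L' = 1 := by
    rw [← map_mul, ← Submonoid.coe_mul, mul_inv_cancel, Submonoid.coe_one, map_one]
  have hL'L : L' * L = 1 := by
    rw [← map_mul, ← Submonoid.coe_mul, inv_mul_cancel, Submonoid.coe_one, map_one]
  have h0 : S * omegaMat hT a = L' * omegaMat hT a * L * S := by
    refine Matrix.ext fun p q => LinearMap.ext fun u => ?_
    have h1 := grp_omega hT a heq k (p, q) u
    simp only [S, L, L', Matrix.scalar_apply, Matrix.diagonal_mul, Matrix.mul_diagonal]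
    simp only [omegaMat, Matrix.of_apply, Matrix.mul_apply, RingHom.mapMatrix_apply,
      Matrix.map_apply, realScalar_mul, mul_realScalar]
    rw [Module.End.mul_apply, h1, Fintype.sum_prod_type, Finset.sum_comm]
    simp only [adMat_apply, Module.End.mul_apply, LinearMap.sum_apply, LinearMap.smul_apply,
      Finset.smul_sum, smul_smul, Complex.ofReal_mul]
    exact Finset.sum_congr rfl fun c _ => Finset.sum_congr rfl fun d _ => by rw [mul_comm]
  have h : Commute (L * S) (omegaMat hT a) := by
    change _ * _ = _ * _
    rw [mul_assoc, h0, ← mul_assoc, ← mul_assoc, ← mul_assoc, hLL', one_mul, mul_assoc]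
  have h2 : _ * _ = _ * _ := h.pow_right m
  have h3 : S * omegaMat hT a ^ m = L' * (omegaMat hT a ^ m * L) * S := by
    rw [mul_assoc, mul_assoc, ← h2, ← mul_assoc, ← mul_assoc, hL'L, one_mul]
  have h4 := congrArg Matrix.trace h3
  rw [trace_scalar_mul, trace_mul_scalar, trace_mapMatrix_mul_comm, mul_assoc, hLL', mul_one] at h4
  exact h4.symm

end Omega

/-! ### Schur's lemma in countable dimension -/

section Resolvent

variable {V : Type*} [AddCommGroup V] [Module ℂ V] {T : Module.End ℂ V}

/-- Over ℂ a nonzero polynomial is a nonzero constant times a product of factors X - c. -/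
theorem aeval_injective (hT : ∀ c : ℂ, Function.Injective (T - c • (1 : Module.End ℂ V)))
    {p : Polynomial ℂ} (hp : p ≠ 0) : Function.Injective (Polynomial.aeval T p) := by
  have hs := (IsAlgClosed.splits p).eq_prod_roots
  have h : ∀ s : Multiset ℂ, Function.Injective
      (Polynomial.aeval T (s.map fun c => Polynomial.X - Polynomial.C c).prod) := by
    intro s
    induction s using Multiset.induction_on with
    | empty =>
      rw [Multiset.map_zero, Multiset.prod_zero, map_one]
      exact Function.injective_id
    | cons c s ih =>
      rw [Multiset.map_cons, Multiset.prod_cons, map_mul]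
      have e : Polynomial.aeval T (Polynomial.X - Polynomial.C c)
          = T - c • (1 : Module.End ℂ V) := by
        simp [Algebra.algebraMap_eq_smul_one]
      rw [e]
      exact (hT c).comp ih
  rw [hs, map_mul, Polynomial.aeval_C]
  exact Function.Injective.comp (g := fun v : V => p.leadingCoeff • v)
    (smul_right_injective V (Polynomial.leadingCoeff_ne_zero.2 hp)) (h p.roots)

/-- The vectors `(T - c)⁻¹ v` are linearly independent. -/
theorem linearIndependent_resolvent
    (hT : ∀ c : ℂ, Function.Injective (T - c • (1 : Module.End ℂ V)))
    {v : V} (hv : v ≠ 0) {R : ℂ → V} (hR : ∀ c, (T - c • (1 : Module.End ℂ V)) (R c) = v) :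
    LinearIndependent ℂ R := by
  classical
  rw [linearIndependent_iff']
  intro s g hg i hi
  set p : ℂ → Polynomial ℂ := fun c => ∏ μ ∈ s.erase c, (Polynomial.X - Polynomial.C μ)
  -- Multiplying a relation among the resolvents by the product of all T - μ clears the denominators
  -- and leaves a polynomial in T that kills v.
  have h1 : ∀ c ∈ s, Polynomial.aeval T (∏ μ ∈ s, (Polynomial.X - Polynomial.C μ)) (R c)
      = Polynomial.aeval T (p c) v := by
    intro c hc
    rw [← Finset.prod_erase_mul s _ hc, map_mul, Module.End.mul_apply]
    congr 1
    rw [← hR c]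
    simp [Algebra.algebraMap_eq_smul_one]
  have h2 : Polynomial.aeval T (∑ c ∈ s, Polynomial.C (g c) * p c) v = 0 := by
    have h3 := congrArg (Polynomial.aeval T (∏ μ ∈ s, (Polynomial.X - Polynomial.C μ))) hg
    rw [map_zero, map_sum] at h3
    rw [map_sum, LinearMap.sum_apply, ← h3]
    refine Finset.sum_congr rfl fun c hc => ?_
    rw [map_smul, h1 c hc, map_mul, Polynomial.aeval_C, Algebra.algebraMap_eq_smul_one,
      smul_mul_assoc, one_mul, LinearMap.smul_apply]
  have h4 : ∑ c ∈ s, Polynomial.C (g c) * p c = 0 := by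
    by_contra hne
    exact hv (aeval_injective hT hne (h2.trans (map_zero _).symm))
  -- At X = i only the summand of index i survives, as all others contain the factor X - i.
  have h5 := congrArg (Polynomial.eval i) h4
  rw [Polynomial.eval_finsetSum, Finset.sum_eq_single i] at h5
  · simp only [Polynomial.eval_mul, Polynomial.eval_C, Polynomial.eval_zero, mul_eq_zero, p,
      Polynomial.eval_prod, Finset.prod_eq_zero_iff] at h5
    rcases h5 with h5 | ⟨μ, hμ, h5⟩
    · exact h5
    · simp only [Polynomial.eval_sub, Polynomial.eval_X, Polynomial.eval_C, sub_eq_zero] at h5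
      exact absurd h5.symm (Finset.ne_of_mem_erase hμ)
  · intro c _ hc
    rw [Polynomial.eval_mul, Polynomial.eval_prod,
      Finset.prod_eq_zero (Finset.mem_erase.2 ⟨hc.symm, hi⟩) (by simp), mul_zero]
  · exact fun h => absurd hi h

/-- In a space of countable dimension, some `T - c` is not bijective. -/
theorem exists_not_bijective [Nontrivial V] {F : ℕ → Submodule ℂ V}
    (hF : ∀ n, FiniteDimensional ℂ (F n)) (hV : ∀ v, ∃ n, v ∈ F n) (T : Module.End ℂ V) :
    ∃ c : ℂ, ¬ Function.Bijective (T - c • (1 : Module.End ℂ V)) := by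
  by_contra! h
  obtain ⟨v, hv⟩ := exists_ne (0 : V)
  choose R hR using fun c => (h c).2 v
  -- The resolvents applied to v would be independent vectors indexed by ℂ, only finitely many of
  -- them in each F n, and ℂ would be countable.
  have hli := linearIndependent_resolvent (fun c => (h c).1) hv hR
  have hfin : ∀ n, {c : ℂ | R c ∈ F n}.Finite := by
    intro n
    have h1 : LinearIndependent ℂ (fun c : {c : ℂ | R c ∈ F n} => (⟨R c, c.2⟩ : F n)) :=
      LinearIndependent.of_comp (F n).subtype (hli.comp _ Subtype.val_injective)
    have := hF n
    exact Set.finite_coe_iff.1 h1.finite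
  have hcount : (Set.univ : Set ℂ).Countable := by
    have : (Set.univ : Set ℂ) ⊆ ⋃ n, {c : ℂ | R c ∈ F n} := fun c _ =>
      Set.mem_iUnion.2 (hV (R c))
    exact (Set.countable_iUnion fun n => (hfin n).countable).mono this
  exact not_countable_complex hcount

end Resolvent

/-! ### Schur's lemma for irreducible modules. -/

section Schur

variable {N : ℕ} {D : DualPair N} {V : Type*} [AddCommGroup V] [Module ℂ V] {a : GKAct D V}
  (hT : ∀ X ∈ D.lieG, Xᵀ ∈ D.lieG)

/-- A nonzero `K̃`-stable subspace generates an irreducible module. -/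
theorem GKAct.IsIrreducible.exists_mem_wordFilt (hirr : a.IsIrreducible) (ha : a.IsSmooth)
    {E : Submodule ℂ V} (hE : ∀ k, ∀ v ∈ E, a.grp k v ∈ E) (hE0 : E ≠ ⊥) (v : V) :
    ∃ n, v ∈ wordFilt (omega hT a) E n := by
  have hdir : Directed (· ≤ ·) (wordFilt (omega hT a) E) := wordFilt_mono.directed_le
  have hw := omega_isWordRep hT a ha.lfc ha.equivariant hE
  rcases hirr.2 (⨆ n, wordFilt (omega hT a) E n)
    (fun X v hv => by
      obtain ⟨n, hn⟩ := (Submodule.mem_iSup_of_directed _ hdir).1 hv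
      exact Submodule.mem_iSup_of_mem (n + 1)
        (span_apply_mem_wordFilt hn (lie_mem_span_omega hT a X)))
    (fun k v hv => by
      obtain ⟨n, hn⟩ := (Submodule.mem_iSup_of_directed _ hdir).1 hv
      exact Submodule.mem_iSup_of_mem n (hw.apply_mem k hn)) with h | h
  · exact absurd (le_bot_iff.1 (((le_wordFilt_succ 0).trans
      (le_iSup (wordFilt (omega hT a) E) 1)).trans h.le)) hE0
  · have hv : v ∈ ⨆ n, wordFilt (omega hT a) E n := h ▸ Submodule.mem_top
    exact (Submodule.mem_iSup_of_directed _ hdir).1 hv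

theorem GKAct.grp_mem_span_orbit (a : GKAct D V) (v : V) (k : D.ktilde) :
    ∀ w ∈ Submodule.span ℂ (Set.range fun k : D.ktilde => a.grp k v),
      a.grp k w ∈ Submodule.span ℂ (Set.range fun k : D.ktilde => a.grp k v) := by
  intro w hw
  have : Submodule.span ℂ (Set.range fun k : D.ktilde => a.grp k v)
      ≤ (Submodule.span ℂ (Set.range fun k : D.ktilde => a.grp k v)).comap (a.grp k) := by
    rw [Submodule.span_le]
    rintro _ ⟨k', rfl⟩
    refine Submodule.subset_span ⟨k * k', ?_⟩
    change a.grp (k * k') v = a.grp k (a.grp k' v)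
    rw [map_mul]
    rfl
  exact this hw

theorem GKAct.mem_span_orbit (a : GKAct D V) (v : V) :
    v ∈ Submodule.span ℂ (Set.range fun k : D.ktilde => a.grp k v) :=
  Submodule.subset_span ⟨1, by simp⟩

/-- An irreducible module contains a nonzero finite-dimensional `K̃`-stable subspace. -/
theorem GKAct.IsIrreducible.exists_stable (hirr : a.IsIrreducible) (ha : a.IsSmooth) :
    ∃ E : Submodule ℂ V, FiniteDimensional ℂ E ∧ (∀ k, ∀ v ∈ E, a.grp k v ∈ E) ∧ E ≠ ⊥ := by
  have := hirr.1
  obtain ⟨v, hv⟩ := exists_ne (0 : V)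
  exact ⟨_, finiteDimensional_of_mem_finCont (ha.lfc v), a.grp_mem_span_orbit v,
    fun h => hv ((Submodule.eq_bot_iff _).1 h v (a.mem_span_orbit v))⟩

include hT in
/-- Schur's lemma. -/
theorem GKAct.IsIrreducible.exists_eq_smul (hirr : a.IsIrreducible) (ha : a.IsSmooth)
    {T : Module.End ℂ V} (hl : ∀ X v, T (a.lie X v) = a.lie X (T v))
    (hk : ∀ k v, T (a.grp k v) = a.grp k (T v)) : ∃ c : ℂ, T = c • 1 := by
  have := hirr.1
  obtain ⟨E, hEf, hE, hE0⟩ := hirr.exists_stable ha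
  -- V is the union of the finite-dimensional steps of the filtration generated by E, so it has
  -- countable dimension.
  obtain ⟨c, hc⟩ := exists_not_bijective (F := wordFilt (omega hT a) E) (fun n => inferInstance)
    (hirr.exists_mem_wordFilt hT ha hE hE0) T
  refine ⟨c, ?_⟩
  set T' := T - c • (1 : Module.End ℂ V) with hT'
  have hl' : ∀ X v, T' (a.lie X v) = a.lie X (T' v) := by
    intro X v
    simp [hT', hl]
  have hk' : ∀ k v, T' (a.grp k v) = a.grp k (T' v) := by
    intro k v
    simp [hT', hk]
  have h1 := hirr.2 (LinearMap.ker T')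
    (fun X v hv => by rw [LinearMap.mem_ker, hl', LinearMap.mem_ker.1 hv, map_zero])
    (fun k v hv => by rw [LinearMap.mem_ker, hk', LinearMap.mem_ker.1 hv, map_zero])
  have h2 := hirr.2 (LinearMap.range T')
    (fun X v hv => by
      obtain ⟨w, rfl⟩ := hv
      exact ⟨a.lie X w, hl' X w⟩)
    (fun k v hv => by
      obtain ⟨w, rfl⟩ := hv
      exact ⟨a.grp k w, hk' k w⟩)
  have h0 : T' = 0 := by
    rcases h1 with h1 | h1
    · rcases h2 with h2 | h2
      · exact LinearMap.range_eq_bot.1 h2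
      · exact absurd ⟨LinearMap.ker_eq_bot.1 h1, LinearMap.range_eq_top.1 h2⟩ hc
    · exact LinearMap.ker_eq_top.1 h1
  exact sub_eq_zero.1 h0

end Schur

/-! ### Admissibility -/

section Admissible

variable {N : ℕ} {D : DualPair N}

/-- The commutator of y with a letter is again a combination of letters, so moving y through a word
does not lengthen it. Applied to elements of 𝔨, this makes their linear symbols lowering. -/
theorem wordFilt_stable {ι U : Type*} [AddCommGroup U] [Module ℂ U] {x : ι → Module.End ℂ U}
    {H : Submodule ℂ U} {y : Module.End ℂ U} (hH : ∀ u ∈ H, y u ∈ H)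
    (hy : ∀ i, y * x i - x i * y ∈ Submodule.span ℂ (Set.range x)) (n : ℕ) :
    ∀ u ∈ wordFilt x H n, y u ∈ wordFilt x H n := by
  induction n with
  | zero =>
    intro u hu
    rw [wordFilt, Submodule.mem_bot] at hu
    rw [hu, map_zero]
    exact Submodule.zero_mem _
  | succ n ih =>
    intro u hu
    have h : wordFilt x H (n + 1) ≤ (wordFilt x H (n + 1)).comap y := by
      refine wordFilt_succ_le (fun h hh => le_wordFilt_succ n (hH h hh)) fun i u hu => ?_
      rw [Submodule.mem_comap]
      have e : y (x i u) = x i (y u) + (y * x i - x i * y) u := by simp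
      rw [e]
      exact Submodule.add_mem _ (apply_mem_wordFilt (ih u hu) i) (span_apply_mem_wordFilt hu (hy i))
    exact h hu

/-- A matrix orthogonal to all matrices with projection in `𝔨` lies in `𝔭`. -/
theorem mem_pPart_of_trace (hT : ∀ X ∈ D.lieG, Xᵀ ∈ D.lieG) {R : Mat N}
    (h : ∀ C : Mat N, (projG hT C : Mat N)ᵀ = -(projG hT C : Mat N) → (C * R).trace = 0) :
    R ∈ pPart D := by
  set P := lieP hT (projG hT R)
  set K := lieK hT (projG hT R)
  -- Here P and K are the 𝔭- and 𝔨-components of the projection of R, so C projects to K and Cᵀ to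
  -- -K. The hypothesis for Cᵀ, together with tr (K P) = 0, gives tr (Cᵀ C) = 0 and hence R = P.
  set C : Mat N := R - P
  have hPs : (P : Mat N)ᵀ = (P : Mat N) := isP_lieP hT _
  have hKs : (K : Mat N)ᵀ = -(K : Mat N) := transpose_lieK hT _
  have hC : projG hT C = K := by
    rw [map_sub, projG_coe, sub_eq_iff_eq_add', lieP_add_lieK]
  have hCt : (projG hT Cᵀ : Mat N) = -(K : Mat N) := by rw [projG_transpose, hC, hKs]
  have h1 : (Cᵀ * R).trace = 0 := h _ (by rw [hCt, Matrix.transpose_neg, hKs])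
  have h2 : ((K : Mat N) * (P : Mat N)).trace = 0 := by
    have h3 := Matrix.trace_transpose ((K : Mat N) * (P : Mat N))
    rw [Matrix.transpose_mul, hPs, hKs, mul_neg, Matrix.trace_neg, Matrix.trace_mul_comm] at h3
    linarith
  have h3 : (Cᵀ * (P : Mat N)).trace = 0 := by
    rw [← trace_projG_mul hT _ P.2, hCt, neg_mul, Matrix.trace_neg, h2, neg_zero]
  have h4 : (Cᵀ * C).trace = 0 := by
    change (Cᵀ * (R - P)).trace = 0
    rw [mul_sub, Matrix.trace_sub, h1, h3, sub_zero]
  rw [← Matrix.conjTranspose_eq_transpose_of_trivial] at h4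
  have h5 : R - P = 0 := Matrix.trace_conjTranspose_mul_self_eq_zero_iff.1 h4
  rw [sub_eq_zero.1 h5]
  exact ⟨P.2, hPs⟩

variable {U : Type*} [AddCommGroup U] [Module ℂ U]

/-- The Nullstellensatz. -/
theorem mem_radical_of_eval {ι : Type*} [Finite ι] {J : Ideal (MvPolynomial ι ℂ)}
    {q : MvPolynomial ι ℂ}
    (h : ∀ T : ι → ℂ, (∀ c ∈ J, MvPolynomial.eval T c = 0) → MvPolynomial.eval T q = 0) :
    q ∈ J.radical := by
  rw [← MvPolynomial.vanishingIdeal_zeroLocus_eq_radical (K := ℂ),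
    MvPolynomial.mem_vanishingIdeal_iff]
  intro T hT
  rw [MvPolynomial.mem_zeroLocus_iff] at hT
  simp only [MvPolynomial.aeval_eq_eval] at hT ⊢
  exact h T hT

theorem eval_trace_pow {I : Type*} [Fintype I] [DecidableEq I] (M : Matrix I I ℂ) (m : ℕ) :
    MvPolynomial.eval (fun i : I × I => M i.1 i.2)
      ((Matrix.of fun a b => (MvPolynomial.X (a, b) : MvPolynomial (I × I) ℂ)) ^ m).trace
        = (M ^ m).trace := by
  rw [AddMonoidHom.map_trace]
  congr 1
  have h3 := map_pow (MvPolynomial.eval (fun i : I × I => M i.1 i.2)).mapMatrix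
    (Matrix.of fun a b => (MvPolynomial.X (a, b) : MvPolynomial (I × I) ℂ)) m
  refine h3.trans ?_
  congr 1
  ext i j
  simp

theorem mem_complexify_pPart (hT : ∀ X ∈ D.lieG, Xᵀ ∈ D.lieG)
    {M : Matrix (Fin N ⊕ Fin N) (Fin N ⊕ Fin N) ℂ}
    (hM : ∀ C : Mat N, (projG hT C : Mat N)ᵀ = -(projG hT C : Mat N) →
      ∑ i : (Fin N ⊕ Fin N) × (Fin N ⊕ Fin N), (C i.2 i.1 : ℂ) * M i.1 i.2 = 0) :
    M ∈ complexify (pPart D) := by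
  constructor
  · refine mem_pPart_of_trace hT fun C hC => ?_
    have h1 := congrArg Complex.re (hM C hC)
    rw [Complex.re_sum, Fintype.sum_prod_type, Finset.sum_comm] at h1
    simpa [Matrix.trace, Matrix.mul_apply] using h1
  · refine mem_pPart_of_trace hT fun C hC => ?_
    have h1 := congrArg Complex.im (hM C hC)
    rw [Complex.im_sum, Fintype.sum_prod_type, Finset.sum_comm] at h1
    simpa [Matrix.trace, Matrix.mul_apply] using h1

/-- The operator tr (C Ω) is the action of an element of 𝔨, which preserves H and therefore every
step. Matrices C with projection zero are included: these force a common zero of the symbols into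
the complexified Lie algebra, and those from 𝔨 force it into 𝔭. -/
theorem isLowering_projG (hT : ∀ X ∈ D.lieG, Xᵀ ∈ D.lieG) {b : GKAct D U}
    {H : Submodule ℂ U} (hw : IsWordRep (omega hT b) H (adMat D) b.grp)
    (hH : ∀ X : D.lieG, (X : Mat N)ᵀ = -(X : Mat N) → ∀ u ∈ H, b.lie X u ∈ H)
    {C : Mat N} (hC : (projG hT C : Mat N)ᵀ = -(projG hT C : Mat N)) :
    IsLowering (omega hT b) H 1 (∑ i, (C i.2 i.1 : ℂ) • MvPolynomial.X i) := by
  refine isLowering_linear hw.comm (fun i => (C i.2 i.1 : ℂ)) ?_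
  rw [← lie_projG]
  refine wordFilt_stable (hH _ hC) fun i => ?_
  rw [← LieRing.of_associative_ring_bracket, omega, ← LieHom.map_lie]
  exact lie_mem_span_omega hT b _

/-- Invariant polynomials without constant term lie in the radical of the lowering ideal. -/
theorem mem_radical_loweringIdeal (hT : ∀ X ∈ D.lieG, Xᵀ ∈ D.lieG) {b : GKAct D U}
    {H : Submodule ℂ U} (hw : IsWordRep (omega hT b) H (adMat D) b.grp)
    (hH : ∀ X : D.lieG, (X : Mat N)ᵀ = -(X : Mat N) → ∀ u ∈ H, b.lie X u ∈ H)
    (hc : ∀ m, ∃ c : ℂ, (omegaMat hT b ^ (m + 1)).trace = c • 1) {d : ℕ}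
    {q : MvPolynomial ((Fin N ⊕ Fin N) × (Fin N ⊕ Fin N)) ℂ}
    (hd : q ∈ MvPolynomial.homogeneousSubmodule _ ℂ (d + 1))
    (hq : ∀ k, polyRep (adMat D) k q = q) : q ∈ (loweringIdeal (omega hT b) H).radical := by
  -- A common zero of the lowering polynomials is a matrix M. The linear symbols place M in the
  -- complexification of 𝔭, and the Casimir symbols give tr M^(m+1) = 0 for all m, so M is nilpotent
  -- and q vanishes there.
  refine mem_radical_of_eval fun T hTz => ?_
  have hlow : ∀ m c, IsLowering (omega hT b) H m c → MvPolynomial.eval T c = 0 := fun m c hm =>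
    hTz c (Ideal.subset_span ⟨m, hm⟩)
  obtain ⟨M, rfl⟩ : ∃ M : Matrix (Fin N ⊕ Fin N) (Fin N ⊕ Fin N) ℂ, T = fun i => M i.1 i.2 :=
    ⟨Matrix.of fun p q => T (p, q), rfl⟩
  refine eval_eq_zero_of_isNilpotent hT hd hq (mem_complexify_pPart hT fun C hC => ?_)
    (isNilpotent_of_trace_pow fun m => ?_)
  · have h1 := hlow _ _ (isLowering_projG hT hw hH hC)
    simpa only [map_sum, MvPolynomial.smul_eval, MvPolynomial.eval_X] using h1
  · obtain ⟨c, hc⟩ := hc m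
    have h1 := hlow _ _ (isLowering_trace hw.comm m c hc)
    rwa [eval_trace_pow] at h1

/-- The space of invariants of a representation. -/
def invariants {K : Type*} [Group K] (σ : K →* Module.End ℂ U) : Submodule ℂ U where
  carrier := {u | ∀ k, σ k u = u}
  zero_mem' _ := map_zero _
  add_mem' {x y} hx hy k := by rw [map_add, hx k, hy k]
  smul_mem' c {x} hx k := by rw [map_smul, hx k]

variable {V F : Type*} [AddCommGroup V] [Module ℂ V] [AddCommGroup F] [Module ℂ F]

/-- The tensor product of representations of a group. -/
def tensorRep {K : Type*} [Group K] (τ : K →* Module.End ℂ F) (σ : K →* Module.End ℂ V) :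
    K →* Module.End ℂ (F ⊗[ℂ] V) where
  toFun k := TensorProduct.map (τ k) (σ k)
  map_one' := by rw [map_one, map_one]; exact TensorProduct.map_id
  map_mul' k k' := by
    rw [map_mul, map_mul]
    exact TensorProduct.map_comp _ _ _ _

theorem tensorRep_tmul {K : Type*} [Group K] (τ : K →* Module.End ℂ F) (σ : K →* Module.End ℂ V)
    (k : K) (f : F) (v : V) : tensorRep τ σ k (f ⊗ₜ[ℂ] v) = τ k f ⊗ₜ[ℂ] σ k v := rfl

/-- `F ⊗ V` for a representation `F` of `K̃`, the Lie algebra acting through `V`. -/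
def GKAct.twist (τ : D.ktilde →* Module.End ℂ F) (a : GKAct D V) : GKAct D (F ⊗[ℂ] V) where
  lie := (GKAct.onRight F a).lie
  grp := tensorRep τ a.grp

/-- For an irreducible module `V` and a finite-dimensional representation `F` of `K̃`, the
invariants of `K̃` in `F ⊗ V` are finite-dimensional. -/
theorem GKAct.IsIrreducible.finiteDimensional_invariants (hT : ∀ X ∈ D.lieG, Xᵀ ∈ D.lieG)
    {a : GKAct D V} (hirr : a.IsIrreducible) (ha : a.IsSmooth) [FiniteDimensional ℂ F]
    {τ : D.ktilde →* Module.End ℂ F} (hτ : IsLFC τ) :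
    FiniteDimensional ℂ (invariants (tensorRep τ a.grp)) := by
  obtain ⟨E, hEf, hE, hE0⟩ := hirr.exists_stable ha
  -- Here K̃ acts diagonally but the Lie algebra only on V. The derivative of the group action is
  -- not the Lie algebra action in general, but equivariance holds, which is all the word filtration
  -- needs, and operators that are scalar on V remain scalar on F ⊗ V.
  set b := a.twist τ
  have hlfc : IsLFC b.grp := hτ.tensor ha.lfc fun _ _ _ => rfl
  have heq : ∀ (k : D.ktilde) (X : D.lieG) (u : F ⊗[ℂ] V),
      b.grp k (b.lie X u) = b.lie (D.Ad k X) (b.grp k u) := by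
    intro k X u
    induction u with
    | zero => simp
    | add x y hx hy => simp only [map_add, hx, hy]
    | tmul f v =>
      change τ k f ⊗ₜ[ℂ] a.grp k (a.lie X v) = τ k f ⊗ₜ[ℂ] a.lie (D.Ad k X) (a.grp k v)
      rw [ha.equivariant]
  set H := LinearMap.range (E.subtype.lTensor F)
  have hHt : ∀ (f : F), ∀ v ∈ E, f ⊗ₜ[ℂ] v ∈ H := fun f v hv => ⟨f ⊗ₜ[ℂ] ⟨v, hv⟩, rfl⟩
  have hHk : ∀ k, ∀ u ∈ H, b.grp k u ∈ H := by
    rintro k _ ⟨u, rfl⟩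
    induction u with
    | zero => simp
    | add x y hx hy =>
      rw [map_add, map_add]
      exact Submodule.add_mem _ hx hy
    | tmul f v => exact hHt _ _ (hE k v v.2)
  have hHl : ∀ X : D.lieG, (X : Mat N)ᵀ = -(X : Mat N) → ∀ u ∈ H, b.lie X u ∈ H := by
    rintro X hX _ ⟨u, rfl⟩
    induction u with
    | zero => simp
    | add x y hx hy =>
      rw [map_add, map_add]
      exact Submodule.add_mem _ hx hy
    | tmul f v => exact hHt _ _ (ha.lie_mem hX hE v.2)
  have hw := omega_isWordRep hT b hlfc heq hHk
  -- On V the traces of powers of Ω commute with 𝔤 and K̃, so Schur's lemma makes them scalars.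
  have hc : ∀ m, ∃ c : ℂ, (omegaMat hT b ^ (m + 1)).trace = c • 1 := by
    intro m
    obtain ⟨c, hc⟩ := hirr.exists_eq_smul hT ha
      (T := (omegaMat hT a ^ (m + 1)).trace)
      (fun X v => LinearMap.congr_fun (casimir_comm_lie hT a (m + 1) X) v)
      (fun k v => LinearMap.congr_fun (casimir_comm_grp hT a ha.equivariant (m + 1) k) v)
    refine ⟨c, ?_⟩
    have h1 : omegaMat hT b
        = (Module.End.lTensorAlgHom ℂ V F : Module.End ℂ V →+* _).mapMatrix (omegaMat hT a) := rfl
    rw [h1, ← map_pow, RingHom.mapMatrix_apply, ← AddMonoidHom.map_trace, hc]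
    simp
  obtain ⟨n₀, hn₀⟩ := hw.exists_invariants_le
    fun d q hd hq => mem_radical_loweringIdeal hT hw hHl hc hd hq
  have hall : ∀ u : F ⊗[ℂ] V, ∃ n, u ∈ wordFilt (omega hT b) H n := by
    intro u
    induction u with
    | zero => exact ⟨0, Submodule.zero_mem _⟩
    | add x y hx hy =>
      obtain ⟨n, hn⟩ := hx
      obtain ⟨m, hm⟩ := hy
      exact ⟨max n m, Submodule.add_mem _ (wordFilt_mono (le_max_left _ _) hn)
        (wordFilt_mono (le_max_right _ _) hm)⟩
    | tmul f v =>
      obtain ⟨n, hn⟩ := hirr.exists_mem_wordFilt hT ha hE hE0 v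
      refine ⟨n, ?_⟩
      induction n generalizing v with
      | zero =>
        rw [wordFilt, Submodule.mem_bot] at hn
        rw [hn, TensorProduct.tmul_zero]
        exact Submodule.zero_mem _
      | succ n ih =>
        have h : wordFilt (omega hT a) E (n + 1)
            ≤ (wordFilt (omega hT b) H (n + 1)).comap (TensorProduct.mk ℂ F V f) :=
          wordFilt_succ_le (fun v hv => le_wordFilt_succ n (hHt f v hv))
            fun i v hv => apply_mem_wordFilt (ih v hv) i
        exact h hn
  refine Submodule.finiteDimensional_of_le (S₂ := wordFilt (omega hT b) H n₀) fun u hu => ?_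
  obtain ⟨n, hn⟩ := hall u
  exact hn₀ n u hn hu

end Admissible

/-! ### Duality -/

section Representations

variable {K : Type*} [Group K] {V M : Type*} [AddCommGroup V] [Module ℂ V] [AddCommGroup M]
  [Module ℂ M]

/-- The restriction of a representation to a stable subspace. -/
def restrictRep (σ : K →* Module.End ℂ V) (H : Submodule ℂ V) (hH : ∀ k, ∀ v ∈ H, σ k v ∈ H) :
    K →* Module.End ℂ H where
  toFun k := (σ k).restrict (hH k)
  map_one' := LinearMap.ext fun v => Subtype.ext (by simp [LinearMap.restrict_apply])
  map_mul' k k' := LinearMap.ext fun v => Subtype.ext (by simp [LinearMap.restrict_apply])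

/-- The dual representation. -/
def dualRep (μ : K →* Module.End ℂ M) : K →* Module.End ℂ (Module.Dual ℂ M) where
  toFun k := (μ k⁻¹).dualMap
  map_one' := LinearMap.ext fun f => LinearMap.ext fun m => by simp
  map_mul' k k' := LinearMap.ext fun f => LinearMap.ext fun m => by simp

theorem dualRep_apply (μ : K →* Module.End ℂ M) (k : K) (f : Module.Dual ℂ M) (m : M) :
    dualRep μ k f m = f (μ k⁻¹ m) := rfl

theorem rep_inv_apply (σ : K →* Module.End ℂ V) (k : K) (v : V) : σ k⁻¹ (σ k v) = v := by
  rw [← Module.End.mul_apply, ← map_mul, inv_mul_cancel, map_one, Module.End.one_apply]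

theorem rep_apply_inv (σ : K →* Module.End ℂ V) (k : K) (v : V) : σ k (σ k⁻¹ v) = v := by
  rw [← Module.End.mul_apply, ← map_mul, mul_inv_cancel, map_one, Module.End.one_apply]

/-- The identity in `M^* ⊗ M`. -/
theorem exists_invariant_tensor [FiniteDimensional ℂ M] [Nontrivial M] (μ : K →* Module.End ℂ M) :
    ∃ u : Module.Dual ℂ M ⊗[ℂ] M, u ≠ 0 ∧ ∀ k, tensorRep (dualRep μ) μ k u = u := by
  have hinj : Function.Injective (dualTensorHom ℂ M M) := by
    have h : (dualTensorHomEquiv ℂ M M).toLinearMap = dualTensorHom ℂ M M := by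
      ext
      simp
    rw [← h]
    exact (dualTensorHomEquiv ℂ M M).injective
  have hsurj : Function.Surjective (dualTensorHom ℂ M M) := by
    have h : (dualTensorHomEquiv ℂ M M).toLinearMap = dualTensorHom ℂ M M := by
      ext
      simp
    rw [← h]
    exact (dualTensorHomEquiv ℂ M M).surjective
  obtain ⟨u, hu⟩ := hsurj 1
  have hk : ∀ (k : K) (t : Module.Dual ℂ M ⊗[ℂ] M), dualTensorHom ℂ M M
      (tensorRep (dualRep μ) μ k t) = μ k * dualTensorHom ℂ M M t * μ k⁻¹ := by
    intro k t
    induction t with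
    | zero => simp
    | add x y hx hy => simp only [map_add, hx, hy, mul_add, add_mul]
    | tmul f m =>
      refine LinearMap.ext fun v => ?_
      simp [tensorRep_tmul, dualRep_apply]
  refine ⟨u, ?_, fun k => hinj ?_⟩
  · rintro rfl
    rw [map_zero] at hu
    exact zero_ne_one hu
  · rw [hk, hu, mul_one, ← map_mul, mul_inv_cancel, map_one]

variable [TopologicalSpace K]

theorem restrictRep_isLFC {σ : K →* Module.End ℂ V} (hσ : IsLFC σ) (H : Submodule ℂ V)
    [FiniteDimensional ℂ H] (hH : ∀ k, ∀ v ∈ H, σ k v ∈ H) : IsLFC (restrictRep σ H hH) := by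
  intro h
  exact mem_finCont_of_separating (fun l : Module.Dual ℂ V => l.comp H.subtype) ⊤
    (fun v _ hv => Subtype.ext ((Module.forall_dual_apply_eq_zero_iff ℂ (v : V)).1 hv))
    (fun _ => trivial) fun l => hσ.continuous h l

variable [IsTopologicalGroup K]

theorem dualRep_isLFC [FiniteDimensional ℂ M] {μ : K →* Module.End ℂ M} (hμ : IsLFC μ) :
    IsLFC (dualRep μ) := fun f =>
  mem_finCont_of_separating (fun m : M => Module.Dual.eval ℂ M m) ⊤
    (fun _ _ hf => LinearMap.ext hf) (fun _ => trivial)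
    fun m => (hμ.continuous m f).comp continuous_inv

/-- Invariant functionals are not changed by averaging. -/
theorem dual_average_of_invariant [CompactSpace K] {σ : K →* Module.End ℂ V} (hσ : IsLFC σ)
    {l : Module.Dual ℂ V} (hl : ∀ k v, l (σ k v) = l v) (v : V) : l (average σ hσ v) = l v := by
  rw [dual_average]
  simp only [hl]
  exact haarMean_const _

end Representations

/-! ### K̃-finite functionals and invariant pairings. -/

section Duality

variable {N : ℕ} {D : DualPair N} {V : Type*} [AddCommGroup V] [Module ℂ V] {a : GKAct D V}

/-- An irreducible module has a nonzero `K̃`-finite functional. -/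
theorem GKAct.IsIrreducible.exists_dual_ne_zero (hirr : a.IsIrreducible) (ha : a.IsSmooth) :
    ∃ l : a.DualSpace, l ≠ 0 := by
  obtain ⟨E, hEf, hE, hE0⟩ := hirr.exists_stable ha
  set μ := restrictRep a.grp E hE
  have hμ : IsLFC μ := restrictRep_isLFC ha.lfc E hE
  have : Nontrivial E := Submodule.nontrivial_iff_ne_bot.2 hE0
  -- The invariant u in E* ⊗ E stays nonzero in E* ⊗ V. A functional nonzero on it, averaged over
  -- K̃, is an equivariant map from the finite-dimensional E* to functionals on V, whose values are
  -- therefore K̃-finite.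
  obtain ⟨u, hu0, hu⟩ := exists_invariant_tensor μ
  set ι := E.subtype.lTensor (Module.Dual ℂ E)
  have hιk : ∀ k t, tensorRep (dualRep μ) a.grp k (ι t) = ι (tensorRep (dualRep μ) μ k t) := by
    intro k t
    induction t with
    | zero => simp
    | add x y hx hy => simp only [map_add, hx, hy]
    | tmul f m => rfl
  have hι0 : ι u ≠ 0 := fun h => hu0 (Module.Flat.lTensor_preserves_injective_linearMap
    (M := Module.Dual ℂ E) E.subtype E.injective_subtype (h.trans (map_zero _).symm))
  have hlfc : IsLFC (tensorRep (dualRep μ) a.grp) :=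
    (dualRep_isLFC hμ).tensor ha.lfc fun _ _ _ => rfl
  obtain ⟨Λ₀, hΛ₀⟩ : ∃ Λ₀ : Module.Dual ℂ (Module.Dual ℂ E ⊗[ℂ] V), Λ₀ (ι u) ≠ 0 := by
    by_contra! h
    exact hι0 ((Module.forall_dual_apply_eq_zero_iff ℂ _).1 h)
  set Λ := Λ₀.comp (average _ hlfc)
  have hΛ : ∀ k t, Λ (tensorRep (dualRep μ) a.grp k t) = Λ t := fun k t =>
    congrArg Λ₀ (average_apply hlfc k t)
  have hΛu : Λ (ι u) ≠ 0 := by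
    have h1 : average _ hlfc (ι u) = ι u :=
      average_of_invariant hlfc fun k => by rw [hιk, hu]
    change Λ₀ (average _ hlfc (ι u)) ≠ 0
    rwa [h1]
  set L : Module.Dual ℂ E →ₗ[ℂ] Module.Dual ℂ V :=
    (TensorProduct.mk ℂ (Module.Dual ℂ E) V).compr₂ Λ
  have hL : ∀ f, L f ∈ a.finDual := by
    intro f
    refine Submodule.finiteDimensional_of_le (S₂ := LinearMap.range L) ?_
    rw [Submodule.span_le]
    rintro _ ⟨k, rfl⟩
    refine ⟨dualRep μ k f, LinearMap.ext fun v => ?_⟩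
    have h1 := hΛ k (f ⊗ₜ[ℂ] a.grp k⁻¹ v)
    rw [tensorRep_tmul, rep_apply_inv] at h1
    exact h1
  by_contra! h
  refine hΛu ?_
  have h0 : Λ = 0 := TensorProduct.ext' fun f v =>
    LinearMap.congr_fun (congrArg Subtype.val (h ⟨L f, hL f⟩)) v
  rw [h0, LinearMap.zero_apply]

/-- The `K̃`-finite functionals separate the points of an irreducible module. -/
theorem GKAct.IsIrreducible.eq_zero_of_dual (hirr : a.IsIrreducible) (ha : a.IsGKModule) {v : V}
    (hv : ∀ l : a.DualSpace, l.1 v = 0) : v = 0 := by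
  let S : Submodule ℂ V :=
    { carrier := {v | ∀ l : a.DualSpace, l.1 v = 0}
      zero_mem' := fun l => map_zero _
      add_mem' := fun hx hy l => by rw [map_add, hx l, hy l, add_zero]
      smul_mem' := fun c x hx l => by rw [map_smul, hx l, smul_zero] }
  -- The annihilator of V* is invariant, hence 0 or V, and it is not V because V* is nonzero.
  rcases hirr.2 S
    (fun X v hv l => by
      have h := hv ((a.contragredient ha).lie X l)
      rwa [a.contragredient_lie_apply, neg_eq_zero] at h)
    (fun k v hv l => by
      have h := hv ((a.contragredient ha).grp k⁻¹ l)
      rwa [a.contragredient_grp_apply, inv_inv] at h) with h | h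
  · exact (Submodule.eq_bot_iff _).1 h v hv
  · obtain ⟨l, hl⟩ := hirr.exists_dual_ne_zero ha.isSmooth
    refine absurd (Subtype.ext (LinearMap.ext fun w => ?_)) hl
    have hw : w ∈ S := h ▸ Submodule.mem_top
    exact hw l

variable {M : Type*} [AddCommGroup M] [Module ℂ M]

variable (a M) in
/-- The pairing of `M^* ⊗ V` and `V^* ⊗ M`. -/
def dualPairing : (Module.Dual ℂ M ⊗[ℂ] V) →ₗ[ℂ] Module.Dual ℂ (a.DualSpace ⊗[ℂ] M) :=
  TensorProduct.lift (LinearMap.mk₂ ℂ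
    (fun f v => (LinearMap.mul' ℂ ℂ).comp (TensorProduct.map (a.evalDual v) f))
    (fun _ _ _ => by rw [TensorProduct.map_add_right, LinearMap.comp_add])
    (fun _ _ _ => by rw [TensorProduct.map_smul_right, LinearMap.comp_smul])
    (fun _ _ _ => by rw [map_add, TensorProduct.map_add_left, LinearMap.comp_add])
    (fun _ _ _ => by rw [map_smul, TensorProduct.map_smul_left, LinearMap.comp_smul]))

theorem dualPairing_tmul (f : Module.Dual ℂ M) (v : V) (l : a.DualSpace) (m : M) :
    dualPairing a M (f ⊗ₜ[ℂ] v) (l ⊗ₜ[ℂ] m) = l.1 v * f m := rfl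

theorem dualPairing_invariant (ha : a.IsGKModule) (μ : D.ktilde →* Module.End ℂ M) (k : D.ktilde)
    (s : Module.Dual ℂ M ⊗[ℂ] V) (x : a.DualSpace ⊗[ℂ] M) :
    dualPairing a M (tensorRep (dualRep μ) a.grp k s) (tensorRep (a.contragredient ha).grp μ k x)
      = dualPairing a M s x := by
  induction s with
  | zero => simp
  | add s t hs ht => simp only [map_add, LinearMap.add_apply, hs, ht]
  | tmul f v =>
    induction x with
    | zero => simp
    | add s t hs ht => simp only [map_add, hs, ht]
    | tmul l m =>
      rw [tensorRep_tmul, tensorRep_tmul, dualPairing_tmul, dualPairing_tmul,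
        a.contragredient_grp_apply, dualRep_apply, rep_inv_apply, rep_inv_apply]

/-- Functionals on a factor separate the points of a tensor product. -/
theorem eq_zero_of_lTensor {W C : Type*} [AddCommGroup W] [Module ℂ W] [AddCommGroup C]
    [Module ℂ C] {t : W ⊗[ℂ] C} (h : ∀ f : Module.Dual ℂ C, f.lTensor W t = 0) : t = 0 := by
  set b := Module.Free.chooseBasis ℂ C
  refine (TensorProduct.equivFinsuppOfBasisRight b).map_eq_zero_iff.1 (Finsupp.ext fun i => ?_)
  have h1 : ∀ t : W ⊗[ℂ] C, TensorProduct.equivFinsuppOfBasisRight b t i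
      = TensorProduct.rid ℂ W ((b.coord i).lTensor W t) := by
    intro t
    induction t with
    | zero => simp
    | add x y hx hy => simp only [map_add, Finsupp.add_apply, hx, hy]
    | tmul w c => simp
  rw [h1, h, map_zero]
  rfl

/-- Pairing with f ⊗ v contracts M by f and evaluates at v. The functionals f separate the factor M,
and evaluations separate V*. -/
theorem dualPairing_separates {x : a.DualSpace ⊗[ℂ] M} (h : ∀ s, dualPairing a M s x = 0) :
    x = 0 := by
  refine eq_zero_of_lTensor fun f => (TensorProduct.rid ℂ a.DualSpace).map_eq_zero_iff.1
    (a.evalDual_separates _ fun v => ?_)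
  have h1 : ∀ x : a.DualSpace ⊗[ℂ] M, a.evalDual v (TensorProduct.rid ℂ a.DualSpace
      (f.lTensor a.DualSpace x)) = dualPairing a M (f ⊗ₜ[ℂ] v) x := by
    intro x
    induction x with
    | zero => simp
    | add x y hx hy => simp only [map_add, hx, hy]
    | tmul l m =>
      rw [LinearMap.lTensor_tmul, TensorProduct.rid_tmul, map_smul, smul_eq_mul, mul_comm,
        dualPairing_tmul, a.evalDual_apply]
  rw [h1, h]

/-- For an irreducible module `V` and a finite-dimensional representation `M` of `K̃`, the
invariant functionals on `V^* ⊗ M` are given by the invariants of `M^* ⊗ V`. -/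
theorem GKAct.IsIrreducible.exists_dualPairing_eq (hT : ∀ X ∈ D.lieG, Xᵀ ∈ D.lieG)
    (hirr : a.IsIrreducible) (ha : a.IsGKModule) [FiniteDimensional ℂ M]
    {μ : D.ktilde →* Module.End ℂ M} (hμ : IsLFC μ) (J : Module.Dual ℂ (a.DualSpace ⊗[ℂ] M))
    (hJ : ∀ k x, J (tensorRep (a.contragredient ha).grp μ k x) = J x) :
    ∃ s ∈ invariants (tensorRep (dualRep μ) a.grp), dualPairing a M s = J := by
  set H := invariants (tensorRep (dualRep μ) a.grp)
  have hH : FiniteDimensional ℂ H :=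
    hirr.finiteDimensional_invariants hT ha.isSmooth (dualRep_isLFC hμ)
  have hlfc : IsLFC (tensorRep (dualRep μ) a.grp) :=
    (dualRep_isLFC hμ).tensor ha.isSmooth.lfc fun _ _ _ => rfl
  have hlfc' : IsLFC (tensorRep (a.contragredient ha).grp μ) :=
    (a.contragredient_isSmooth ha).lfc.tensor hμ fun _ _ _ => rfl
  have hinv : ∀ s ∈ H, ∀ k x, dualPairing a M s (tensorRep (a.contragredient ha).grp μ k x)
      = dualPairing a M s x := by
    intro s hs k x
    conv_lhs => rw [← hs k]
    exact dualPairing_invariant ha μ k s x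
  have : Module.Free ℂ H := Module.Free.of_divisionRing ℂ H
  let b := Module.finBasis ℂ H
  -- By finite dimension it suffices that J x = 0 whenever all invariants s pair to zero with x. For
  -- the average x̄ of such an x and arbitrary s, one may replace s by its average and then x̄ by x,
  -- so s pairs to zero with x̄. Hence x̄ = 0 and J x = J x̄ = 0.
  have hspan : J ∈ Submodule.span ℂ (Set.range fun i => dualPairing a M (b i)) := by
    refine mem_span_of_iInf_ker_le_ker fun x hx => ?_
    rw [Submodule.mem_iInf] at hx
    have hx' : ∀ s ∈ H, dualPairing a M s x = 0 := by
      intro s hs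
      have h1 : H ≤ LinearMap.ker ((dualPairing a M).flip x) := by
        rw [← H.map_subtype_top, ← b.span_eq, Submodule.map_span, Submodule.span_le]
        rintro _ ⟨_, ⟨i, rfl⟩, rfl⟩
        exact hx i
      exact h1 hs
    rw [LinearMap.mem_ker, ← dual_average_of_invariant hlfc' hJ x]
    have h0 : average _ hlfc' x = 0 := by
      refine dualPairing_separates fun s => ?_
      have hs : average _ hlfc s ∈ H := fun k => apply_average hlfc k s
      have h1 := dual_average_of_invariant hlfc' (hinv _ hs) x
      rw [hx' _ hs] at h1
      have h2 : ∀ k s, (dualPairing a M).flip (average _ hlfc' x)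
          (tensorRep (dualRep μ) a.grp k s)
            = (dualPairing a M).flip (average _ hlfc' x) s := by
        intro k s
        have h3 := dualPairing_invariant ha μ k s (average _ hlfc' x)
        rwa [apply_average] at h3
      have h4 := dual_average_of_invariant hlfc h2 s
      rw [LinearMap.flip_apply, h1] at h4
      exact h4.symm
    rw [h0, map_zero]
  have hle : Submodule.span ℂ (Set.range fun i => dualPairing a M (b i))
      ≤ H.map (dualPairing a M) := by
    rw [Submodule.span_le]
    rintro _ ⟨i, rfl⟩
    exact Submodule.mem_map_of_mem (b i).2
  exact hle hspan

end Duality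

/-! ### Coinvariants of `V^* ⊗ Y` -/

section Contraction

variable {N : ℕ} {D : DualPair N} {V : Type*} [AddCommGroup V] [Module ℂ V] {a : GKAct D V}
  {C : Type*} [AddCommGroup C] [Module ℂ C]

variable (C) in
/-- Contraction of `V ⊗ C` with a functional on `V`. -/
def contract (l : Module.Dual ℂ V) : V ⊗[ℂ] C →ₗ[ℂ] C :=
  (TensorProduct.lid ℂ C).toLinearMap.comp (l.rTensor C)

theorem contract_tmul (l : Module.Dual ℂ V) (v : V) (c : C) :
    contract C l (v ⊗ₜ[ℂ] c) = l v • c := rfl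

theorem contract_rTensor (l : Module.Dual ℂ V) (S : Module.End ℂ V) (t : V ⊗[ℂ] C) :
    contract C l (S.rTensor C t) = contract C (l.comp S) t := by
  induction t with
  | zero => simp
  | add x y hx hy => simp only [map_add, hx, hy]
  | tmul v c => rfl

theorem contract_lTensor {C' : Type*} [AddCommGroup C'] [Module ℂ C'] (l : Module.Dual ℂ V)
    (S : C →ₗ[ℂ] C') (t : V ⊗[ℂ] C) :
    contract C' l (S.lTensor V t) = S (contract C l t) := by
  induction t with
  | zero => simp
  | add x y hx hy => simp only [map_add, hx, hy]
  | tmul v c => rw [LinearMap.lTensor_tmul, contract_tmul, contract_tmul, map_smul]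

theorem contract_add (l m : Module.Dual ℂ V) (t : V ⊗[ℂ] C) :
    contract C (l + m) t = contract C l t + contract C m t := by
  rw [contract, LinearMap.rTensor_add, LinearMap.comp_add]
  rfl

theorem contract_smul (c : ℂ) (l : Module.Dual ℂ V) (t : V ⊗[ℂ] C) :
    contract C (c • l) t = c • contract C l t := by
  rw [contract, LinearMap.rTensor_smul, LinearMap.comp_smul]
  rfl

theorem contract_neg (l : Module.Dual ℂ V) (t : V ⊗[ℂ] C) :
    contract C (-l) t = -contract C l t := by
  rw [← neg_one_smul ℂ l, contract_smul, neg_one_smul]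

theorem GKAct.contract_contragredient_lie (ha : a.IsGKModule) (X : D.lieG) (l : a.DualSpace)
    (t : V ⊗[ℂ] C) : contract C ((a.contragredient ha).lie X l).1 t
      = -contract C l.1 ((a.lie X).rTensor C t) := by
  rw [contract_rTensor, ← contract_neg]
  rfl

theorem GKAct.contract_contragredient_grp (ha : a.IsGKModule) (k : D.ktilde) (l : a.DualSpace)
    (t : V ⊗[ℂ] C) : contract C ((a.contragredient ha).grp k l).1 ((a.grp k).rTensor C t)
      = contract C l.1 t := by
  rw [contract_rTensor]
  congr 2
  refine LinearMap.ext fun v => ?_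
  change l.1 (a.grp k⁻¹ (a.grp k v)) = l.1 v
  rw [rep_inv_apply]

variable (V) in
/-- Contraction of `V ⊗ C` with a functional on `C`. -/
def contractRight (f : Module.Dual ℂ C) : V ⊗[ℂ] C →ₗ[ℂ] V :=
  (TensorProduct.rid ℂ V).toLinearMap.comp (f.lTensor V)

theorem contractRight_tmul (f : Module.Dual ℂ C) (v : V) (c : C) :
    contractRight V f (v ⊗ₜ[ℂ] c) = f c • v := by
  simp [contractRight]

theorem contractRight_rTensor (f : Module.Dual ℂ C) (S : Module.End ℂ V) (t : V ⊗[ℂ] C) :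
    contractRight V f (S.rTensor C t) = S (contractRight V f t) := by
  induction t with
  | zero => simp
  | add x y hx hy => simp only [map_add, hx, hy]
  | tmul v c => rw [LinearMap.rTensor_tmul, contractRight_tmul, contractRight_tmul, map_smul]

theorem dual_contractRight (l : Module.Dual ℂ V) (f : Module.Dual ℂ C) (t : V ⊗[ℂ] C) :
    l (contractRight V f t) = f (contract C l t) := by
  induction t with
  | zero => simp
  | add x y hx hy => simp only [map_add, hx, hy]
  | tmul v c =>
    rw [contractRight_tmul, contract_tmul, map_smul, map_smul, smul_eq_mul, smul_eq_mul, mul_comm]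

theorem eq_zero_of_contractRight {t : V ⊗[ℂ] C} (h : ∀ f, contractRight V f t = 0) : t = 0 :=
  eq_zero_of_lTensor fun f => (TensorProduct.rid ℂ V).map_eq_zero_iff.1 (h f)

/-- Functionals on C reduce the claim to vectors of V, which the K̃-finite functionals separate.
Linearity and equivariance of `coinvMap` are checked on contractions by means of this. -/
theorem GKAct.IsIrreducible.eq_of_contract (hirr : a.IsIrreducible) (ha : a.IsGKModule)
    {t t' : V ⊗[ℂ] C} (h : ∀ l : a.DualSpace, contract C l.1 t = contract C l.1 t') : t = t' := by
  rw [← sub_eq_zero]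
  refine eq_zero_of_contractRight fun f => hirr.eq_zero_of_dual ha fun l => ?_
  rw [dual_contractRight, map_sub, h, sub_self, map_zero]

end Contraction

/-! ### Jacobson density and stable subspaces of V ⊗ C. -/

section Density

variable {N : ℕ} {D : DualPair N} {V : Type*} [AddCommGroup V] [Module ℂ V] {a : GKAct D V}

variable (a) in
/-- The algebra of operators generated by the actions of `𝔤` and `K̃`. -/
def GKAct.opAlgebra : Subalgebra ℂ (Module.End ℂ V) :=
  Algebra.adjoin ℂ (Set.range a.lie ∪ Set.range a.grp)

theorem GKAct.IsIrreducible.isSimpleModule (hirr : a.IsIrreducible) :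
    IsSimpleModule a.opAlgebra V := by
  have := hirr.1
  rw [isSimpleModule_iff]
  refine { exists_pair_ne := ⟨⊥, ⊤, bot_ne_top⟩, eq_bot_or_eq_top := fun W => ?_ }
  rcases hirr.2 (W.restrictScalars ℂ)
    (fun X v hv => W.smul_mem ⟨a.lie X, Algebra.subset_adjoin (Or.inl ⟨X, rfl⟩)⟩ hv)
    (fun k v hv => W.smul_mem ⟨a.grp k, Algebra.subset_adjoin (Or.inr ⟨k, rfl⟩)⟩ hv) with h | h
  · exact Or.inl ((Submodule.restrictScalars_eq_bot_iff ℂ a.opAlgebra V).1 h)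
  · exact Or.inr ((Submodule.restrictScalars_eq_top_iff ℂ a.opAlgebra V).1 h)

/-- Every operator agrees on finitely many vectors with one generated by `𝔤` and `K̃`. -/
theorem GKAct.IsIrreducible.exists_opAlgebra_eq (hT : ∀ X ∈ D.lieG, Xᵀ ∈ D.lieG)
    (hirr : a.IsIrreducible) (ha : a.IsSmooth) (f : Module.End ℂ V) (s : Finset V) :
    ∃ r ∈ a.opAlgebra, ∀ v ∈ s, f v = r v := by
  have := hirr.isSimpleModule
  -- By Schur's lemma the commutant consists of scalars, so every linear f commutes with it and the
  -- density theorem applies to f.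
  have hcomm : ∀ (g : Module.End a.opAlgebra V) (v : V), f (g v) = g (f v) := by
    intro g v
    obtain ⟨c, hc⟩ := hirr.exists_eq_smul hT ha (T := g.restrictScalars ℂ)
      (fun X v => g.map_smul ⟨a.lie X, Algebra.subset_adjoin (Or.inl ⟨X, rfl⟩)⟩ v)
      (fun k v => g.map_smul ⟨a.grp k, Algebra.subset_adjoin (Or.inr ⟨k, rfl⟩)⟩ v)
    have hg : ∀ w, g w = c • w := fun w => LinearMap.congr_fun hc w
    rw [hg, hg, map_smul]
  let f' : Module.End (Module.End a.opAlgebra V) V :=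
    { toFun := f, map_add' := f.map_add, map_smul' := hcomm }
  obtain ⟨r, hr⟩ := jacobson_density f' s
  exact ⟨r, r.2, hr⟩

variable {C : Type*} [AddCommGroup C] [Module ℂ C]

/-- A subspace of `V ⊗ C` which is stable under the actions on `V` contains `V ⊗ c` for all
contractions `c` of its elements. -/
theorem GKAct.IsIrreducible.eq_top_of_contract (hT : ∀ X ∈ D.lieG, Xᵀ ∈ D.lieG)
    (hirr : a.IsIrreducible) (ha : a.IsSmooth) {R : Submodule ℂ (V ⊗[ℂ] C)}
    (hl : ∀ X, ∀ t ∈ R, (a.lie X).rTensor C t ∈ R) (hk : ∀ k, ∀ t ∈ R, (a.grp k).rTensor C t ∈ R)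
    (hR : ∀ c, c ∈ Submodule.span ℂ {c | ∃ (l : a.DualSpace) (t : V ⊗[ℂ] C),
      t ∈ R ∧ c = contract C l.1 t}) : R = ⊤ := by
  classical
  have hA : ∀ r ∈ a.opAlgebra, ∀ t ∈ R, r.rTensor C t ∈ R := by
    intro r hr
    induction hr using Algebra.adjoin_induction with
    | mem x hx =>
      rcases hx with ⟨X, rfl⟩ | ⟨k, rfl⟩
      · exact hl X
      · exact hk k
    | algebraMap c =>
      intro t ht
      rw [Algebra.algebraMap_eq_smul_one, LinearMap.rTensor_smul, Module.End.one_eq_id,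
        LinearMap.rTensor_id]
      exact R.smul_mem c ht
    | add x y _ _ hx hy =>
      intro t ht
      rw [LinearMap.rTensor_add]
      exact R.add_mem (hx t ht) (hy t ht)
    | mul x y _ _ hx hy =>
      intro t ht
      rw [LinearMap.rTensor_mul]
      exact hx _ (hy t ht)
  -- A tensor involves finitely many vectors of V, so density lets an arbitrary endomorphism of V
  -- act on it like an element of the algebra. Hence R is stable under all endomorphisms of V.
  have hfin : ∀ t : V ⊗[ℂ] C, ∃ s : Finset V, ∀ f g : Module.End ℂ V,
      (∀ v ∈ s, f v = g v) → f.rTensor C t = g.rTensor C t := by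
    intro t
    induction t with
    | zero => exact ⟨∅, fun f g _ => by simp⟩
    | add x y hx hy =>
      obtain ⟨s, hs⟩ := hx
      obtain ⟨s', hs'⟩ := hy
      refine ⟨s ∪ s', fun f g h => ?_⟩
      rw [map_add, map_add, hs f g fun v hv => h v (Finset.mem_union_left _ hv),
        hs' f g fun v hv => h v (Finset.mem_union_right _ hv)]
    | tmul v c =>
      refine ⟨{v}, fun f g h => ?_⟩
      rw [LinearMap.rTensor_tmul, LinearMap.rTensor_tmul, h v (Finset.mem_singleton_self v)]
  have hend : ∀ (f : Module.End ℂ V), ∀ t ∈ R, f.rTensor C t ∈ R := by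
    intro f t ht
    obtain ⟨s, hs⟩ := hfin t
    obtain ⟨r, hr, hrs⟩ := hirr.exists_opAlgebra_eq hT ha f s
    rw [hs f r hrs]
    exact hA r hr t ht
  -- Operators of rank one convert an element of R into w ⊗ c, with c a contraction of it.
  have hrank : ∀ (l : Module.Dual ℂ V) (w : V) (t : V ⊗[ℂ] C),
      (l.smulRight w).rTensor C t = w ⊗ₜ[ℂ] contract C l t := by
    intro l w t
    induction t with
    | zero => simp
    | add x y hx hy => simp only [map_add, TensorProduct.tmul_add, hx, hy]
    | tmul v c =>
      rw [LinearMap.rTensor_tmul, LinearMap.smulRight_apply, contract_tmul,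
        TensorProduct.smul_tmul]
  rw [eq_top_iff]
  intro t _
  induction t with
  | zero => exact R.zero_mem
  | add x y hx hy => exact R.add_mem (hx trivial) (hy trivial)
  | tmul w c =>
    have h1 : Submodule.span ℂ {c | ∃ (l : a.DualSpace) (t : V ⊗[ℂ] C),
        t ∈ R ∧ c = contract C l.1 t} ≤ R.comap (TensorProduct.mk ℂ V C w) := by
      rw [Submodule.span_le]
      rintro _ ⟨l, t, ht, rfl⟩
      change w ⊗ₜ[ℂ] contract C l.1 t ∈ R
      rw [← hrank]
      exact hend _ t ht
    exact h1 (hR c)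

end Density

/-! ### Classes in the coinvariants as contractions. -/

section Coinvariants

variable {N : ℕ} {D : DualPair N} {V Y : Type*} [AddCommGroup V] [Module ℂ V] [AddCommGroup Y]
  [Module ℂ Y] {a : GKAct D V} (ha : a.IsGKModule) (b : GKAct D Y)

/-- The class of `l ⊗ y` in the coinvariants of `V^* ⊗ Y`. -/
def coinvMk : a.DualSpace →ₗ[ℂ] Y →ₗ[ℂ]
    (a.DualSpace ⊗[ℂ] Y) ⧸ ((a.contragredient ha).tensor b).gkSpan :=
  (TensorProduct.mk ℂ a.DualSpace Y).compr₂ ((a.contragredient ha).tensor b).gkSpan.mkQ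

theorem mkQ_grp (k : D.ktilde) (e : a.DualSpace ⊗[ℂ] Y) :
    ((a.contragredient ha).tensor b).gkSpan.mkQ (((a.contragredient ha).tensor b).grp k e)
      = ((a.contragredient ha).tensor b).gkSpan.mkQ e :=
  (Submodule.Quotient.eq _).2 (Submodule.subset_span (Or.inr ⟨k, e, rfl⟩))

theorem coinvMk_grp (k : D.ktilde) (l : a.DualSpace) (y : Y) :
    coinvMk ha b ((a.contragredient ha).grp k l) (b.grp k y) = coinvMk ha b l y :=
  mkQ_grp ha b k (l ⊗ₜ[ℂ] y)

theorem coinvMk_lie (X : D.lieG) (l : a.DualSpace) (y : Y) :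
    coinvMk ha b l (b.lie X y) = -coinvMk ha b ((a.contragredient ha).lie X l) y := by
  have h : ((a.contragredient ha).tensor b).gkSpan.mkQ
      (((a.contragredient ha).tensor b).lie X (l ⊗ₜ[ℂ] y)) = 0 :=
    (Submodule.Quotient.mk_eq_zero _).2 (Submodule.subset_span (Or.inl ⟨X, _, rfl⟩))
  have h' : coinvMk ha b ((a.contragredient ha).lie X l) y + coinvMk ha b l (b.lie X y) = 0 := by
    rw [← h]
    exact (map_add ((a.contragredient ha).tensor b).gkSpan.mkQ _ _).symm
  exact eq_neg_of_add_eq_zero_right h'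

theorem coinv_hom_ext {W : Type*} [AddCommGroup W] [Module ℂ W]
    {f g : (a.DualSpace ⊗[ℂ] Y) ⧸ ((a.contragredient ha).tensor b).gkSpan →ₗ[ℂ] W}
    (h : ∀ l y, f (coinvMk ha b l y) = g (coinvMk ha b l y)) : f = g :=
  Submodule.linearMap_qext _ (TensorProduct.ext' h)

theorem mem_span_coinvMk
    (c : (a.DualSpace ⊗[ℂ] Y) ⧸ ((a.contragredient ha).tensor b).gkSpan) :
    c ∈ Submodule.span ℂ {c | ∃ l y, c = coinvMk ha b l y} := by
  obtain ⟨e, rfl⟩ := Submodule.mkQ_surjective _ c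
  induction e with
  | zero => rw [map_zero]; exact Submodule.zero_mem _
  | add x y hx hy => rw [map_add]; exact Submodule.add_mem _ hx hy
  | tmul l y => exact Submodule.subset_span ⟨l, y, rfl⟩

/-- Invariant maps on `V^* ⊗ Y` factor through the coinvariants. -/
def coinvLift {W : Type*} [AddCommGroup W] [Module ℂ W] (B : a.DualSpace →ₗ[ℂ] Y →ₗ[ℂ] W)
    (hl : ∀ X l y, B ((a.contragredient ha).lie X l) y + B l (b.lie X y) = 0)
    (hk : ∀ k l y, B ((a.contragredient ha).grp k l) (b.grp k y) = B l y) :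
    (a.DualSpace ⊗[ℂ] Y) ⧸ ((a.contragredient ha).tensor b).gkSpan →ₗ[ℂ] W :=
  ((a.contragredient ha).tensor b).gkSpan.liftQ (TensorProduct.lift B) (by
    rw [GKAct.gkSpan, Submodule.span_le]
    rintro _ (⟨X, e, rfl⟩ | ⟨k, e, rfl⟩)
    · change TensorProduct.lift B (((a.contragredient ha).tensor b).lie X e) = 0
      induction e with
      | zero => simp
      | add x y hx hy => rw [map_add, map_add, hx, hy, add_zero]
      | tmul l y =>
        refine (map_add (TensorProduct.lift B) (((a.contragredient ha).lie X l) ⊗ₜ[ℂ] y)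
          (l ⊗ₜ[ℂ] (b.lie X y))).trans ?_
        rw [TensorProduct.lift.tmul, TensorProduct.lift.tmul, hl]
    · change TensorProduct.lift B (((a.contragredient ha).tensor b).grp k e - e) = 0
      rw [map_sub, sub_eq_zero]
      induction e with
      | zero => simp
      | add x y hx hy => rw [map_add, map_add, map_add, hx, hy]
      | tmul l y =>
        refine (TensorProduct.lift.tmul (f' := B) ((a.contragredient ha).grp k l)
          (b.grp k y)).trans ?_
        rw [TensorProduct.lift.tmul, hk])

theorem coinvLift_coinvMk {W : Type*} [AddCommGroup W] [Module ℂ W]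
    (B : a.DualSpace →ₗ[ℂ] Y →ₗ[ℂ] W)
    (hl : ∀ X l y, B ((a.contragredient ha).lie X l) y + B l (b.lie X y) = 0)
    (hk : ∀ k l y, B ((a.contragredient ha).grp k l) (b.grp k y) = B l y) (l : a.DualSpace)
    (y : Y) : coinvLift ha b B hl hk (coinvMk ha b l y) = B l y := rfl

theorem dual_lid_rTensor {M : Type*} [AddCommGroup M] [Module ℂ M] (m : M) (l : a.DualSpace)
    (s : Module.Dual ℂ M ⊗[ℂ] V) :
    l.1 (TensorProduct.lid ℂ V ((Module.Dual.eval ℂ M m).rTensor V s))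
      = dualPairing a M s (l ⊗ₜ[ℂ] m) := by
  induction s with
  | zero => simp
  | add x y hx hy => simp only [map_add, LinearMap.add_apply, hx, hy]
  | tmul f v =>
    rw [dualPairing_tmul, LinearMap.rTensor_tmul, TensorProduct.lid_tmul, map_smul, smul_eq_mul,
      mul_comm]
    rfl

variable {b}

/-- For irreducible `V`, the map `l ↦ [l ⊗ y]` is contraction with an element of
`V ⊗ (V^* ⊗ Y)_{𝔤, K}`. -/
theorem GKAct.IsIrreducible.exists_contract_eq (hT : ∀ X ∈ D.lieG, Xᵀ ∈ D.lieG)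
    (hirr : a.IsIrreducible) (hb : b.IsSmooth) (y : Y) :
    ∃ t : V ⊗[ℂ] ((a.DualSpace ⊗[ℂ] Y) ⧸ ((a.contragredient ha).tensor b).gkSpan),
      ∀ l : a.DualSpace, contract _ l.1 t = coinvMk ha b l y := by
  -- The class map π on V* ⊗ F is K̃-invariant, so every functional on its range gives an invariant
  -- functional on V* ⊗ F, which comes from an invariant of F* ⊗ V. These invariants are finite in
  -- dimension, and so is the range.
  set F := Submodule.span ℂ (Set.range fun k : D.ktilde => b.grp k y)
  have hFf : FiniteDimensional ℂ F := finiteDimensional_of_mem_finCont (hb.lfc y)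
  have hF : ∀ k, ∀ v ∈ F, b.grp k v ∈ F := b.grp_mem_span_orbit y
  set μ := restrictRep b.grp F hF
  have hμ : IsLFC μ := restrictRep_isLFC hb.lfc F hF
  set π : a.DualSpace ⊗[ℂ] F →ₗ[ℂ] _ :=
    ((a.contragredient ha).tensor b).gkSpan.mkQ.comp (F.subtype.lTensor a.DualSpace)
  have hπ : ∀ k x, π (tensorRep (a.contragredient ha).grp μ k x) = π x := by
    intro k x
    induction x with
    | zero => simp
    | add x y hx hy => simp only [map_add, hx, hy]
    | tmul l m => exact coinvMk_grp ha b k l m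
  have hJ : ∀ ν : Module.Dual ℂ (LinearMap.range π),
      ∃ s ∈ invariants (tensorRep (dualRep μ) a.grp),
        dualPairing a F s = ν.comp π.rangeRestrict := by
    intro ν
    refine hirr.exists_dualPairing_eq hT ha hμ _ fun k x => ?_
    exact congrArg ν (Subtype.ext (hπ k x))
  have hfree : Module.Free ℂ (LinearMap.range π) := Module.Free.of_divisionRing _ _
  have hCF : FiniteDimensional ℂ (LinearMap.range π) := by
    have hH : FiniteDimensional ℂ (invariants (tensorRep (dualRep μ) a.grp)) :=
      hirr.finiteDimensional_invariants hT ha.isSmooth (dualRep_isLFC hμ)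
    have h1 : FiniteDimensional ℂ ((invariants (tensorRep (dualRep μ) a.grp)).map
      (dualPairing a F)) := inferInstance
    have h2 : LinearMap.range π.rangeRestrict.dualMap
        ≤ (invariants (tensorRep (dualRep μ) a.grp)).map (dualPairing a F) := by
      rintro _ ⟨ν, rfl⟩
      obtain ⟨s, hs, h⟩ := hJ ν
      exact ⟨s, hs, h⟩
    have h3 : FiniteDimensional ℂ (LinearMap.range π.rangeRestrict.dualMap) :=
      Submodule.finiteDimensional_of_le h2
    have h4 : Function.Injective π.rangeRestrict.dualMap :=
      LinearMap.dualMap_injective_of_surjective π.surjective_rangeRestrict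
    have h5 : FiniteDimensional ℂ (Module.Dual ℂ (LinearMap.range π)) :=
      (LinearEquiv.ofInjective _ h4).symm.finiteDimensional
    exact (Module.finite_dual_iff ℂ).1 h5
  -- The j-th coordinate of [l ⊗ m] is the pairing of l ⊗ m with s j ∈ F* ⊗ V. Evaluating s j at y
  -- gives a vector v_j of V with l(v_j) the j-th coordinate of [l ⊗ y], and ∑ v_j ⊗ c_j is the
  -- required tensor.
  let c := Module.finBasis ℂ (LinearMap.range π)
  choose s hs hsJ using fun j => hJ (c.coord j)
  let y₀ : F := ⟨y, b.mem_span_orbit y⟩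
  refine ⟨∑ j, TensorProduct.lid ℂ V ((Module.Dual.eval ℂ F y₀).rTensor V (s j))
    ⊗ₜ[ℂ] (c j : (a.DualSpace ⊗[ℂ] Y) ⧸ ((a.contragredient ha).tensor b).gkSpan), fun l => ?_⟩
  rw [map_sum]
  have h1 : ∀ j, contract _ l.1 (TensorProduct.lid ℂ V ((Module.Dual.eval ℂ F y₀).rTensor V (s j))
      ⊗ₜ[ℂ] (c j : (a.DualSpace ⊗[ℂ] Y) ⧸ ((a.contragredient ha).tensor b).gkSpan))
      = ((c.repr (π.rangeRestrict (l ⊗ₜ[ℂ] y₀)) j • c j : LinearMap.range π) :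
        (a.DualSpace ⊗[ℂ] Y) ⧸ ((a.contragredient ha).tensor b).gkSpan) := by
    intro j
    rw [contract_tmul, dual_lid_rTensor, hsJ]
    rfl
  rw [Finset.sum_congr rfl fun j _ => h1 j, ← Submodule.coe_sum, c.sum_repr]
  rfl

end Coinvariants

/-! ### Full theta lifts -/

section UniversalQuotient

variable {N : ℕ} {D : DualPair N} {V Y : Type*} [AddCommGroup V] [Module ℂ V] [AddCommGroup Y]
  [Module ℂ Y] {a : GKAct D V} {b : GKAct D Y} (hT : ∀ X ∈ D.lieG, Xᵀ ∈ D.lieG)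
  (hirr : a.IsIrreducible) (ha : a.IsGKModule) (hb : b.IsSmooth)

/-- The map `Y → V ⊗ (V^* ⊗ Y)_{𝔤, K}` whose contractions are `y ↦ [l ⊗ y]`. -/
def coinvMap :
    Y →ₗ[ℂ] V ⊗[ℂ] ((a.DualSpace ⊗[ℂ] Y) ⧸ ((a.contragredient ha).tensor b).gkSpan) where
  toFun y := (hirr.exists_contract_eq ha hT hb y).choose
  map_add' y z := hirr.eq_of_contract ha fun l => by
    rw [map_add, (hirr.exists_contract_eq ha hT hb _).choose_spec,
      (hirr.exists_contract_eq ha hT hb y).choose_spec,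
      (hirr.exists_contract_eq ha hT hb z).choose_spec, map_add]
  map_smul' c y := hirr.eq_of_contract ha fun l => by
    rw [map_smul, (hirr.exists_contract_eq ha hT hb _).choose_spec,
      (hirr.exists_contract_eq ha hT hb y).choose_spec, map_smul, RingHom.id_apply]

theorem contract_coinvMap (l : a.DualSpace) (y : Y) :
    contract _ l.1 (coinvMap hT hirr ha hb y) = coinvMk ha b l y :=
  (hirr.exists_contract_eq ha hT hb y).choose_spec l

theorem coinvMap_lie (X : D.lieG) (y : Y) : coinvMap hT hirr ha hb (b.lie X y)
    = (a.lie X).rTensor _ (coinvMap hT hirr ha hb y) := by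
  refine hirr.eq_of_contract ha fun l => ?_
  rw [contract_coinvMap, coinvMk_lie, ← contract_coinvMap hT hirr ha hb,
    GKAct.contract_contragredient_lie, neg_neg]

theorem coinvMap_grp (k : D.ktilde) (y : Y) : coinvMap hT hirr ha hb (b.grp k y)
    = (a.grp k).rTensor _ (coinvMap hT hirr ha hb y) := by
  refine hirr.eq_of_contract ha fun l => ?_
  obtain ⟨l, rfl⟩ : ∃ l', l = (a.contragredient ha).grp k l' :=
    ⟨(a.contragredient ha).grp k⁻¹ l, (rep_apply_inv _ k l).symm⟩
  rw [contract_coinvMap, coinvMk_grp, GKAct.contract_contragredient_grp, contract_coinvMap]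

/-- Both sides have the same contractions. For the Fock model S is an operator of the other member
of the dual pair and S' the operator it induces on the coinvariants. -/
theorem coinvMap_lTensor {S : Module.End ℂ Y}
    {S' : Module.End ℂ ((a.DualSpace ⊗[ℂ] Y) ⧸ ((a.contragredient ha).tensor b).gkSpan)}
    (hS : ∀ l y, S' (coinvMk ha b l y) = coinvMk ha b l (S y)) (y : Y) :
    coinvMap hT hirr ha hb (S y) = S'.lTensor V (coinvMap hT hirr ha hb y) := by
  refine hirr.eq_of_contract ha fun l => ?_
  rw [contract_coinvMap, contract_lTensor, contract_coinvMap, hS]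

/-- The intertwining operator `Y → V` defined by a functional on the coinvariants. -/
theorem contractRight_coinvMap_isIntertwining
    (f : Module.Dual ℂ ((a.DualSpace ⊗[ℂ] Y) ⧸ ((a.contragredient ha).tensor b).gkSpan)) :
    IsIntertwining b a ((contractRight V f).comp (coinvMap hT hirr ha hb)) := by
  refine ⟨fun X y => ?_, fun k y => ?_⟩
  · rw [LinearMap.comp_apply, coinvMap_lie, contractRight_rTensor]
    rfl
  · rw [LinearMap.comp_apply, coinvMap_grp, contractRight_rTensor]
    rfl

/-- For an intertwining T and l in V*, the number l (T y) is an invariant pairing and factors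
through the class [l ⊗ y], a contraction of `coinvMap`. Conversely, contracting `coinvMap` with a
functional on the coinvariants is itself intertwining, and these functionals separate. -/
theorem coinvMap_eq_zero_iff (y : Y) : coinvMap hT hirr ha hb y = 0 ↔
    ∀ T : Y →ₗ[ℂ] V, IsIntertwining b a T → T y = 0 := by
  constructor
  · intro hy T hTi
    refine hirr.eq_zero_of_dual ha fun l => ?_
    let B : a.DualSpace →ₗ[ℂ] Y →ₗ[ℂ] ℂ := (a.evalDual.comp T).flip
    have hB : ∀ l y, B l y = l.1 (T y) := fun _ _ => rfl
    have h1 := coinvLift_coinvMk ha b B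
      (fun X l y => by
        rw [hB, hB, hTi.1, a.contragredient_lie_apply, neg_add_cancel])
      (fun k l y => by
        rw [hB, hB, hTi.2, a.contragredient_grp_apply, rep_inv_apply]) l y
    rw [← contract_coinvMap hT hirr ha hb, hy, map_zero, map_zero, hB] at h1
    exact h1.symm
  · intro h
    exact eq_zero_of_contractRight fun f =>
      h _ (contractRight_coinvMap_isIntertwining hT hirr ha hb f)

/-- The range is stable under the actions on V, and its contractions are the classes [l ⊗ y], which
span the coinvariants. -/
theorem coinvMap_range : LinearMap.range (coinvMap hT hirr ha hb) = ⊤ := by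
  refine hirr.eq_top_of_contract hT ha.isSmooth ?_ ?_ fun c => ?_
  · rintro X _ ⟨y, rfl⟩
    exact ⟨b.lie X y, coinvMap_lie hT hirr ha hb X y⟩
  · rintro k _ ⟨y, rfl⟩
    exact ⟨b.grp k y, coinvMap_grp hT hirr ha hb k y⟩
  · refine Submodule.span_mono ?_ (mem_span_coinvMk ha b c)
    rintro _ ⟨l, y, rfl⟩
    exact ⟨l, _, ⟨y, rfl⟩, (contract_coinvMap hT hirr ha hb l y).symm⟩

variable {T : Type*} [AddCommGroup T] [Module ℂ T]

/-- The map from the coinvariants defined by an equivariant map `Y → V ⊗ T`. -/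
def coinvDesc (p : Y →ₗ[ℂ] V ⊗[ℂ] T) (hpl : ∀ X y, p (b.lie X y) = (a.lie X).rTensor T (p y))
    (hpk : ∀ k y, p (b.grp k y) = (a.grp k).rTensor T (p y)) :
    (a.DualSpace ⊗[ℂ] Y) ⧸ ((a.contragredient ha).tensor b).gkSpan →ₗ[ℂ] T :=
  coinvLift ha b
    (LinearMap.mk₂ ℂ (fun (l : a.DualSpace) y => contract T l.1 (p y))
      (fun l l' y => contract_add l.1 l'.1 (p y)) (fun c l y => contract_smul c l.1 (p y))
      (fun l y z => by rw [map_add, map_add]) (fun c l y => by rw [map_smul, map_smul]))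
    (fun X l y => by
      change contract T ((a.contragredient ha).lie X l).1 (p y)
        + contract T l.1 (p (b.lie X y)) = 0
      rw [hpl, a.contract_contragredient_lie, neg_add_cancel])
    (fun k l y => by
      change contract T ((a.contragredient ha).grp k l).1 (p (b.grp k y)) = contract T l.1 (p y)
      rw [hpk, a.contract_contragredient_grp])

theorem coinvDesc_coinvMk (p : Y →ₗ[ℂ] V ⊗[ℂ] T)
    (hpl : ∀ X y, p (b.lie X y) = (a.lie X).rTensor T (p y))
    (hpk : ∀ k y, p (b.grp k y) = (a.grp k).rTensor T (p y)) (l : a.DualSpace) (y : Y) :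
    coinvDesc ha p hpl hpk (coinvMk ha b l y) = contract T l.1 (p y) := rfl

include hT hirr hb in
/-- The map `coinvDesc` is bijective if `p` is surjective and its kernel is the intersection of the
kernels of all intertwining operators. -/
theorem coinvDesc_bijective (p : Y →ₗ[ℂ] V ⊗[ℂ] T)
    (hpl : ∀ X y, p (b.lie X y) = (a.lie X).rTensor T (p y))
    (hpk : ∀ k y, p (b.grp k y) = (a.grp k).rTensor T (p y)) (hs : Function.Surjective p)
    (hker : ∀ y, p y = 0 → ∀ S : Y →ₗ[ℂ] V, IsIntertwining b a S → S y = 0) :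
    Function.Bijective (coinvDesc ha p hpl hpk) := by
  have := hirr.1
  obtain ⟨v₀, hv₀⟩ := exists_ne (0 : V)
  obtain ⟨l₀, hl₀⟩ : ∃ l : a.DualSpace, l.1 v₀ ≠ 0 := by
    by_contra! h
    exact hv₀ (hirr.eq_zero_of_dual ha h)
  constructor
  · rw [← LinearMap.ker_eq_bot, LinearMap.ker_eq_bot']
    intro c hc
    refine (Module.forall_dual_apply_eq_zero_iff ℂ c).1 fun f => ?_
    set S := (contractRight V f).comp (coinvMap hT hirr ha hb)
    have hS : IsIntertwining b a S := contractRight_coinvMap_isIntertwining hT hirr ha hb f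
    -- The section q is merely linear. As S vanishes on the kernel of p, the composite S ∘ q is
    -- independent of the choice and inherits equivariance from S and p.
    obtain ⟨q, hq⟩ := p.exists_rightInverse_of_surjective (LinearMap.range_eq_top.2 hs)
    have hpq : ∀ t, p (q t) = t := fun t => LinearMap.congr_fun hq t
    have hSq : ∀ y, S (q (p y)) = S y := by
      intro y
      have h := hker (q (p y) - y) (by rw [map_sub, hpq, sub_self]) S hS
      rwa [map_sub, sub_eq_zero] at h
    -- For fixed t this is an endomorphism of the irreducible V, hence a scalar.
    have hscal : ∀ t : T, ∃ z : ℂ, ∀ v, S (q (v ⊗ₜ[ℂ] t)) = z • v := by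
      intro t
      obtain ⟨z, hz⟩ := hirr.exists_eq_smul hT ha.isSmooth
        (T := (S.comp q).comp ((TensorProduct.mk ℂ V T).flip t))
        (fun X v => by
          change S (q ((a.lie X).rTensor T (v ⊗ₜ[ℂ] t))) = a.lie X (S (q (v ⊗ₜ[ℂ] t)))
          rw [← hS.1, ← hSq (b.lie X _), hpl, hpq])
        (fun k v => by
          change S (q ((a.grp k).rTensor T (v ⊗ₜ[ℂ] t))) = a.grp k (S (q (v ⊗ₜ[ℂ] t)))
          rw [← hS.2, ← hSq (b.grp k _), hpk, hpq])
      exact ⟨z, fun v => LinearMap.congr_fun hz v⟩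
    -- Reading off the scalar at v₀ with l₀ shows that it is linear in t.
    let ν : Module.Dual ℂ T := (l₀.1 v₀)⁻¹ •
      ((l₀.1.comp (S.comp q)).comp (TensorProduct.mk ℂ V T v₀))
    have hν : ∀ v t, S (q (v ⊗ₜ[ℂ] t)) = ν t • v := by
      intro v t
      obtain ⟨z, hz⟩ := hscal t
      have h1 : ν t = z := by
        change (l₀.1 v₀)⁻¹ * l₀.1 (S (q (v₀ ⊗ₜ[ℂ] t))) = z
        rw [hz, map_smul, smul_eq_mul]
        field_simp
      rw [hz, h1]
    have hν' : ∀ t, S (q t) = contractRight V ν t := by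
      intro t
      induction t with
      | zero => simp
      | add x y hx hy => simp only [map_add, hx, hy]
      | tmul v t => rw [hν, contractRight_tmul]
    -- Thus every functional on the coinvariants factors through `coinvDesc`, so nothing nonzero
    -- lies in its kernel.
    have hf : f = ν.comp (coinvDesc ha p hpl hpk) := by
      refine coinv_hom_ext ha b fun l y => ?_
      rw [LinearMap.comp_apply, coinvDesc_coinvMk, ← dual_contractRight, ← hν', hSq,
        ← contract_coinvMap hT hirr ha hb, ← dual_contractRight]
      rfl
    rw [hf, LinearMap.comp_apply, hc, map_zero]
  · intro t
    obtain ⟨y, hy⟩ := hs (v₀ ⊗ₜ[ℂ] ((l₀.1 v₀)⁻¹ • t))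
    refine ⟨coinvMk ha b l₀ y, ?_⟩
    rw [coinvDesc_coinvMk, hy, contract_tmul, smul_smul, mul_inv_cancel₀ hl₀, one_smul]

end UniversalQuotient

/-! ### Existence and uniqueness of the theta lift. -/

section Theta

variable {N : ℕ} (D : DualPair N) (hD : D.Adapted) {V' : Type*} [AddCommGroup V'] [Module ℂ V']
  (ρ' : GKAct D.swap V') (h : ρ'.IsGKModule) (hirr : ρ'.IsIrreducible)

theorem mem_howeKernel_iff (y : Fock N) : y ∈ D.howeKernel ρ' ↔
    ∀ T : Fock N →ₗ[ℂ] V', IsIntertwining D.swap.fock ρ' T → T y = 0 := by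
  simp [DualPair.howeKernel]

-- The map `coinvMap` kills exactly the Howe kernel and is surjective, so it descends to the
-- required isomorphism. Compatibility with 𝔤 and K̃ is naturality, as their action on the
-- coinvariants is induced from the Fock model.
include hD hirr in
theorem isFullThetaLift_coinvariants : D.IsFullThetaLift ρ' (D.coinvariants ρ' h) := by
  have hT : ∀ X ∈ D.swap.lieG, Xᵀ ∈ D.swap.lieG := fun X hX =>
    transpose_mem_lieG D.swap (swap_adapted D hD) hX
  have hb := fock_isSmooth D.swap
  have hker : D.howeKernel ρ' = LinearMap.ker (coinvMap hT hirr h hb) := by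
    ext y
    rw [mem_howeKernel_iff, LinearMap.mem_ker, coinvMap_eq_zero_iff]
  refine ⟨coinvariants_isGKModule D ρ' h,
    (Submodule.quotEquivOfEq _ _ hker).trans ((coinvMap hT hirr h hb).quotKerEquivOfSurjective
      (LinearMap.range_eq_top.1 (coinvMap_range hT hirr h hb))), ?_, ?_, ?_, ?_⟩
  · exact fun X' y => coinvMap_lie hT hirr h hb X' y
  · exact fun k' y => coinvMap_grp hT hirr h hb k' y
  · exact fun X y => coinvMap_lTensor hT hirr h hb (S := D.fock.lie X)
      (S' := (D.coinvariants ρ' h).lie X) (fun _ _ => rfl) y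
  · exact fun k y => coinvMap_lTensor hT hirr h hb (S := D.fock.grp k)
      (S' := (D.coinvariants ρ' h).grp k) (fun _ _ => rfl) y

-- The given isomorphism lifts to a surjection of the Fock model onto ρ' ⊗ Θ with the Howe kernel as
-- its kernel, so `coinvDesc_bijective` applies. Contraction on the factor ρ' commutes with
-- operators on Θ, which gives equivariance.
include hD hirr in
theorem gkIso_of_isFullThetaLift {T : Type*} [AddCommGroup T] [Module ℂ T] {Θ : GKAct D T}
    (hΘ : D.IsFullThetaLift ρ' Θ) : GKIso Θ (D.coinvariants ρ' h) := by
  have hT : ∀ X ∈ D.swap.lieG, Xᵀ ∈ D.swap.lieG := fun X hX =>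
    transpose_mem_lieG D.swap (swap_adapted D hD) hX
  obtain ⟨-, e, h1, h2, h3, h4⟩ := hΘ
  let p : Fock N →ₗ[ℂ] V' ⊗[ℂ] T := e.toLinearMap.comp (D.howeKernel ρ').mkQ
  have hb := coinvDesc_bijective hT hirr h (fock_isSmooth D.swap) p h1 h2
    (e.surjective.comp (Submodule.mkQ_surjective _)) (fun y hy => by
      have hy' : (D.howeKernel ρ').mkQ y = 0 := e.map_eq_zero_iff.1 hy
      exact (mem_howeKernel_iff D ρ' y).1 ((Submodule.Quotient.mk_eq_zero _).1 hy'))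
  refine GKIso.symm ⟨LinearEquiv.ofBijective _ hb, fun X c => ?_, fun k c => ?_⟩
  · refine LinearMap.congr_fun (f := (coinvDesc h p h1 h2).comp ((D.coinvariants ρ' h).lie X))
      (g := (Θ.lie X).comp (coinvDesc h p h1 h2)) (coinv_hom_ext h _ fun l y => ?_) c
    change contract T l.1 (p (D.fock.lie X y)) = Θ.lie X (contract T l.1 (p y))
    rw [← contract_lTensor]
    exact congrArg _ (h3 X y)
  · refine LinearMap.congr_fun (f := (coinvDesc h p h1 h2).comp ((D.coinvariants ρ' h).grp k))
      (g := (Θ.grp k).comp (coinvDesc h p h1 h2)) (coinv_hom_ext h _ fun l y => ?_) c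
    change contract T l.1 (p (D.fock.grp k y)) = Θ.grp k (contract T l.1 (p y))
    rw [← contract_lTensor]
    exact congrArg _ (h4 k y)

end Theta

end ThetaLift

end

theorem mainTheorem6 {N : ℕ} (D : ThetaLift.DualPair N) (hD : D.Adapted)
    {V' : Type*} [AddCommGroup V'] [Module ℂ V'] (ρ' : ThetaLift.GKAct D.swap V')
    (hρ' : ρ'.IsGKModule) (hirr : ρ'.IsIrreducible) :
    D.IsFullThetaLift ρ' (D.coinvariants ρ' hρ') ∧
      (∀ {T : Type*} [AddCommGroup T] [Module ℂ T] (Θ : ThetaLift.GKAct D T),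
        D.IsFullThetaLift ρ' Θ →
          ThetaLift.GKIso Θ (D.coinvariants ρ' hρ') ∧
            ThetaLift.GKIso Θ (D.pCoinvariantsInvariants ρ' hρ')) ∧
      ThetaLift.GKIso (D.coinvariants ρ' hρ') (D.pCoinvariantsInvariants ρ' hρ') := by
  have hc := ThetaLift.gkIso_coinvariants_pCoinvariantsInvariants D ρ' hρ' hD
  refine ⟨ThetaLift.isFullThetaLift_coinvariants D hD ρ' hρ' hirr, fun Θ hΘ => ?_, hc⟩
  have h := ThetaLift.gkIso_of_isFullThetaLift D hD ρ' hρ' hirr hΘ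
  exact ⟨h, h.trans hc⟩
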